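/- Let $M$ be a smooth manifold of dimension $n\ge 3$ and let $q\in\mathbb R$, $q\neq 0,1$. Let $\alpha=\sqrt{a_{ij}(x)y^iy^j}$ and $\bar\alpha=\sqrt{\bar a_{ij}(x)y^iy^j}$ be two smooth Riemannian metrics on $M$, and let $\beta=b_i(x)y^i$ and $\bar\beta=\bar b_i(x)y^i$ be two smooth 1-forms on $M$ which vanish at no point and are collinear at every point. Suppose that $\|\beta\|_\alpha<1$ and that $F=\frac{(\alpha+\beta)^q}{\alpha^{q-1}}$ is a Finsler metric on $M$ (smooth and positive on the slit tangent bundle, positively $1$-homogeneous, with positive definite fundamental tensor), and let $\bar F=\frac{\bar\alpha^2}{\bar\beta}$ be the Kropina metric, defined on the cone $\{\bar\beta>0\}\subset TM$. The spray coefficients of a Finsler metric $L$ are $\frac14 g^{il}\{\frac{\partial^2L^2}{\partial x^k\partial y^l}y^k-\frac{\partial L^2}{\partial x^l}\}$, where $g_{ij}=\frac12\frac{\partial^2L^2}{\partial y^i\partial y^j}$ and $(g^{ij})=(g_{ij})^{-1}$. Let $G^i$, $\bar G^i$, $G^i_\alpha$, $\bar G^i_{\bar\alpha}$ be those of $F$,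 $\bar F$, $\alpha$, $\bar\alpha$. $F$ is projectively equivalent to $\bar F$ if there is a scalar function $P=P(x,y)$ on $\{\bar\beta>0\}$ such that $G^i=\bar G^i+Py^i$ there, in all local coordinates. Let $b_{i|j}$ be the coefficients of the covariant derivative of $\beta$ with respect to the Levi-Civita connection of $\alpha$, and put $r_{ij}=\frac12(b_{i|j}+b_{j|i})$, $s_{ij}=\frac12(b_{i|j}-b_{j|i})$, $r_{00}=r_{ij}y^iy^j$, $b^i=a^{ij}b_j$, $b^2=b^ib_i=\|\beta\|_\alpha^2$, $s_j=b^is_{ij}$, $s^i=a^{ij}s_j$. Barred quantities are formed in the same way from $\bar\alpha$ and $\bar\beta$. Then $F$ is projectively equivalent to $\bar F$ if and only if the following three conditions hold in all local coordinates: 1. there is a smooth 1-form $\theta=\theta_i(x)y^i$ on $M$ such that, for all $y\neq0$, $$G^i_\alpha+\frac12\,\frac{q(q-1)\alpha^2r_{00}}{(1-q^2)\beta^2+(2-q)\alpha\beta+[1+q(q-1)b^2]\alpha^2}\,b^i=\bar G^i_{\bar\alpha}+\frac1{2\bar b^2}\left(\bar\alpha^2\bar s^i+\bar r_{00}\bar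 b^i\right)+\theta y^i;$$ 2. $s_{ij}=0$, i.e. $\beta$ is closed; 3. $\bar s_{ij}=\frac1{\bar b^2}\left(\bar b_i\bar s_j-\bar b_j\bar s_i\right)$. -/

import Mathlib

open scoped Manifold ContDiff Bundle

noncomputable section

namespace Finsler

/-! ### Tensor calculus of a Riemannian metric `a` and a 1-form `b` in local coordinates

`a p` is the matrix `(a_ij(p))` and `b p` the tuple `(b_i(p))` at the coordinate point `p`. -/

/-- The partial derivative `∂f/∂x^k` at `p`. -/
def partialDeriv {n : ℕ} (f : EuclideanSpace ℝ (Fin n) → ℝ) (k : Fin n)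
    (p : EuclideanSpace ℝ (Fin n)) : ℝ :=
  fderiv ℝ f p (EuclideanSpace.single k 1)

/-- The Christoffel symbols `Γ^k_ij` of the Levi-Civita connection of `a`. -/
def christoffel {n : ℕ} (a : EuclideanSpace ℝ (Fin n) → Matrix (Fin n) (Fin n) ℝ)
    (p : EuclideanSpace ℝ (Fin n)) (k i j : Fin n) : ℝ :=
  (1 / 2) * ∑ l, (a p)⁻¹ k l *
    (partialDeriv (fun x => a x j l) i p + partialDeriv (fun x => a x i l) j p
      - partialDeriv (fun x => a x i j) l p)

/-- The covariant derivative `b_{i|j} = ∂b_i/∂x^j - Γ^k_ij b_k`. -/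
def covDeriv {n : ℕ} (a : EuclideanSpace ℝ (Fin n) → Matrix (Fin n) (Fin n) ℝ)
    (b : EuclideanSpace ℝ (Fin n) → Fin n → ℝ) (p : EuclideanSpace ℝ (Fin n))
    (i j : Fin n) : ℝ :=
  partialDeriv (fun x => b x i) j p - ∑ k, christoffel a p k i j * b p k

/-- `r_ij = (b_{i|j} + b_{j|i}) / 2`. -/
def rLow {n : ℕ} (a : EuclideanSpace ℝ (Fin n) → Matrix (Fin n) (Fin n) ℝ)
    (b : EuclideanSpace ℝ (Fin n) → Fin n → ℝ) (p : EuclideanSpace ℝ (Fin n))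
    (i j : Fin n) : ℝ :=
  (1 / 2) * (covDeriv a b p i j + covDeriv a b p j i)

/-- `s_ij = (b_{i|j} - b_{j|i}) / 2`. -/
def sLow {n : ℕ} (a : EuclideanSpace ℝ (Fin n) → Matrix (Fin n) (Fin n) ℝ)
    (b : EuclideanSpace ℝ (Fin n) → Fin n → ℝ) (p : EuclideanSpace ℝ (Fin n))
    (i j : Fin n) : ℝ :=
  (1 / 2) * (covDeriv a b p i j - covDeriv a b p j i)

/-- `r_00 = r_ij y^i y^j`. -/
def r00 {n : ℕ} (a : EuclideanSpace ℝ (Fin n) → Matrix (Fin n) (Fin n) ℝ)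
    (b : EuclideanSpace ℝ (Fin n) → Fin n → ℝ) (p y : EuclideanSpace ℝ (Fin n)) : ℝ :=
  ∑ i, ∑ j, rLow a b p i j * y i * y j

/-- Raising an index: `w^i = a^{ij} w_j`. -/
def raise {n : ℕ} (a : EuclideanSpace ℝ (Fin n) → Matrix (Fin n) (Fin n) ℝ)
    (p : EuclideanSpace ℝ (Fin n)) (w : Fin n → ℝ) (i : Fin n) : ℝ :=
  ∑ j, (a p)⁻¹ i j * w j

/-- `b^2 = a^{ij} b_i b_j`, the square of the norm of the 1-form with respect to `a`. -/
def normSq {n : ℕ} (a : EuclideanSpace ℝ (Fin n) → Matrix (Fin n) (Fin n) ℝ)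
    (b : EuclideanSpace ℝ (Fin n) → Fin n → ℝ) (p : EuclideanSpace ℝ (Fin n)) : ℝ :=
  ∑ i, raise a p (b p) i * b p i

/-- `s_j = b^i s_ij`. -/
def sVec {n : ℕ} (a : EuclideanSpace ℝ (Fin n) → Matrix (Fin n) (Fin n) ℝ)
    (b : EuclideanSpace ℝ (Fin n) → Fin n → ℝ) (p : EuclideanSpace ℝ (Fin n))
    (j : Fin n) : ℝ :=
  ∑ i, raise a p (b p) i * sLow a b p i j

/-! ### The spray of a Finsler function in local coordinates -/

/-- The fundamental tensor `g_ij(x,y) = (1/2) ∂²F²/∂y^i∂y^j`. -/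
def fundamentalTensor {n : ℕ}
    (F : EuclideanSpace ℝ (Fin n) → EuclideanSpace ℝ (Fin n) → ℝ)
    (p y : EuclideanSpace ℝ (Fin n)) : Matrix (Fin n) (Fin n) ℝ :=
  fun i j => (1 / 2) * partialDeriv (fun v => partialDeriv (fun w => F p w ^ 2) j v) i y

/-- The spray coefficients
`G^i = (1/4) g^{il} { (∂²F²/∂x^k∂y^l) y^k - ∂F²/∂x^l }`. -/
def sprayCoeff {n : ℕ}
    (F : EuclideanSpace ℝ (Fin n) → EuclideanSpace ℝ (Fin n) → ℝ)
    (p y : EuclideanSpace ℝ (Fin n)) (i : Fin n) : ℝ :=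
  (1 / 4) * ∑ l, (fundamentalTensor F p y)⁻¹ i l *
    ((∑ k, partialDeriv (fun x => partialDeriv (fun v => F x v ^ 2) l y) k p * y k)
      - partialDeriv (fun x => F x y ^ 2) l p)

/-! ### Riemannian metrics, 1-forms and Finsler metrics on a manifold -/

/-- A `C^∞` Riemannian metric on the `n`-dimensional manifold `M`. -/
abbrev Metric (n : ℕ) (M : Type*) [TopologicalSpace M]
    [ChartedSpace (EuclideanSpace ℝ (Fin n)) M] [IsManifold (𝓡 n) ∞ M] :=
  Bundle.ContMDiffRiemannianMetric (𝓡 n) ∞ (EuclideanSpace ℝ (Fin n))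
    (fun x : M => TangentSpace (𝓡 n) x)

/-- A `C^∞` 1-form on the `n`-dimensional manifold `M`. -/
structure OneForm (n : ℕ) (M : Type*) [TopologicalSpace M]
    [ChartedSpace (EuclideanSpace ℝ (Fin n)) M] [IsManifold (𝓡 n) ∞ M] where
  toFun : (x : M) → TangentSpace (𝓡 n) x →L[ℝ] ℝ
  contMDiff : ContMDiff (𝓡 n) ((𝓡 n).prod 𝓘(ℝ, EuclideanSpace ℝ (Fin n) →L[ℝ] ℝ)) ∞
    (fun x => Bundle.TotalSpace.mk' (EuclideanSpace ℝ (Fin n) →L[ℝ] ℝ)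
      (E := fun x : M => TangentSpace (𝓡 n) x →L[ℝ] Bundle.Trivial M ℝ x) x (toFun x))

section Manifold

variable {n : ℕ} {M : Type*} [TopologicalSpace M]
  [ChartedSpace (EuclideanSpace ℝ (Fin n)) M] [IsManifold (𝓡 n) ∞ M]

/-- The tangent vector `y^i ∂/∂x^i` at the point with coordinates `p` in the chart `e`. -/
def coordVec (e : OpenPartialHomeomorph M (EuclideanSpace ℝ (Fin n)))
    (p y : EuclideanSpace ℝ (Fin n)) : TangentSpace (𝓡 n) (e.symm p) :=
  mfderiv (𝓡 n) (𝓡 n) e.symm p y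

/-- The local expression `F(x, y)` in the chart `e` of a function `F` on `TM`. -/
def localExpr (F : (x : M) → TangentSpace (𝓡 n) x → ℝ)
    (e : OpenPartialHomeomorph M (EuclideanSpace ℝ (Fin n)))
    (p y : EuclideanSpace ℝ (Fin n)) : ℝ :=
  F (e.symm p) (coordVec e p y)

/-- The components `a_ij` of a Riemannian metric in the chart `e`. -/
def Metric.comp (a : Metric n M) (e : OpenPartialHomeomorph M (EuclideanSpace ℝ (Fin n)))
    (p : EuclideanSpace ℝ (Fin n)) : Matrix (Fin n) (Fin n) ℝ :=
  fun i j => a.inner (e.symm p) (coordVec e p (EuclideanSpace.single i 1))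
    (coordVec e p (EuclideanSpace.single j 1))

/-- The components `b_i` of a 1-form in the chart `e`. -/
def OneForm.comp (β : OneForm n M) (e : OpenPartialHomeomorph M (EuclideanSpace ℝ (Fin n)))
    (p : EuclideanSpace ℝ (Fin n)) (i : Fin n) : ℝ :=
  β.toFun (e.symm p) (coordVec e p (EuclideanSpace.single i 1))

/-- The norm function `α(y) = √(a_ij y^i y^j)` of a Riemannian metric. -/
def Metric.norm (a : Metric n M) (x : M) (v : TangentSpace (𝓡 n) x) : ℝ :=
  Real.sqrt (a.inner x v v)

/-- `F` is a Finsler metric on `M`: it is `C^∞` on the slit tangent bundle, positive there,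
positively homogeneous of degree one, and its fundamental tensor is positive definite. -/
structure IsFinslerMetric (F : (x : M) → TangentSpace (𝓡 n) x → ℝ) : Prop where
  contMDiffOn : ContMDiffOn (𝓡 n).tangent 𝓘(ℝ, ℝ) ∞
    (fun v : TangentBundle (𝓡 n) M => F v.1 v.2) {v | v.2 ≠ 0}
  pos : ∀ (x : M) (v : TangentSpace (𝓡 n) x), v ≠ 0 → 0 < F x v
  homogeneous : ∀ (x : M) (v : TangentSpace (𝓡 n) x) (c : ℝ), 0 < c →
    F x (c • v) = c * F x v
  posDef : ∀ e ∈ IsManifold.maximalAtlas (𝓡 n) ∞ M, ∀ p ∈ e.target,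
    ∀ y : EuclideanSpace ℝ (Fin n), y ≠ 0 →
      (fundamentalTensor (localExpr F e) p y).PosDef

/-- The function `F = (α + β)^q / α^(q-1)`. -/
def qMetric (q : ℝ) (a : Metric n M) (β : OneForm n M) (x : M)
    (v : TangentSpace (𝓡 n) x) : ℝ :=
  (a.norm x v + β.toFun x v) ^ q / a.norm x v ^ (q - 1)

/-- `F = (α + β)^q / α^(q-1)` is a `(q, α, β)`-metric: `‖β‖_α < 1` at every point and `F` is a
Finsler metric. -/
structure IsQAlphaBetaMetric (q : ℝ) (a : Metric n M) (β : OneForm n M) : Prop where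
  norm_lt_one : ∀ (x : M) (v : TangentSpace (𝓡 n) x), v ≠ 0 → |β.toFun x v| < a.norm x v
  isFinsler : IsFinslerMetric (qMetric q a β)

/-- The Kropina metric `F = α² / β`, a metric on the cone `β > 0`. -/
def kropina (a : Metric n M) (β : OneForm n M) (x : M) (v : TangentSpace (𝓡 n) x) : ℝ :=
  a.norm x v ^ 2 / β.toFun x v

/-- `F` and `F'` are projectively related on the set `D` of tangent vectors: there is a scalar
function `P` on `D` with `G^i = G'^i + P y^i` in every chart. -/
def ProjectivelyRelatedOn (D : (x : M) → Set (TangentSpace (𝓡 n) x))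
    (F F' : (x : M) → TangentSpace (𝓡 n) x → ℝ) : Prop :=
  ∃ P : (x : M) → TangentSpace (𝓡 n) x → ℝ,
    ∀ e ∈ IsManifold.maximalAtlas (𝓡 n) ∞ M, ∀ p ∈ e.target,
      ∀ y : EuclideanSpace ℝ (Fin n), coordVec e p y ∈ D (e.symm p) → ∀ i : Fin n,
        sprayCoeff (localExpr F e) p y i =
          sprayCoeff (localExpr F' e) p y i + localExpr P e p y * y i

end Manifold

end Finsler

end

open scoped Topology

set_option linter.unusedSectionVars false

namespace Finsler

open Matrix

/-! ### Charts, coordinate changes and smoothness of components. -/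

section Charts

variable {n : ℕ} {M : Type*} [TopologicalSpace M]
  [ChartedSpace (EuclideanSpace ℝ (Fin n)) M] [IsManifold (𝓡 n) ∞ M]

/-! Write S = (s_ij), b^♯ = a⁻¹b and s_0 = s_j y^j. Both F² and the square of the Kropina metric
have the form Λ(α², β). The spray of such a metric is the Riemannian spray of α plus a vector D
solving a linear system whose matrix is the y-Hessian of F² (`sprayCoeff_eq_conn_add`). Seeking D in
the span of a⁻¹Sy, y and b^♯ reduces the system to scalar equations (`hess_mulVec_solution`). With κ
= qα²/(α + (1 - q)β) and Δ the denominator in condition 1, D is, modulo y, κ a⁻¹Sy + ½ q(q - 1)α²/Δ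
· (r_00 - 2κ s_0) b^♯ for F, and -α²/(2β) a⁻¹Sy + (r_00 + (α²/β) s_0)/(2b²) b^♯ for the Kropina
metric, in barred quantities. Positive definiteness of the fundamental tensor, together with n ≥ 3,
keeps α + (1 - q)β and Δ away from zero (`la_ne_zero`, `denom_ne_zero`). Projective equivalence thus
says that a difference of explicit vectors is parallel to y on the half space where the barred form
is positive.

Necessity is a pointwise argument in three stages. The Kropina terms with 1/β are the only ones
singular on the boundary hyperplane; multiplying by β and passing to the boundary isolates them and
forces condition 3 (`kropina_sLow_eq`). The Kropina correction then becomes quadratic in y, so the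
relation extends continuously to the boundary, which by collinearity is also the kernel of the
unbarred form. There the part containing S changes sign under y ↦ -y while the rest does not;
comparing the two signs gives S = 0 (`q_sMat_eq_zero`). What is left is a quadratic map plus a
multiple of b^♯. Modulo b^♯ it is a quadratic map parallel to a linear map of rank n - 1 ≥ 2, so the
factor is a linear form (`exists_quad_eq_linear_mul`); analytic continuation along lines in the
direction b^♯ carries the full identity from the half space to all y ≠ 0
(`exists_linear_of_half_space`).

The linear forms obtained at the points have smooth components, since they can be read off the
identity at basis vectors. They glue to a 1-form because they differ from the scalar P by a
coordinate-invariant quantity (`radialDiff_transition`, `exists_oneForm`). Conversely, adding this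
quantity to θ gives the required P. -/

theorem mdifferentiable_of_mem_maximalAtlas
    {e : OpenPartialHomeomorph M (EuclideanSpace ℝ (Fin n))}
    (he : e ∈ IsManifold.maximalAtlas (𝓡 n) ∞ M) : e.MDifferentiable (𝓡 n) (𝓡 n) :=
  ⟨(contMDiffOn_of_mem_maximalAtlas he).mdifferentiableOn (by simp),
    (contMDiffOn_symm_of_mem_maximalAtlas he).mdifferentiableOn (by simp)⟩

theorem coordVec_injective {e : OpenPartialHomeomorph M (EuclideanSpace ℝ (Fin n))}
    (he : e ∈ IsManifold.maximalAtlas (𝓡 n) ∞ M) {p : EuclideanSpace ℝ (Fin n)}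
    (hp : p ∈ e.target) : Function.Injective (coordVec e p) :=
  (mdifferentiable_of_mem_maximalAtlas he).symm.mfderiv_injective hp

theorem coordVec_ne_zero {e : OpenPartialHomeomorph M (EuclideanSpace ℝ (Fin n))}
    (he : e ∈ IsManifold.maximalAtlas (𝓡 n) ∞ M) {p : EuclideanSpace ℝ (Fin n)}
    (hp : p ∈ e.target) {y : EuclideanSpace ℝ (Fin n)} (hy : y ≠ 0) : coordVec e p y ≠ 0 := by
  intro h
  apply hy
  apply coordVec_injective he hp
  rw [h]
  exact (map_zero (mfderiv (𝓡 n) (𝓡 n) e.symm p)).symm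

theorem coordVec_mfderiv {e : OpenPartialHomeomorph M (EuclideanSpace ℝ (Fin n))}
    (he : e ∈ IsManifold.maximalAtlas (𝓡 n) ∞ M) {x : M} (hx : x ∈ e.source)
    (v : TangentSpace (𝓡 n) x) :
    (coordVec e (e x) (mfderiv (𝓡 n) (𝓡 n) e x v) : EuclideanSpace ℝ (Fin n)) = v :=
  DFunLike.congr_fun ((mdifferentiable_of_mem_maximalAtlas he).symm_comp_deriv hx) v

/-- All tangent spaces unfold to the model space, whereas the base points produced by two charts are
equal only propositionally. Comparing vectors in the model space avoids transport along that
equality. -/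
theorem apply_congr_base (F : (x : M) → TangentSpace (𝓡 n) x → ℝ) {x x' : M} (h : x = x')
    {v : TangentSpace (𝓡 n) x} {v' : TangentSpace (𝓡 n) x'}
    (hv : (v : EuclideanSpace ℝ (Fin n)) = v') : F x v = F x' v' := by
  subst h
  exact congrArg _ hv

/-- The change of coordinates from the chart `e` to the chart `e'`. -/
def transition (e e' : OpenPartialHomeomorph M (EuclideanSpace ℝ (Fin n)))
    (p : EuclideanSpace ℝ (Fin n)) : EuclideanSpace ℝ (Fin n) :=
  e' (e.symm p)

theorem contDiffAt_transition {e e' : OpenPartialHomeomorph M (EuclideanSpace ℝ (Fin n))}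
    (he : e ∈ IsManifold.maximalAtlas (𝓡 n) ∞ M) (he' : e' ∈ IsManifold.maximalAtlas (𝓡 n) ∞ M)
    {p : EuclideanSpace ℝ (Fin n)} (hp : p ∈ e.target) (hp' : e.symm p ∈ e'.source) :
    ContDiffAt ℝ ∞ (transition e e') p := by
  rw [← contMDiffAt_iff_contDiffAt]
  exact (contMDiffAt_of_mem_maximalAtlas he' hp').comp p
    (contMDiffAt_symm_of_mem_maximalAtlas he hp)

theorem fderiv_transition_apply {e e' : OpenPartialHomeomorph M (EuclideanSpace ℝ (Fin n))}
    (he : e ∈ IsManifold.maximalAtlas (𝓡 n) ∞ M) (he' : e' ∈ IsManifold.maximalAtlas (𝓡 n) ∞ M)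
    {p : EuclideanSpace ℝ (Fin n)} (hp : p ∈ e.target) (hp' : e.symm p ∈ e'.source)
    (y : EuclideanSpace ℝ (Fin n)) :
    fderiv ℝ (transition e e') p y = mfderiv (𝓡 n) (𝓡 n) e' (e.symm p) (coordVec e p y) := by
  rw [← mfderiv_eq_fderiv]
  exact DFunLike.congr_fun (mfderiv_comp (I' := 𝓡 n) p
    ((mdifferentiable_of_mem_maximalAtlas he').mdifferentiableAt hp')
    ((mdifferentiable_of_mem_maximalAtlas he).mdifferentiableAt_symm hp)) y

theorem coordVec_transition {e e' : OpenPartialHomeomorph M (EuclideanSpace ℝ (Fin n))}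
    (he : e ∈ IsManifold.maximalAtlas (𝓡 n) ∞ M) (he' : e' ∈ IsManifold.maximalAtlas (𝓡 n) ∞ M)
    {p : EuclideanSpace ℝ (Fin n)} (hp : p ∈ e.target) (hp' : e.symm p ∈ e'.source)
    (y : EuclideanSpace ℝ (Fin n)) :
    (coordVec e' (transition e e' p) (fderiv ℝ (transition e e') p y) :
      EuclideanSpace ℝ (Fin n)) = coordVec e p y := by
  rw [fderiv_transition_apply he he' hp hp']
  exact coordVec_mfderiv he' hp' _

theorem localExpr_transition (F : (x : M) → TangentSpace (𝓡 n) x → ℝ)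
    {e e' : OpenPartialHomeomorph M (EuclideanSpace ℝ (Fin n))}
    (he : e ∈ IsManifold.maximalAtlas (𝓡 n) ∞ M) (he' : e' ∈ IsManifold.maximalAtlas (𝓡 n) ∞ M)
    {p : EuclideanSpace ℝ (Fin n)} (hp : p ∈ e.target) (hp' : e.symm p ∈ e'.source)
    (y : EuclideanSpace ℝ (Fin n)) :
    localExpr F e p y
      = localExpr F e' (transition e e' p) (fderiv ℝ (transition e e') p y) :=
  apply_congr_base F (e'.left_inv hp').symm (coordVec_transition he he' hp hp' y).symm

/-- The field is the image of the constant section y under the tangent map of `e.symm`, which is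
smooth on the open set `e.target`. -/
theorem contMDiffAt_coordVec {e : OpenPartialHomeomorph M (EuclideanSpace ℝ (Fin n))}
    (he : e ∈ IsManifold.maximalAtlas (𝓡 n) ∞ M) {p : EuclideanSpace ℝ (Fin n)}
    (hp : p ∈ e.target) (y : EuclideanSpace ℝ (Fin n)) :
    ContMDiffAt (𝓡 n) (𝓡 n).tangent ∞
      (fun x => (⟨e.symm x, coordVec e x y⟩ : TangentBundle (𝓡 n) M)) p := by
  have h1 := (contMDiffOn_symm_of_mem_maximalAtlas he).contMDiffOn_tangentMapWithin
    (m := ∞) (by simp) e.open_target.uniqueMDiffOn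
  have h2 : ContMDiffAt (𝓡 n) (𝓡 n).tangent ∞
      (fun x => (⟨x, y⟩ : TangentBundle (𝓡 n) (EuclideanSpace ℝ (Fin n)))) p := by
    rw [Bundle.contMDiffAt_totalSpace]
    refine ⟨contMDiffAt_id, ?_⟩
    simp only [trivializationAt_model_space_apply]
    exact contMDiffAt_const
  have h3 := (h1.contMDiffAt (x := (⟨p, y⟩ : TangentBundle (𝓡 n) (EuclideanSpace ℝ (Fin n))))
    ((e.open_target.preimage
      (FiberBundle.continuous_proj _ _)).mem_nhds hp)).comp p h2
  refine h3.congr_of_eventuallyEq ?_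
  filter_upwards [e.open_target.mem_nhds hp] with x hx
  simp only [Function.comp, tangentMapWithin]
  rw [mfderivWithin_of_isOpen e.open_target hx]
  rfl

theorem Metric.contDiffOn_comp (a : Metric n M)
    {e : OpenPartialHomeomorph M (EuclideanSpace ℝ (Fin n))}
    (he : e ∈ IsManifold.maximalAtlas (𝓡 n) ∞ M) (i j : Fin n) :
    ContDiffOn ℝ ∞ (fun p => a.comp e p i j) e.target := by
  intro p hp
  apply ContDiffAt.contDiffWithinAt
  rw [← contMDiffAt_iff_contDiffAt]
  have hb : ContMDiffAt (𝓡 n) (𝓡 n) ∞ e.symm p := contMDiffAt_symm_of_mem_maximalAtlas he hp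
  have : ContMDiffAt (𝓡 n) ((𝓡 n).prod 𝓘(ℝ)) ∞
      (fun m ↦ Bundle.TotalSpace.mk' ℝ (E := Bundle.Trivial M ℝ) (e.symm m)
        (a.inner (e.symm m) (coordVec e m (EuclideanSpace.single i 1))
          (coordVec e m (EuclideanSpace.single j 1)))) p := by
    apply ContMDiffAt.clm_bundle_apply₂ (F₁ := EuclideanSpace ℝ (Fin n))
      (F₂ := EuclideanSpace ℝ (Fin n))
    · exact ContMDiffAt.comp p a.contMDiff.contMDiffAt hb
    · exact contMDiffAt_coordVec he hp _
    · exact contMDiffAt_coordVec he hp _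
  simp only [Bundle.contMDiffAt_totalSpace] at this
  exact this.2

theorem OneForm.contDiffOn_comp (β : OneForm n M)
    {e : OpenPartialHomeomorph M (EuclideanSpace ℝ (Fin n))}
    (he : e ∈ IsManifold.maximalAtlas (𝓡 n) ∞ M) (i : Fin n) :
    ContDiffOn ℝ ∞ (fun p => β.comp e p i) e.target := by
  intro p hp
  apply ContDiffAt.contDiffWithinAt
  rw [← contMDiffAt_iff_contDiffAt]
  have hb : ContMDiffAt (𝓡 n) (𝓡 n) ∞ e.symm p := contMDiffAt_symm_of_mem_maximalAtlas he hp
  have : ContMDiffAt (𝓡 n) ((𝓡 n).prod 𝓘(ℝ)) ∞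
      (fun m ↦ Bundle.TotalSpace.mk' ℝ (E := Bundle.Trivial M ℝ) (e.symm m)
        (β.toFun (e.symm m) (coordVec e m (EuclideanSpace.single i 1)))) p := by
    apply ContMDiffAt.clm_bundle_apply (F₁ := EuclideanSpace ℝ (Fin n))
    · exact ContMDiffAt.comp p β.contMDiff.contMDiffAt hb
    · exact contMDiffAt_coordVec he hp _
  simp only [Bundle.contMDiffAt_totalSpace] at this
  exact this.2

/-- A covector field given in every chart by smooth components that are compatible with the
changes of coordinates is a smooth 1-form. -/
theorem exists_oneForm
    (w : OpenPartialHomeomorph M (EuclideanSpace ℝ (Fin n)) → EuclideanSpace ℝ (Fin n) →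
      EuclideanSpace ℝ (Fin n) →L[ℝ] ℝ)
    (hw : ∀ e ∈ IsManifold.maximalAtlas (𝓡 n) ∞ M, ∀ e' ∈ IsManifold.maximalAtlas (𝓡 n) ∞ M,
      ∀ p ∈ e.target, e.symm p ∈ e'.source → ∀ y,
        w e p y = w e' (transition e e' p) (fderiv ℝ (transition e e') p y))
    (hs : ∀ e ∈ IsManifold.maximalAtlas (𝓡 n) ∞ M, ContDiffOn ℝ ∞ (w e) e.target) :
    ∃ θ : OneForm n M, ∀ e ∈ IsManifold.maximalAtlas (𝓡 n) ∞ M, ∀ p ∈ e.target, ∀ y,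
      localExpr (fun x v => θ.toFun x v) e p y = w e p y := by
  -- The value at x uses the preferred chart at x, a choice that varies with x; the compatibility
  -- `hw` makes it agree with the components in any fixed chart near x.
  let φ : (x : M) → TangentSpace (𝓡 n) x →L[ℝ] ℝ := fun x =>
    (w (chartAt _ x) (chartAt (EuclideanSpace ℝ (Fin n)) x x)).comp
      (mfderiv (𝓡 n) (𝓡 n) (chartAt (EuclideanSpace ℝ (Fin n)) x) x)
  have hφ : ∀ e ∈ IsManifold.maximalAtlas (𝓡 n) ∞ M, ∀ p ∈ e.target, ∀ y,
      φ (e.symm p) (coordVec e p y) = w e p y := by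
    intro e he p hp y
    have hs' := mem_chart_source (EuclideanSpace ℝ (Fin n)) (e.symm p)
    have he' := IsManifold.chart_mem_maximalAtlas (I := 𝓡 n) (n := ∞) (e.symm p)
    rw [hw e he _ he' p hp hs' y, fderiv_transition_apply he he' hp hs' y]
    rfl
  refine ⟨⟨φ, ?_⟩, hφ⟩
  intro x₀
  rw [contMDiffAt_hom_bundle]
  refine ⟨contMDiffAt_id, ?_⟩
  have he := IsManifold.chart_mem_maximalAtlas (I := 𝓡 n) (n := ∞) x₀
  have hx := mem_chart_source (EuclideanSpace ℝ (Fin n)) x₀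
  set e := chartAt (EuclideanSpace ℝ (Fin n)) x₀ with he0
  have h1 : ContMDiffAt (𝓡 n) 𝓘(ℝ, EuclideanSpace ℝ (Fin n) →L[ℝ] ℝ) ∞ (fun x => w e (e x)) x₀ :=
    ((hs e he).contDiffAt (e.open_target.mem_nhds (e.map_source hx))).contMDiffAt.comp x₀
      (contMDiffAt_of_mem_maximalAtlas he hx)
  refine h1.congr_of_eventuallyEq ?_
  filter_upwards [e.open_source.mem_nhds hx] with x hx
  ext y
  -- The tangent trivialization at x₀ is the derivative of the chart there, so the local
  -- representative of φ is w e ∘ e.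
  have h := TangentBundle.symmL_trivializationAt (I := 𝓡 n) (x₀ := x₀) hx
  simp only [ContinuousLinearMap.inCoordinates, Bundle.Trivial.fiberBundle_trivializationAt',
    Bundle.Trivial.continuousLinearMapAt_trivialization]
  change φ x ((trivializationAt (EuclideanSpace ℝ (Fin n)) (TangentSpace (𝓡 n)) x₀).symmL ℝ x y)
    = w e (e x) y
  rw [← hφ e he (e x) (e.map_source hx) y]
  refine apply_congr_base (fun x v => φ x v) (e.left_inv hx).symm ?_
  rw [h]
  have h2 : Set.range (𝓡 n) = Set.univ := by simp
  rw [h2, mfderivWithin_univ]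
  rfl

end Charts

/-! ### Rules for partial derivatives, including the chain rule for Λ(f, g). -/

section PartialDeriv

variable {n : ℕ} {f g : EuclideanSpace ℝ (Fin n) → ℝ} {p : EuclideanSpace ℝ (Fin n)}

theorem partialDeriv_congr (h : f =ᶠ[𝓝 p] g) (k : Fin n) :
    partialDeriv f k p = partialDeriv g k p := by
  rw [partialDeriv, partialDeriv, h.fderiv_eq]

theorem partialDeriv_mul (hf : DifferentiableAt ℝ f p) (hg : DifferentiableAt ℝ g p)
    (k : Fin n) : partialDeriv (fun x => f x * g x) k p
      = partialDeriv f k p * g p + f p * partialDeriv g k p := by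
  simp only [partialDeriv]
  rw [fderiv_fun_mul hf hg]
  simp
  ring

theorem partialDeriv_add (hf : DifferentiableAt ℝ f p) (hg : DifferentiableAt ℝ g p)
    (k : Fin n) : partialDeriv (fun x => f x + g x) k p
      = partialDeriv f k p + partialDeriv g k p := by
  simp only [partialDeriv]
  rw [fderiv_fun_add hf hg]
  simp

theorem partialDeriv_const_mul (hf : DifferentiableAt ℝ f p) (c : ℝ) (k : Fin n) :
    partialDeriv (fun x => c * f x) k p = c * partialDeriv f k p := by
  simp only [partialDeriv]
  rw [fderiv_const_mul hf]
  simp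

theorem partialDeriv_mul_const (hf : DifferentiableAt ℝ f p) (c : ℝ) (k : Fin n) :
    partialDeriv (fun x => f x * c) k p = partialDeriv f k p * c := by
  simp only [mul_comm _ c]
  exact partialDeriv_const_mul hf c k

theorem partialDeriv_sum {ι : Type*} {s : Finset ι} {u : ι → EuclideanSpace ℝ (Fin n) → ℝ}
    (hu : ∀ i ∈ s, DifferentiableAt ℝ (u i) p) (k : Fin n) :
    partialDeriv (fun x => ∑ i ∈ s, u i x) k p = ∑ i ∈ s, partialDeriv (u i) k p := by
  simp only [partialDeriv]
  rw [fderiv_fun_sum hu]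
  simp

theorem partialDeriv_coord (i k : Fin n) :
    partialDeriv (fun v : EuclideanSpace ℝ (Fin n) => v.ofLp i) k p = if i = k then 1 else 0 := by
  have h : HasFDerivAt (fun v : EuclideanSpace ℝ (Fin n) => v.ofLp i)
      (EuclideanSpace.proj i : EuclideanSpace ℝ (Fin n) →L[ℝ] ℝ) p :=
    (EuclideanSpace.proj i : EuclideanSpace ℝ (Fin n) →L[ℝ] ℝ).hasFDerivAt
  rw [partialDeriv, h.fderiv]
  simp

/-- The linear form on `ℝ × ℝ` with coefficients `s` and `t`. -/
noncomputable def pairForm (s t : ℝ) : ℝ × ℝ →L[ℝ] ℝ :=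
  s • ContinuousLinearMap.fst ℝ ℝ ℝ + t • ContinuousLinearMap.snd ℝ ℝ ℝ

theorem partialDeriv_comp_pair {Φ : ℝ × ℝ → ℝ} {s t : ℝ}
    (hf : DifferentiableAt ℝ f p) (hg : DifferentiableAt ℝ g p)
    (hΦ : HasFDerivAt Φ (pairForm s t) (f p, g p)) (k : Fin n) :
    partialDeriv (fun x => Φ (f x, g x)) k p
      = s * partialDeriv f k p + t * partialDeriv g k p := by
  have h := hΦ.comp p (hf.hasFDerivAt.prodMk hg.hasFDerivAt)
  simp only [partialDeriv]
  have h2 : fderiv ℝ (fun x => Φ (f x, g x)) p = _ := h.fderiv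
  rw [h2]
  simp [pairForm]

theorem differentiableAt_comp_pair {Φ : ℝ × ℝ → ℝ} {s t : ℝ}
    (hf : DifferentiableAt ℝ f p) (hg : DifferentiableAt ℝ g p)
    (hΦ : HasFDerivAt Φ (pairForm s t) (f p, g p)) :
    DifferentiableAt ℝ (fun x => Φ (f x, g x)) p :=
  (hΦ.comp p (hf.hasFDerivAt.prodMk hg.hasFDerivAt)).differentiableAt

end PartialDeriv

/-! ### Fundamental tensor and spray of a metric with F² = Λ(α², β). -/

section Spray

variable {n : ℕ} {a : EuclideanSpace ℝ (Fin n) → Matrix (Fin n) (Fin n) ℝ}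
  {b : EuclideanSpace ℝ (Fin n) → Fin n → ℝ} {p y : EuclideanSpace ℝ (Fin n)}

/-- The quadratic form `m_ij y^i y^j`. -/
noncomputable def quad (m : Matrix (Fin n) (Fin n) ℝ) (y : Fin n → ℝ) : ℝ := y ⬝ᵥ m *ᵥ y

theorem dotProduct_mulVec_symm {m : Matrix (Fin n) (Fin n) ℝ} (hm : m.IsSymm) (v w : Fin n → ℝ) :
    v ⬝ᵥ m *ᵥ w = w ⬝ᵥ m *ᵥ v := by
  rw [dotProduct_mulVec, dotProduct_comm, ← mulVec_transpose, hm.eq]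

theorem differentiable_coord (i : Fin n) :
    Differentiable ℝ (fun v : EuclideanSpace ℝ (Fin n) => v.ofLp i) :=
  (EuclideanSpace.proj i : EuclideanSpace ℝ (Fin n) →L[ℝ] ℝ).differentiable

theorem differentiableAt_mulVec_right (m : Matrix (Fin n) (Fin n) ℝ) (l : Fin n) :
    DifferentiableAt ℝ (fun v : EuclideanSpace ℝ (Fin n) => (m *ᵥ v.ofLp) l) y := by
  simp only [mulVec, dotProduct]
  exact DifferentiableAt.fun_sum fun j _ => (differentiable_coord j y).const_mul _

theorem differentiableAt_quad_right (m : Matrix (Fin n) (Fin n) ℝ) :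
    DifferentiableAt ℝ (fun v : EuclideanSpace ℝ (Fin n) => quad m v.ofLp) y := by
  simp only [quad, dotProduct]
  exact DifferentiableAt.fun_sum fun j _ =>
    (differentiable_coord j y).fun_mul (differentiableAt_mulVec_right m j)

theorem differentiableAt_dotProduct_right (w : Fin n → ℝ) :
    DifferentiableAt ℝ (fun v : EuclideanSpace ℝ (Fin n) => w ⬝ᵥ v.ofLp) y := by
  simp only [dotProduct]
  exact DifferentiableAt.fun_sum fun j _ => (differentiable_coord j y).const_mul _

theorem partialDeriv_mulVec_right (m : Matrix (Fin n) (Fin n) ℝ) (l k : Fin n) :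
    partialDeriv (fun v : EuclideanSpace ℝ (Fin n) => (m *ᵥ v.ofLp) l) k y = m l k := by
  simp only [mulVec, dotProduct]
  rw [partialDeriv_sum fun j _ => (differentiable_coord j y).const_mul _]
  simp [partialDeriv_const_mul (differentiable_coord _ y), partialDeriv_coord]

theorem partialDeriv_dotProduct_right (w : Fin n → ℝ) (k : Fin n) :
    partialDeriv (fun v : EuclideanSpace ℝ (Fin n) => w ⬝ᵥ v.ofLp) k y = w k := by
  simp only [dotProduct]
  rw [partialDeriv_sum fun j _ => (differentiable_coord j y).const_mul _]
  simp [partialDeriv_const_mul (differentiable_coord _ y), partialDeriv_coord]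

theorem partialDeriv_quad_right {m : Matrix (Fin n) (Fin n) ℝ} (hm : m.IsSymm) (k : Fin n) :
    partialDeriv (fun v : EuclideanSpace ℝ (Fin n) => quad m v.ofLp) k y
      = 2 * (m *ᵥ y.ofLp) k := by
  have h : ∀ x, partialDeriv (fun v : EuclideanSpace ℝ (Fin n) => v.ofLp x * (m *ᵥ v.ofLp) x) k y
      = (if x = k then 1 else 0) * (m *ᵥ y.ofLp) x + y.ofLp x * m x k := fun x => by
    rw [partialDeriv_mul (differentiable_coord x y) (differentiableAt_mulVec_right m x),
      partialDeriv_coord, partialDeriv_mulVec_right]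
  simp only [quad, dotProduct]
  rw [partialDeriv_sum fun j _ => (differentiable_coord j y).fun_mul (differentiableAt_mulVec_right m j)]
  simp only [h, Finset.sum_add_distrib]
  rw [two_mul]
  congr 1
  · simp
  · simp only [mulVec, dotProduct]
    exact Finset.sum_congr rfl fun x _ => by rw [mul_comm, hm.apply]

/-- The partial derivatives of the components of `a`, as a matrix. -/
noncomputable def dMat (a : EuclideanSpace ℝ (Fin n) → Matrix (Fin n) (Fin n) ℝ)
    (p : EuclideanSpace ℝ (Fin n)) (k : Fin n) : Matrix (Fin n) (Fin n) ℝ :=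
  fun i j => partialDeriv (fun x => a x i j) k p

/-- The partial derivatives of the components of `b`, as a vector. -/
noncomputable def dVec (b : EuclideanSpace ℝ (Fin n) → Fin n → ℝ)
    (p : EuclideanSpace ℝ (Fin n)) (k : Fin n) : Fin n → ℝ :=
  fun i => partialDeriv (fun x => b x i) k p

theorem differentiableAt_mulVec_left (ha : ∀ i j, DifferentiableAt ℝ (fun x => a x i j) p)
    (v : Fin n → ℝ) (l : Fin n) : DifferentiableAt ℝ (fun x => (a x *ᵥ v) l) p := by
  simp only [mulVec, dotProduct]
  exact DifferentiableAt.fun_sum fun j _ => (ha l j).mul_const _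

theorem differentiableAt_quad_left (ha : ∀ i j, DifferentiableAt ℝ (fun x => a x i j) p)
    (v : Fin n → ℝ) : DifferentiableAt ℝ (fun x => quad (a x) v) p := by
  simp only [quad, dotProduct]
  exact DifferentiableAt.fun_sum fun j _ => (differentiableAt_mulVec_left ha v j).const_mul _

theorem differentiableAt_dotProduct_left (hb : ∀ i, DifferentiableAt ℝ (fun x => b x i) p)
    (v : Fin n → ℝ) : DifferentiableAt ℝ (fun x => b x ⬝ᵥ v) p := by
  simp only [dotProduct]
  exact DifferentiableAt.fun_sum fun j _ => (hb j).mul_const _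

theorem partialDeriv_mulVec_left (ha : ∀ i j, DifferentiableAt ℝ (fun x => a x i j) p)
    (v : Fin n → ℝ) (l k : Fin n) :
    partialDeriv (fun x => (a x *ᵥ v) l) k p = (dMat a p k *ᵥ v) l := by
  simp only [mulVec, dotProduct, dMat]
  rw [partialDeriv_sum fun j _ => (ha l j).mul_const _]
  exact Finset.sum_congr rfl fun j _ => partialDeriv_mul_const (ha l j) _ _

theorem partialDeriv_quad_left (ha : ∀ i j, DifferentiableAt ℝ (fun x => a x i j) p)
    (v : Fin n → ℝ) (k : Fin n) :
    partialDeriv (fun x => quad (a x) v) k p = quad (dMat a p k) v := by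
  simp only [quad, dotProduct]
  rw [partialDeriv_sum fun j _ => (differentiableAt_mulVec_left ha v j).const_mul _]
  refine Finset.sum_congr rfl fun j _ => ?_
  rw [partialDeriv_const_mul (differentiableAt_mulVec_left ha v j), partialDeriv_mulVec_left ha]

theorem partialDeriv_dotProduct_left (hb : ∀ i, DifferentiableAt ℝ (fun x => b x i) p)
    (v : Fin n → ℝ) (k : Fin n) :
    partialDeriv (fun x => b x ⬝ᵥ v) k p = dVec b p k ⬝ᵥ v := by
  simp only [dotProduct, dVec]
  rw [partialDeriv_sum fun j _ => (hb j).mul_const _]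
  exact Finset.sum_congr rfl fun j _ => partialDeriv_mul_const (hb j) _ _

/-- The Hessian in `y` of `Λ(α², β)` in terms of the partial derivatives of `Λ`. -/
noncomputable def hess (la laa lab lbb : ℝ) (a : Matrix (Fin n) (Fin n) ℝ) (b y : Fin n → ℝ) :
    Matrix (Fin n) (Fin n) ℝ :=
  fun i j => 2 * la * a i j + 4 * laa * (a *ᵥ y) i * (a *ᵥ y) j
    + 2 * lab * ((a *ᵥ y) i * b j + b i * (a *ᵥ y) j) + lbb * b i * b j

theorem hess_mulVec (la laa lab lbb : ℝ) (a : Matrix (Fin n) (Fin n) ℝ) (b y v : Fin n → ℝ)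
    (i : Fin n) : (hess la laa lab lbb a b y *ᵥ v) i
      = 2 * la * (a *ᵥ v) i + (a *ᵥ y) i * (4 * laa * ((a *ᵥ y) ⬝ᵥ v) + 2 * lab * (b ⬝ᵥ v))
        + b i * (2 * lab * ((a *ᵥ y) ⬝ᵥ v) + lbb * (b ⬝ᵥ v)) := by
  have h : ∀ j, hess la laa lab lbb a b y i j * v j = 2 * la * (a i j * v j)
      + (4 * laa * (a *ᵥ y) i) * ((a *ᵥ y) j * v j) + (2 * lab * (a *ᵥ y) i) * (b j * v j)
      + (2 * lab * b i) * ((a *ᵥ y) j * v j) + (lbb * b i) * (b j * v j) := fun j => by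
    rw [hess]; ring
  have e1 : (hess la laa lab lbb a b y *ᵥ v) i
    = ∑ j, hess la laa lab lbb a b y i j * v j := rfl
  have e2 : (a *ᵥ v) i = ∑ j, a i j * v j := rfl
  have e3 : (a *ᵥ y) ⬝ᵥ v = ∑ j, (a *ᵥ y) j * v j := rfl
  have e4 : b ⬝ᵥ v = ∑ j, b j * v j := rfl
  rw [e1]
  simp only [h, Finset.sum_add_distrib, ← Finset.mul_sum]
  rw [← e2, ← e3, ← e4]
  ring

/-- The right-hand side of the equation of the spray of `Λ(α², β)`. -/
noncomputable def sprayRhs (la lb laa lab lbb : ℝ) (a : EuclideanSpace ℝ (Fin n) → Matrix (Fin n) (Fin n) ℝ)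
    (b : EuclideanSpace ℝ (Fin n) → Fin n → ℝ) (p y : EuclideanSpace ℝ (Fin n)) (l : Fin n) : ℝ :=
  la * (2 * (∑ k, y.ofLp k * (dMat a p k *ᵥ y.ofLp) l) - quad (dMat a p l) y.ofLp)
    + lb * ((∑ k, y.ofLp k * dVec b p k l) - dVec b p l ⬝ᵥ y.ofLp)
    + 2 * (a p *ᵥ y.ofLp) l * (laa * (∑ k, y.ofLp k * quad (dMat a p k) y.ofLp)
        + lab * (∑ k, y.ofLp k * (dVec b p k ⬝ᵥ y.ofLp)))
    + b p l * (lab * (∑ k, y.ofLp k * quad (dMat a p k) y.ofLp)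
        + lbb * (∑ k, y.ofLp k * (dVec b p k ⬝ᵥ y.ofLp)))

variable {F : EuclideanSpace ℝ (Fin n) → EuclideanSpace ℝ (Fin n) → ℝ}
  {Λ la lb : ℝ × ℝ → ℝ} {laa lab lbb : ℝ}

theorem eventually_pair_right (m : Matrix (Fin n) (Fin n) ℝ) (w : Fin n → ℝ) {P : ℝ × ℝ → Prop}
    (h : ∀ᶠ z in 𝓝 (quad m y.ofLp, w ⬝ᵥ y.ofLp), P z) :
    ∀ᶠ v in 𝓝 y, P (quad m v.ofLp, w ⬝ᵥ v.ofLp) :=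
  ((differentiableAt_quad_right m).continuousAt.prodMk
    (differentiableAt_dotProduct_right w).continuousAt).eventually h

theorem eventually_pair_left (ha : ∀ i j, DifferentiableAt ℝ (fun x => a x i j) p)
    (hb : ∀ i, DifferentiableAt ℝ (fun x => b x i) p) (v : Fin n → ℝ) {P : ℝ × ℝ → Prop}
    (h : ∀ᶠ z in 𝓝 (quad (a p) v, b p ⬝ᵥ v), P z) :
    ∀ᶠ x in 𝓝 p, P (quad (a x) v, b x ⬝ᵥ v) :=
  ((differentiableAt_quad_left ha v).continuousAt.prodMk
    (differentiableAt_dotProduct_left hb v).continuousAt).eventually h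

theorem partialDeriv_sq_right (hsymm : ∀ x, (a x).IsSymm) {x v : EuclideanSpace ℝ (Fin n)}
    (hF : ∀ᶠ v in 𝓝 v, F x v ^ 2 = Λ (quad (a x) v.ofLp, b x ⬝ᵥ v.ofLp))
    (hΛ : HasFDerivAt Λ (pairForm (la (quad (a x) v.ofLp, b x ⬝ᵥ v.ofLp))
      (lb (quad (a x) v.ofLp, b x ⬝ᵥ v.ofLp))) (quad (a x) v.ofLp, b x ⬝ᵥ v.ofLp)) (l : Fin n) :
    partialDeriv (fun v => F x v ^ 2) l v
      = 2 * la (quad (a x) v.ofLp, b x ⬝ᵥ v.ofLp) * (a x *ᵥ v.ofLp) l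
        + lb (quad (a x) v.ofLp, b x ⬝ᵥ v.ofLp) * b x l := by
  rw [partialDeriv_congr hF, partialDeriv_comp_pair (differentiableAt_quad_right _)
    (differentiableAt_dotProduct_right _) hΛ, partialDeriv_quad_right (hsymm x),
    partialDeriv_dotProduct_right]
  ring

theorem fundamentalTensor_eq (hsymm : ∀ x, (a x).IsSymm)
    (hF : ∀ᶠ v in 𝓝 y, F p v ^ 2 = Λ (quad (a p) v.ofLp, b p ⬝ᵥ v.ofLp))
    (hΛ : ∀ᶠ z in 𝓝 (quad (a p) y.ofLp, b p ⬝ᵥ y.ofLp), HasFDerivAt Λ (pairForm (la z) (lb z)) z)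
    (hla : HasFDerivAt la (pairForm laa lab) (quad (a p) y.ofLp, b p ⬝ᵥ y.ofLp))
    (hlb : HasFDerivAt lb (pairForm lab lbb) (quad (a p) y.ofLp, b p ⬝ᵥ y.ofLp)) :
    fundamentalTensor F p y = (1 / 2 : ℝ) • hess (la (quad (a p) y.ofLp, b p ⬝ᵥ y.ofLp)) laa lab lbb (a p) (b p) y.ofLp := by
  ext i j
  change (1 / 2 : ℝ) * _ = (1 / 2 : ℝ) * _

  congr 1
  have h1 : (fun v => partialDeriv (fun w => F p w ^ 2) j v) =ᶠ[𝓝 y] fun v =>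
      2 * la (quad (a p) v.ofLp, b p ⬝ᵥ v.ofLp) * (a p *ᵥ v.ofLp) j
        + lb (quad (a p) v.ofLp, b p ⬝ᵥ v.ofLp) * b p j := by
    filter_upwards [hF.eventually_nhds, eventually_pair_right _ _ hΛ] with v hv1 hv2
    exact partialDeriv_sq_right hsymm hv1 hv2 j
  have dA := differentiableAt_quad_right (y := y) (a p)
  have dB := differentiableAt_dotProduct_right (y := y) (b p)
  have d1 := differentiableAt_comp_pair dA dB hla
  have d2 := differentiableAt_comp_pair dA dB hlb
  have d3 := differentiableAt_mulVec_right (y := y) (a p) j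
  rw [partialDeriv_congr h1, partialDeriv_add ((d1.const_mul 2).fun_mul d3) (d2.mul_const _),
    partialDeriv_mul (d1.const_mul 2) d3, partialDeriv_const_mul d1, partialDeriv_mul_const d2,
    partialDeriv_comp_pair dA dB hla, partialDeriv_comp_pair dA dB hlb,
    partialDeriv_quad_right (hsymm p), partialDeriv_dotProduct_right, partialDeriv_mulVec_right,
    hess, (hsymm p).apply]
  ring

/-- The mixed term differentiates in y before x. Hence `hF` is required for all x near p and, for
each of them, for all v near y. -/
theorem sprayCoeff_eq (hsymm : ∀ x, (a x).IsSymm)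
    (ha : ∀ i j, DifferentiableAt ℝ (fun x => a x i j) p)
    (hb : ∀ i, DifferentiableAt ℝ (fun x => b x i) p)
    (hF : ∀ᶠ x in 𝓝 p, ∀ᶠ v in 𝓝 y, F x v ^ 2 = Λ (quad (a x) v.ofLp, b x ⬝ᵥ v.ofLp))
    (hΛ : ∀ᶠ z in 𝓝 (quad (a p) y.ofLp, b p ⬝ᵥ y.ofLp), HasFDerivAt Λ (pairForm (la z) (lb z)) z)
    (hla : HasFDerivAt la (pairForm laa lab) (quad (a p) y.ofLp, b p ⬝ᵥ y.ofLp))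
    (hlb : HasFDerivAt lb (pairForm lab lbb) (quad (a p) y.ofLp, b p ⬝ᵥ y.ofLp)) (i : Fin n) :
    sprayCoeff F p y i = (1 / 4) * ((fundamentalTensor F p y)⁻¹ *ᵥ
      sprayRhs (la (quad (a p) y.ofLp, b p ⬝ᵥ y.ofLp)) (lb (quad (a p) y.ofLp, b p ⬝ᵥ y.ofLp))
        laa lab lbb a b p y) i := by
  rw [sprayCoeff, mulVec, dotProduct]
  congr 1
  refine Finset.sum_congr rfl fun l _ => ?_
  congr 1
  have h1 : (fun x => partialDeriv (fun v => F x v ^ 2) l y) =ᶠ[𝓝 p] fun x =>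
      2 * la (quad (a x) y.ofLp, b x ⬝ᵥ y.ofLp) * (a x *ᵥ y.ofLp) l
        + lb (quad (a x) y.ofLp, b x ⬝ᵥ y.ofLp) * b x l := by
    filter_upwards [hF, eventually_pair_left ha hb _ hΛ] with x hx1 hx2
    exact partialDeriv_sq_right hsymm hx1 hx2 l
  have h2 : (fun x => F x y ^ 2) =ᶠ[𝓝 p] fun x => Λ (quad (a x) y.ofLp, b x ⬝ᵥ y.ofLp) := by
    filter_upwards [hF] with x hx using hx.self_of_nhds
  have dA := differentiableAt_quad_left ha y.ofLp
  have dB := differentiableAt_dotProduct_left hb y.ofLp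
  have d1 := differentiableAt_comp_pair dA dB hla
  have d2 := differentiableAt_comp_pair dA dB hlb
  have d3 := differentiableAt_mulVec_left ha y.ofLp l
  have h3 : ∀ k, partialDeriv (fun x => partialDeriv (fun v => F x v ^ 2) l y) k p
      = 2 * (laa * quad (dMat a p k) y.ofLp + lab * (dVec b p k ⬝ᵥ y.ofLp)) * (a p *ᵥ y.ofLp) l
        + 2 * la (quad (a p) y.ofLp, b p ⬝ᵥ y.ofLp) * (dMat a p k *ᵥ y.ofLp) l
        + (lab * quad (dMat a p k) y.ofLp + lbb * (dVec b p k ⬝ᵥ y.ofLp)) * b p l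
        + lb (quad (a p) y.ofLp, b p ⬝ᵥ y.ofLp) * dVec b p k l := fun k => by
    rw [partialDeriv_congr h1, partialDeriv_add ((d1.const_mul 2).fun_mul d3) (d2.fun_mul (hb l)),
      partialDeriv_mul (d1.const_mul 2) d3, partialDeriv_const_mul d1, partialDeriv_mul d2 (hb l),
      partialDeriv_comp_pair dA dB hla, partialDeriv_comp_pair dA dB hlb,
      partialDeriv_quad_left ha, partialDeriv_dotProduct_left hb, partialDeriv_mulVec_left ha]
    simp only [dVec]
    ring
  rw [partialDeriv_congr h2, partialDeriv_comp_pair dA dB hΛ.self_of_nhds,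
    partialDeriv_quad_left ha, partialDeriv_dotProduct_left hb]
  have h4 : ∀ k, partialDeriv (fun x => partialDeriv (fun v => F x v ^ 2) l y) k p * y.ofLp k
      = (2 * (a p *ᵥ y.ofLp) l * laa + b p l * lab) * (y.ofLp k * quad (dMat a p k) y.ofLp)
        + (2 * (a p *ᵥ y.ofLp) l * lab + b p l * lbb) * (y.ofLp k * (dVec b p k ⬝ᵥ y.ofLp))
        + 2 * la (quad (a p) y.ofLp, b p ⬝ᵥ y.ofLp) * (y.ofLp k * (dMat a p k *ᵥ y.ofLp) l)
        + lb (quad (a p) y.ofLp, b p ⬝ᵥ y.ofLp) * (y.ofLp k * dVec b p k l) := fun k => by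
    rw [h3]; ring
  simp only [h4, Finset.sum_add_distrib, ← Finset.mul_sum, sprayRhs]
  ring

end Spray

/-! ### The Riemannian spray, r_ij and s_ij, and the reduction to the equation for D. -/

section Connection

variable {n : ℕ} {a : EuclideanSpace ℝ (Fin n) → Matrix (Fin n) (Fin n) ℝ}
  {b : EuclideanSpace ℝ (Fin n) → Fin n → ℝ} {p y : EuclideanSpace ℝ (Fin n)}

/-- The quadratic form `½ Γ^i_jk y^j y^k`, as a matrix. -/
noncomputable def connMat (a : EuclideanSpace ℝ (Fin n) → Matrix (Fin n) (Fin n) ℝ)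
    (p : EuclideanSpace ℝ (Fin n)) (i : Fin n) : Matrix (Fin n) (Fin n) ℝ :=
  fun j k => (1 / 2) * christoffel a p i j k

/-- The vector `½ Γ^i_jk y^j y^k`. -/
noncomputable def conn (a : EuclideanSpace ℝ (Fin n) → Matrix (Fin n) (Fin n) ℝ)
    (p y : EuclideanSpace ℝ (Fin n)) (i : Fin n) : ℝ :=
  quad (connMat a p i) y.ofLp

/-- The matrix `s_ij`. -/
noncomputable def sMat (a : EuclideanSpace ℝ (Fin n) → Matrix (Fin n) (Fin n) ℝ)
    (b : EuclideanSpace ℝ (Fin n) → Fin n → ℝ) (p : EuclideanSpace ℝ (Fin n)) :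
    Matrix (Fin n) (Fin n) ℝ :=
  fun i j => sLow a b p i j

theorem quad_eq_sum (m : Matrix (Fin n) (Fin n) ℝ) (v : Fin n → ℝ) :
    quad m v = ∑ i, ∑ j, m i j * v i * v j := by
  simp only [quad, dotProduct, mulVec, Finset.mul_sum]
  exact Finset.sum_congr rfl fun i _ => Finset.sum_congr rfl fun j _ => by ring

theorem quad_transpose (m : Matrix (Fin n) (Fin n) ℝ) (v : Fin n → ℝ) :
    quad mᵀ v = quad m v := by
  rw [quad, quad, mulVec_transpose, dotProduct_mulVec, dotProduct_comm]

theorem dMat_comm (hsymm : ∀ x, (a x).IsSymm) (k i j : Fin n) :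
    dMat a p k i j = dMat a p k j i := by
  have h : (fun x => a x i j) = fun x => a x j i := by
    ext x; exact (hsymm x).apply _ _
  rw [dMat, dMat, h]

/-- Contracted with y^j y^k, the first two derivative terms of the Christoffel symbol coincide. -/
theorem conn_eq (hsymm : ∀ x, (a x).IsSymm) (p y : EuclideanSpace ℝ (Fin n)) :
    conn a p y = (a p)⁻¹ *ᵥ fun l => (1 / 4) * (2 * (∑ k, y.ofLp k * (dMat a p k *ᵥ y.ofLp) l)
      - quad (dMat a p l) y.ofLp) := by
  ext i
  have h : ∀ l, 2 * (∑ k, y.ofLp k * (dMat a p k *ᵥ y.ofLp) l) - quad (dMat a p l) y.ofLp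
      = ∑ j, ∑ k, (dMat a p j k l + dMat a p k j l - dMat a p l j k)
        * y.ofLp j * y.ofLp k := fun l => by
    have h1 : ∑ k, y.ofLp k * (dMat a p k *ᵥ y.ofLp) l
        = ∑ j, ∑ k, dMat a p j k l * y.ofLp j * y.ofLp k := by
      refine Finset.sum_congr rfl fun j _ => ?_
      rw [mulVec, dotProduct, Finset.mul_sum]
      refine Finset.sum_congr rfl fun k _ => ?_
      rw [dMat_comm hsymm]
      ring
    have h2 : ∑ j, ∑ k, dMat a p k j l * y.ofLp j * y.ofLp k
        = ∑ j, ∑ k, dMat a p j k l * y.ofLp j * y.ofLp k := by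
      rw [Finset.sum_comm]
      exact Finset.sum_congr rfl fun j _ => Finset.sum_congr rfl fun k _ => by ring
    simp only [sub_mul, add_mul, Finset.sum_add_distrib, Finset.sum_sub_distrib]
    rw [h1, h2, quad_eq_sum]
    ring
  simp only [h]
  simp only [mulVec, dotProduct, conn, quad_eq_sum, connMat, christoffel, Finset.mul_sum,
    Finset.sum_mul]
  refine ((Finset.sum_congr rfl fun j _ => Finset.sum_comm).trans Finset.sum_comm).trans ?_
  refine Finset.sum_congr rfl fun l _ => Finset.sum_congr rfl fun j _ =>
    Finset.sum_congr rfl fun k _ => ?_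
  simp only [dMat]
  ring

theorem mulVec_conn (hsymm : ∀ x, (a x).IsSymm) (hu : IsUnit (a p).det) (l : Fin n) :
    (a p *ᵥ conn a p y) l = (1 / 4) * (2 * (∑ k, y.ofLp k * (dMat a p k *ᵥ y.ofLp) l)
      - quad (dMat a p l) y.ofLp) := by
  rw [conn_eq hsymm, mulVec_mulVec, mul_nonsing_inv _ hu, one_mulVec]

/-- Contraction with y^i y^j absorbs the symmetrization, so only b_{i|j} y^i y^j has to be expanded.
-/
theorem r00_eq (a : EuclideanSpace ℝ (Fin n) → Matrix (Fin n) (Fin n) ℝ)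
    (b : EuclideanSpace ℝ (Fin n) → Fin n → ℝ) (p y : EuclideanSpace ℝ (Fin n)) :
    r00 a b p y = (∑ k, y.ofLp k * (dVec b p k ⬝ᵥ y.ofLp)) - 2 * (b p ⬝ᵥ conn a p y) := by
  have h1 : r00 a b p y = ∑ i, ∑ j, covDeriv a b p i j * y.ofLp i * y.ofLp j := by
    have h : ∑ i, ∑ j, covDeriv a b p j i * y.ofLp i * y.ofLp j
        = ∑ i, ∑ j, covDeriv a b p i j * y.ofLp i * y.ofLp j := by
      rw [Finset.sum_comm]
      exact Finset.sum_congr rfl fun j _ => Finset.sum_congr rfl fun k _ => by ring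
    simp only [r00, rLow, mul_add, add_mul, Finset.sum_add_distrib, mul_assoc, ← Finset.mul_sum]
    simp only [← mul_assoc]
    rw [h]
    ring
  have h2 : ∑ k, y.ofLp k * (dVec b p k ⬝ᵥ y.ofLp)
      = ∑ i, ∑ j, dVec b p j i * y.ofLp i * y.ofLp j := by
    simp only [dotProduct, Finset.mul_sum]
    rw [Finset.sum_comm]
    exact Finset.sum_congr rfl fun j _ => Finset.sum_congr rfl fun k _ => by ring
  have h3 : 2 * (b p ⬝ᵥ conn a p y)
      = ∑ i, ∑ j, (∑ k, christoffel a p k i j * b p k) * y.ofLp i * y.ofLp j := by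
    simp only [dotProduct, conn, quad_eq_sum, connMat, Finset.mul_sum, Finset.sum_mul]
    symm
    refine ((Finset.sum_congr rfl fun j _ => Finset.sum_comm).trans Finset.sum_comm).trans ?_
    exact Finset.sum_congr rfl fun l _ => Finset.sum_congr rfl fun j _ =>
      Finset.sum_congr rfl fun k _ => by ring
  rw [h1, h2, h3]
  simp only [covDeriv, sub_mul, Finset.sum_sub_distrib, dVec]

theorem christoffel_comm (hsymm : ∀ x, (a x).IsSymm) (k i j : Fin n) :
    christoffel a p k i j = christoffel a p k j i := by
  have h : (fun x => a x i j) = fun x => a x j i := by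
    ext x; exact (hsymm x).apply _ _
  simp only [christoffel, h]
  congr 1
  exact Finset.sum_congr rfl fun l _ => by ring

/-- The Christoffel symbols are symmetric in their lower indices and cancel: s_ij is an exterior
derivative and does not see the metric. -/
theorem sLow_eq (hsymm : ∀ x, (a x).IsSymm) (i j : Fin n) :
    sLow a b p i j = (1 / 2) * (dVec b p j i - dVec b p i j) := by
  simp only [sLow, covDeriv, christoffel_comm hsymm _ j i, dVec]
  ring

theorem sMat_mulVec (hsymm : ∀ x, (a x).IsSymm) (l : Fin n) :
    (sMat a b p *ᵥ y.ofLp) l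
      = (1 / 2) * ((∑ k, y.ofLp k * dVec b p k l) - dVec b p l ⬝ᵥ y.ofLp) := by
  simp only [mulVec, dotProduct, sMat, sLow_eq hsymm, ← Finset.sum_sub_distrib, Finset.mul_sum]
  exact Finset.sum_congr rfl fun k _ => by ring

theorem sMat_transpose (hsymm : ∀ x, (a x).IsSymm) : (sMat a b p)ᵀ = -sMat a b p := by
  ext i j
  change sLow a b p j i = - sLow a b p i j
  rw [sLow_eq hsymm, sLow_eq hsymm]
  ring

theorem dotProduct_mulVec_conn (hsymm : ∀ x, (a x).IsSymm) (hu : IsUnit (a p).det) :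
    y.ofLp ⬝ᵥ (a p *ᵥ conn a p y) = (1 / 4) * ∑ k, y.ofLp k * quad (dMat a p k) y.ofLp := by
  simp only [dotProduct, mulVec_conn hsymm hu]
  have h : ∀ l, y.ofLp l * (1 / 4 * (2 * (∑ k, y.ofLp k * (dMat a p k *ᵥ y.ofLp) l)
      - quad (dMat a p l) y.ofLp)) = (1 / 2) * (∑ k, y.ofLp k * (y.ofLp l *
        (dMat a p k *ᵥ y.ofLp) l)) - (1 / 4) * (y.ofLp l * quad (dMat a p l) y.ofLp) := fun l => by
    have : ∀ k, y.ofLp k * (y.ofLp l * (dMat a p k *ᵥ y.ofLp) l)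
      = y.ofLp l * (y.ofLp k * (dMat a p k *ᵥ y.ofLp) l) := fun k => by ring
    simp only [this, ← Finset.mul_sum]
    ring
  simp only [h, Finset.sum_sub_distrib, ← Finset.mul_sum]
  rw [Finset.sum_comm]
  simp only [← Finset.mul_sum]
  have : ∀ k, ∑ l, y.ofLp l * (dMat a p k *ᵥ y.ofLp) l = quad (dMat a p k) y.ofLp := fun k => rfl
  simp only [this]
  ring

/-- The derivatives of a enter the right-hand side exactly through the Hessian applied to `conn`.
The derivatives of b that remain combine into Sy and r_00, which is what the equation for D must
produce. -/
theorem sprayRhs_eq (hsymm : ∀ x, (a x).IsSymm) (hu : IsUnit (a p).det)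
    {la lb laa lab lbb : ℝ} {D : Fin n → ℝ}
    (hD : ∀ l, (hess la laa lab lbb (a p) (b p) y.ofLp *ᵥ D) l
      = lb * (sMat a b p *ᵥ y.ofLp) l
        + r00 a b p y * (lab * (a p *ᵥ y.ofLp) l + (1 / 2) * lbb * b p l)) :
    sprayRhs la lb laa lab lbb a b p y
      = (2 : ℝ) • (hess la laa lab lbb (a p) (b p) y.ofLp *ᵥ (conn a p y + D)) := by
  ext l
  rw [mulVec_add, Pi.smul_apply, Pi.add_apply, hD, hess_mulVec, sMat_mulVec hsymm, mulVec_conn hsymm hu,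
    r00_eq]
  have h : (a p *ᵥ y.ofLp) ⬝ᵥ conn a p y
      = (1 / 4) * ∑ k, y.ofLp k * quad (dMat a p k) y.ofLp := by
    rw [← dotProduct_mulVec_conn hsymm hu, dotProduct_comm, dotProduct_mulVec_symm (hsymm p)]
  rw [h, sprayRhs]
  simp only [smul_eq_mul]
  ring

variable {F : EuclideanSpace ℝ (Fin n) → EuclideanSpace ℝ (Fin n) → ℝ}
  {Λ la lb : ℝ × ℝ → ℝ} {laa lab lbb : ℝ}

/-- The spray of a Finsler function with `F² = Λ(α², β)`. -/
theorem sprayCoeff_eq_conn_add (hsymm : ∀ x, (a x).IsSymm) (hu : IsUnit (a p).det)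
    (ha : ∀ i j, DifferentiableAt ℝ (fun x => a x i j) p)
    (hb : ∀ i, DifferentiableAt ℝ (fun x => b x i) p)
    (hF : ∀ᶠ x in 𝓝 p, ∀ᶠ v in 𝓝 y, F x v ^ 2 = Λ (quad (a x) v.ofLp, b x ⬝ᵥ v.ofLp))
    (hΛ : ∀ᶠ z in 𝓝 (quad (a p) y.ofLp, b p ⬝ᵥ y.ofLp), HasFDerivAt Λ (pairForm (la z) (lb z)) z)
    (hla : HasFDerivAt la (pairForm laa lab) (quad (a p) y.ofLp, b p ⬝ᵥ y.ofLp))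
    (hlb : HasFDerivAt lb (pairForm lab lbb) (quad (a p) y.ofLp, b p ⬝ᵥ y.ofLp))
    (hdet : (hess (la (quad (a p) y.ofLp, b p ⬝ᵥ y.ofLp)) laa lab lbb (a p) (b p) y.ofLp).det ≠ 0)
    {D : Fin n → ℝ}
    (hD : ∀ l, (hess (la (quad (a p) y.ofLp, b p ⬝ᵥ y.ofLp)) laa lab lbb (a p) (b p) y.ofLp *ᵥ D) l
      = lb (quad (a p) y.ofLp, b p ⬝ᵥ y.ofLp) * (sMat a b p *ᵥ y.ofLp) l
        + r00 a b p y * (lab * (a p *ᵥ y.ofLp) l + (1 / 2) * lbb * b p l)) (i : Fin n) :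
    sprayCoeff F p y i = conn a p y i + D i := by
  rw [sprayCoeff_eq hsymm ha hb hF hΛ hla hlb,
    fundamentalTensor_eq hsymm hF.self_of_nhds hΛ hla hlb, sprayRhs_eq hsymm hu hD]
  set H := hess (la (quad (a p) y.ofLp, b p ⬝ᵥ y.ofLp)) laa lab lbb (a p) (b p) y.ofLp
  -- The fundamental tensor is H/2, so 2Hv = (H/2)(4v), and the 4 cancels the factor 1/4 in the
  -- definition of the spray.
  have h1 : (2 : ℝ) • (H *ᵥ (conn a p y + D))
      = ((1 / 2 : ℝ) • H) *ᵥ ((4 : ℝ) • (conn a p y + D)) := by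
    rw [smul_mulVec, mulVec_smul, smul_smul]
    norm_num
  have h2 : IsUnit ((1 / 2 : ℝ) • H).det := by
    rw [det_smul]
    exact (mul_ne_zero (by positivity) hdet).isUnit
  rw [h1, mulVec_mulVec, nonsing_inv_mul _ h2, one_mulVec]
  simp

end Connection

/-! ### Solving for D, and the nonvanishing denominators of the (q, α, β)-metric. -/

section Solve

variable {n : ℕ} {a S : Matrix (Fin n) (Fin n) ℝ} {b y : Fin n → ℝ}

theorem isSymm_of_posDef (ha : a.PosDef) : a.IsSymm := by
  have h := ha.isHermitian
  rwa [Matrix.IsHermitian, conjTranspose_eq_transpose_of_trivial] at h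

theorem isUnit_det_of_posDef (ha : a.PosDef) : IsUnit a.det := ha.det_pos.ne'.isUnit

theorem quad_pos (ha : a.PosDef) {v : Fin n → ℝ} (hv : v ≠ 0) : 0 < quad a v :=
  ha.dotProduct_mulVec_pos hv

theorem dotProduct_self_skew (hS : Sᵀ = -S) (v : Fin n → ℝ) : v ⬝ᵥ S *ᵥ v = 0 := by
  have h := quad_transpose S v
  rw [hS, quad, quad, neg_mulVec, dotProduct_neg] at h
  linarith

theorem mulVec_inv_mulVec (ha : a.PosDef) (v : Fin n → ℝ) : a *ᵥ (a⁻¹ *ᵥ v) = v := by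
  rw [mulVec_mulVec, mul_nonsing_inv _ (isUnit_det_of_posDef ha), one_mulVec]

/-- Solution of the equation of the spray for given values of the derivatives of `Λ`. -/
theorem hess_mulVec_solution (ha : a.PosDef) (hS : Sᵀ = -S)
    {la lb laa lab lbb κ X Y r : ℝ} (hκ : 2 * la * κ = lb)
    (hX : 2 * la * X + 4 * laa * (X * quad a y + Y * (b ⬝ᵥ y))
      + 2 * lab * (κ * (b ⬝ᵥ a⁻¹ *ᵥ S *ᵥ y) + X * (b ⬝ᵥ y) + Y * (b ⬝ᵥ a⁻¹ *ᵥ b)) = r * lab)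
    (hY : 2 * la * Y + 2 * lab * (X * quad a y + Y * (b ⬝ᵥ y))
      + lbb * (κ * (b ⬝ᵥ a⁻¹ *ᵥ S *ᵥ y) + X * (b ⬝ᵥ y) + Y * (b ⬝ᵥ a⁻¹ *ᵥ b))
        = r * (1 / 2 * lbb)) (l : Fin n) :
    (hess la laa lab lbb a b y *ᵥ (κ • a⁻¹ *ᵥ S *ᵥ y + X • y + Y • a⁻¹ *ᵥ b)) l
      = lb * (S *ᵥ y) l + r * (lab * (a *ᵥ y) l + (1 / 2) * lbb * b l) := by
  have h1 : a *ᵥ (κ • a⁻¹ *ᵥ S *ᵥ y + X • y + Y • a⁻¹ *ᵥ b)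
      = κ • S *ᵥ y + X • a *ᵥ y + Y • b := by
    simp only [mulVec_add, mulVec_smul, mulVec_inv_mulVec ha]
  -- Skewness gives y·Sy = 0, so this pairing contains no κ term.
  have h2 : (a *ᵥ y) ⬝ᵥ (κ • a⁻¹ *ᵥ S *ᵥ y + X • y + Y • a⁻¹ *ᵥ b)
      = X * quad a y + Y * (b ⬝ᵥ y) := by
    rw [dotProduct_comm, dotProduct_comm _ (a *ᵥ y), dotProduct_comm (a *ᵥ y),
      dotProduct_mulVec_symm (isSymm_of_posDef ha), h1]
    simp only [dotProduct_add, dotProduct_smul, dotProduct_self_skew hS, smul_eq_mul, quad,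
      dotProduct_comm b y]
    ring
  have h3 : b ⬝ᵥ (κ • a⁻¹ *ᵥ S *ᵥ y + X • y + Y • a⁻¹ *ᵥ b)
      = κ * (b ⬝ᵥ a⁻¹ *ᵥ S *ᵥ y) + X * (b ⬝ᵥ y) + Y * (b ⬝ᵥ a⁻¹ *ᵥ b) := by
    simp only [dotProduct_add, dotProduct_smul, smul_eq_mul]
  rw [hess_mulVec, h1, h2, h3]
  simp only [Pi.add_apply, Pi.smul_apply, smul_eq_mul]
  -- The hypotheses are the coefficients of Sy, ay and b in the equation to be solved.
  linear_combination (S *ᵥ y) l * hκ + (a *ᵥ y) l * hX + b l * hY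

theorem exists_ne_zero_dotProduct_eq_zero (hn : 3 ≤ n) (u w : Fin n → ℝ) :
    ∃ v : Fin n → ℝ, v ≠ 0 ∧ u ⬝ᵥ v = 0 ∧ w ⬝ᵥ v = 0 := by
  obtain ⟨v, hv, hv0⟩ := Submodule.exists_mem_ne_zero_of_ne_bot
    (LinearMap.ker_ne_bot_of_finrank_lt (f := (Matrix.of ![u, w]).mulVecLin)
      (by simp only [Module.finrank_fin_fun]; omega))
  refine ⟨v, hv0, ?_, ?_⟩
  · exact congrFun hv 0
  · exact congrFun hv 1

/-- On the common kernel of ay and b the Hessian acts as 2Λ_{α²}·a. For n ≥ 3 this kernel is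
nonzero, so the coefficient cannot vanish when the Hessian is invertible. -/
theorem la_ne_zero (hn : 3 ≤ n) {la laa lab lbb : ℝ}
    (hdet : (hess la laa lab lbb a b y).det ≠ 0) : la ≠ 0 := by
  rintro rfl
  obtain ⟨v, hv, h1, h2⟩ := exists_ne_zero_dotProduct_eq_zero hn (a *ᵥ y) b
  refine hdet (exists_mulVec_eq_zero_iff.1 ⟨v, hv, ?_⟩)
  ext l
  rw [hess_mulVec, h1, h2]
  simp

/-- The denominator `(1 - q²)β² + (2 - q)αβ + (1 + q(q - 1)b²)α²`. -/
def denom (q α B b2 : ℝ) : ℝ :=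
  (1 - q ^ 2) * B ^ 2 + (2 - q) * α * B + (1 + q * (q - 1) * b2) * α ^ 2

/-- The value of `∂Λ/∂α²` for `Λ = (α + β)^{2q} / α^{2q-2}`, with `L` the value of `Λ`. -/
noncomputable def qLa (q α B L : ℝ) : ℝ := L * (α + (1 - q) * B) / (α ^ 2 * (α + B))
/-- The value of `∂Λ/∂β` for `Λ` as in `qLa`. -/
noncomputable def qLb (q α B L : ℝ) : ℝ := 2 * q * L / (α + B)
/-- The value of `∂²Λ/∂α²∂β` for `Λ` as in `qLa`. -/
noncomputable def qLab (q α B L : ℝ) : ℝ :=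
  L * q * (α + 2 * (1 - q) * B) / (α ^ 2 * (α + B) ^ 2)
/-- The value of `∂²Λ/∂β²` for `Λ` as in `qLa`. -/
noncomputable def qLbb (q α B L : ℝ) : ℝ :=
  L * (2 * q * (2 * q - 1)) / (α + B) ^ 2
/-- The value of `∂²Λ/(∂α²)²` for `Λ` as in `qLa`. -/
noncomputable def qLaa (q α B L : ℝ) : ℝ :=
  - B * qLab q α B L / (2 * α ^ 2)

/-- The coefficient of `y` in the spray of the `(q, α, β)`-metric. -/
noncomputable def qRadial (q α B b2 r s0 : ℝ) : ℝ :=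
  q * (α + 2 * (1 - q) * B) / (2 * denom q α B b2)
    * (r - 2 * (q * α ^ 2 / (α + (1 - q) * B)) * s0)

variable {q α L : ℝ}

/-- Isolates the Cauchy–Schwarz defect α²b² - β², which vanishes when b is proportional to ay. -/
theorem denom_eq (q α B b2 : ℝ) :
    denom q α B b2 = (α + B) * (α + (1 - q) * B) + q * (q - 1) * (α ^ 2 * b2 - B ^ 2) := by
  rw [denom]; ring

/-- X is chosen so that the Hessian maps Xy + b^♯ to a vector with no ay component. The left side is
the remaining b component, a multiple of Δ; if Δ = 0, then Xy + b^♯ lies in the kernel. -/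
theorem denom_key {B b2 : ℝ} (hα : α ≠ 0) (hm : α + B ≠ 0) (hn' : α + (1 - q) * B ≠ 0)
    {X : ℝ} (hX : X = - q * (α + 2 * (1 - q) * B) / ((α + B) * (α + (1 - q) * B))
      * (b2 - B ^ 2 / α ^ 2)) :
    2 * qLa q α B L + 2 * qLab q α B L * (X * α ^ 2 + B) + qLbb q α B L * (X * B + b2)
      = 2 * L * denom q α B b2 / (α ^ 2 * (α + B) * (α + (1 - q) * B)) := by
  rw [hX, qLa, qLab, qLbb, denom_eq]
  field_simp
  ring

theorem denom_ne_zero (ha : a.PosDef) (hα : 0 < α) (hA : quad a y = α ^ 2)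
    (hm : α + b ⬝ᵥ y ≠ 0) (hn' : α + (1 - q) * (b ⬝ᵥ y) ≠ 0)
    (hdet : (hess (qLa q α (b ⬝ᵥ y) L) (qLaa q α (b ⬝ᵥ y) L) (qLab q α (b ⬝ᵥ y) L)
      (qLbb q α (b ⬝ᵥ y) L) a b y).det ≠ 0) : denom q α (b ⬝ᵥ y) (b ⬝ᵥ a⁻¹ *ᵥ b) ≠ 0 := by
  intro h0
  obtain ⟨X, hX⟩ : ∃ X, X = - q * (α + 2 * (1 - q) * (b ⬝ᵥ y))
    / ((α + b ⬝ᵥ y) * (α + (1 - q) * (b ⬝ᵥ y))) * (b ⬝ᵥ a⁻¹ *ᵥ b - (b ⬝ᵥ y) ^ 2 / α ^ 2) :=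
    ⟨_, rfl⟩
  have hsol := hess_mulVec_solution (S := 0) (b := b) (y := y) ha (by simp) (κ := 0)
    (la := qLa q α (b ⬝ᵥ y) L) (lb := 0) (laa := qLaa q α (b ⬝ᵥ y) L)
    (lab := qLab q α (b ⬝ᵥ y) L) (lbb := qLbb q α (b ⬝ᵥ y) L) (r := 0) (Y := 1) (X := X) (by simp)
    (by
      rw [hA, hX, qLaa, qLab, qLa]
      field_simp
      ring)
    (by
      have := denom_key (L := L) hα.ne' hm hn' hX
      rw [h0] at this
      rw [hA]
      linear_combination this)
  -- The kernel vector must be zero, so b = -X·ay. The Cauchy–Schwarz defect in `denom_eq` then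
  -- disappears, leaving a product of two nonzero factors.
  have hz : (0 : ℝ) • a⁻¹ *ᵥ (0 : Matrix (Fin n) (Fin n) ℝ) *ᵥ y + X • y + (1 : ℝ) • a⁻¹ *ᵥ b
      = 0 := by
    by_contra hne
    refine hdet (exists_mulVec_eq_zero_iff.1 ⟨_, hne, ?_⟩)
    ext l
    rw [hsol]
    simp
  simp only [zero_smul, zero_add, one_smul] at hz
  have hbs : a⁻¹ *ᵥ b = -X • y := by
    rw [neg_smul]; exact eq_neg_of_add_eq_zero_right hz
  have hb : b = -X • a *ᵥ y := by
    rw [← mulVec_smul, ← hbs, mulVec_inv_mulVec ha]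
  have hB : b ⬝ᵥ y = -X * α ^ 2 := by
    rw [hb, smul_dotProduct, dotProduct_comm, smul_eq_mul, ← hA, quad]
  have hb2 : b ⬝ᵥ a⁻¹ *ᵥ b = X ^ 2 * α ^ 2 := by
    rw [hbs, dotProduct_smul, hB, smul_eq_mul]; ring
  rw [denom_eq] at h0
  have : α ^ 2 * (b ⬝ᵥ a⁻¹ *ᵥ b) - (b ⬝ᵥ y) ^ 2 = 0 := by rw [hb2, hB]; ring
  rw [this, mul_zero, add_zero] at h0
  exact mul_ne_zero hm hn' h0

theorem q_solution (hq0 : q ≠ 0) (hq1 : q ≠ 1) (ha : a.PosDef) (hS : Sᵀ = -S) (hα : 0 < α) (hA : quad a y = α ^ 2)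
    (hm : α + b ⬝ᵥ y ≠ 0) (hn' : α + (1 - q) * (b ⬝ᵥ y) ≠ 0)
    (hΔ : denom q α (b ⬝ᵥ y) (b ⬝ᵥ a⁻¹ *ᵥ b) ≠ 0) (r : ℝ) (l : Fin n) :
    (hess (qLa q α (b ⬝ᵥ y) L) (qLaa q α (b ⬝ᵥ y) L) (qLab q α (b ⬝ᵥ y) L)
      (qLbb q α (b ⬝ᵥ y) L) a b y *ᵥ
        ((q * α ^ 2 / (α + (1 - q) * (b ⬝ᵥ y))) • a⁻¹ *ᵥ S *ᵥ y
          + qRadial q α (b ⬝ᵥ y) (b ⬝ᵥ a⁻¹ *ᵥ b) r (b ⬝ᵥ a⁻¹ *ᵥ S *ᵥ y) • y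
          + ((1 / 2) * (q * (q - 1) * α ^ 2 / denom q α (b ⬝ᵥ y) (b ⬝ᵥ a⁻¹ *ᵥ b))
            * (r - 2 * (q * α ^ 2 / (α + (1 - q) * (b ⬝ᵥ y))) * (b ⬝ᵥ a⁻¹ *ᵥ S *ᵥ y)))
              • a⁻¹ *ᵥ b)) l
      = qLb q α (b ⬝ᵥ y) L * (S *ᵥ y) l + r * (qLab q α (b ⬝ᵥ y) L * (a *ᵥ y) l
          + (1 / 2) * qLbb q α (b ⬝ᵥ y) L * b l) := by
  have hq1' : q - 1 ≠ 0 := sub_ne_zero.2 hq1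
  -- Eliminating b² in favour of Δ makes Δ an independent nonzero quantity in the rational
  -- identities below; this divides by q(q - 1).
  have hb2 : b ⬝ᵥ a⁻¹ *ᵥ b = ((denom q α (b ⬝ᵥ y) (b ⬝ᵥ a⁻¹ *ᵥ b)
      - (α + b ⬝ᵥ y) * (α + (1 - q) * (b ⬝ᵥ y))) / (q * (q - 1)) + (b ⬝ᵥ y) ^ 2) / α ^ 2 := by
    rw [denom_eq]
    field_simp
    ring
  apply hess_mulVec_solution ha hS
  · rw [qLa, qLb]
    field_simp
  all_goals
    rw [hA, qRadial]
    generalize b ⬝ᵥ a⁻¹ *ᵥ S *ᵥ y = s0 at *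
    generalize denom q α (b ⬝ᵥ y) (b ⬝ᵥ a⁻¹ *ᵥ b) = d at *
    rw [hb2]
    generalize b ⬝ᵥ y = B at *
  · rw [qLaa, qLab, qLa]
    field_simp
    ring
  · rw [qLab, qLbb, qLa]
    field_simp
    ring

end Solve

/-! ### First and second derivatives of (α + β)^{2q}/α^{2q-2} in the variables (α², β). -/

section PairDerivatives

theorem hasFDerivAt_pair {Φ : ℝ × ℝ → ℝ} {D : ℝ × ℝ →L[ℝ] ℝ} {s t : ℝ} {z : ℝ × ℝ}
    (h : HasFDerivAt Φ D z) (hs : D (1, 0) = s) (ht : D (0, 1) = t) :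
    HasFDerivAt Φ (pairForm s t) z := by
  have : D = pairForm s t := by
    ext
    · simp [pairForm, hs]
    · simp [pairForm, ht]
  rwa [← this]

theorem hasFDerivAt_fst_mul_snd {g h : ℝ → ℝ} {g' h' : ℝ} {z : ℝ × ℝ}
    (hg : HasDerivAt g g' z.1) (hh : HasDerivAt h h' z.2) :
    HasFDerivAt (fun z : ℝ × ℝ => g z.1 * h z.2) (pairForm (g' * h z.2) (g z.1 * h')) z := by
  have h1 : HasFDerivAt (fun z : ℝ × ℝ => g z.1) _ z := hg.comp_hasFDerivAt z (hasFDerivAt_fst (𝕜 := ℝ) (p := z))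
  have h2 : HasFDerivAt (fun z : ℝ × ℝ => h z.2) _ z := hh.comp_hasFDerivAt z (hasFDerivAt_snd (𝕜 := ℝ) (p := z))
  refine hasFDerivAt_pair (h1.fun_mul h2) ?_ ?_ <;> simp [mul_comm]

/-- `(α + β)^{2q} / α^{2q-2}` as a function of `α²` and `β`. -/
noncomputable def qLambda (q : ℝ) (z : ℝ × ℝ) : ℝ :=
  Real.exp ((1 - q) * Real.log z.1 + 2 * q * Real.log (Real.sqrt z.1 + z.2))

variable {q : ℝ} {z : ℝ × ℝ}

theorem hasFDerivAt_sqrt_fst (hz : 0 < z.1) :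
    HasFDerivAt (fun z : ℝ × ℝ => Real.sqrt z.1) (pairForm (1 / (2 * Real.sqrt z.1)) 0) z := by
  have h := (Real.hasDerivAt_sqrt hz.ne').comp_hasFDerivAt z (hasFDerivAt_fst (𝕜 := ℝ) (p := z))
  exact hasFDerivAt_pair (Φ := fun z : ℝ × ℝ => Real.sqrt z.1) h (by simp) (by simp)

theorem hasFDerivAt_sqrt_fst_add (c : ℝ) (hz : 0 < z.1) :
    HasFDerivAt (fun z : ℝ × ℝ => Real.sqrt z.1 + c * z.2)
      (pairForm (1 / (2 * Real.sqrt z.1)) c) z := by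
  refine hasFDerivAt_pair ((hasFDerivAt_sqrt_fst hz).fun_add
    ((hasFDerivAt_snd (𝕜 := ℝ) (p := z)).const_mul c)) ?_ ?_ <;> simp [pairForm]

theorem hasFDerivAt_qLambda (hz : 0 < z.1) (hm : Real.sqrt z.1 + z.2 ≠ 0) :
    HasFDerivAt (qLambda q) (pairForm (qLa q (Real.sqrt z.1) z.2 (qLambda q z))
      (qLb q (Real.sqrt z.1) z.2 (qLambda q z))) z := by
  have hm' := hasFDerivAt_sqrt_fst_add 1 hz
  simp only [one_mul] at hm'
  have h1 := ((((hasFDerivAt_fst (𝕜 := ℝ) (p := z)).log hz.ne').const_mul (1 - q)).fun_add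
    ((hm'.log hm).const_mul (2 * q))).exp
  have hα := Real.sqrt_pos.2 hz
  have hA : z.1 = Real.sqrt z.1 ^ 2 := (Real.sq_sqrt hz.le).symm
  refine hasFDerivAt_pair (Φ := qLambda q) h1 ?_ ?_
  · simp only [pairForm, FunLike.coe_smul, FunLike.coe_add, Pi.smul_apply, Pi.add_apply,
      ContinuousLinearMap.coe_fst', ContinuousLinearMap.coe_snd', smul_eq_mul]
    change qLambda q z * _ = _
    rw [qLa]
    generalize qLambda q z = L at *
    generalize Real.sqrt z.1 = α at *
    rw [hA]
    field_simp
    ring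
  · simp only [pairForm, FunLike.coe_smul, FunLike.coe_add, Pi.smul_apply, Pi.add_apply,
      ContinuousLinearMap.coe_fst', ContinuousLinearMap.coe_snd', smul_eq_mul]
    change qLambda q z * _ = _
    rw [qLb]
    field_simp
    ring

/-- The expression of `qLaa` through `qLab` is Euler's relation 2α²Λ_aa + βΛ_ab = 0, since ∂Λ/∂α² is
homogeneous of degree zero. -/
theorem hasFDerivAt_qLa (hz : 0 < z.1) (hm : Real.sqrt z.1 + z.2 ≠ 0) :
    HasFDerivAt (fun z : ℝ × ℝ => qLa q (Real.sqrt z.1) z.2 (qLambda q z))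
      (pairForm (qLaa q (Real.sqrt z.1) z.2 (qLambda q z))
        (qLab q (Real.sqrt z.1) z.2 (qLambda q z))) z := by
  have hm' := hasFDerivAt_sqrt_fst_add 1 hz
  simp only [one_mul] at hm'
  have hα := Real.sqrt_pos.2 hz
  have hden := ((hasFDerivAt_sqrt_fst hz).pow 2).fun_mul hm'
  have hne : Real.sqrt z.1 ^ 2 * (Real.sqrt z.1 + z.2) ≠ 0 := mul_ne_zero (by positivity) hm
  have h := ((hasFDerivAt_qLambda (q := q) hz hm).fun_mul
    (hasFDerivAt_sqrt_fst_add (1 - q) hz)).fun_mul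
      ((hasDerivAt_inv hne).comp_hasFDerivAt z hden)
  refine hasFDerivAt_pair (Φ := fun z : ℝ × ℝ => qLa q (Real.sqrt z.1) z.2 (qLambda q z))
    h ?_ ?_
  all_goals
    simp [pairForm]
    simp only [qLaa, qLab, qLa, qLb]
    generalize qLambda q z = L at *
    generalize Real.sqrt z.1 = α at *
    field_simp
    ring

theorem hasFDerivAt_qLb (hz : 0 < z.1) (hm : Real.sqrt z.1 + z.2 ≠ 0) :
    HasFDerivAt (fun z : ℝ × ℝ => qLb q (Real.sqrt z.1) z.2 (qLambda q z))
      (pairForm (qLab q (Real.sqrt z.1) z.2 (qLambda q z))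
        (qLbb q (Real.sqrt z.1) z.2 (qLambda q z))) z := by
  have hm' := hasFDerivAt_sqrt_fst_add 1 hz
  simp only [one_mul] at hm'
  have hα := Real.sqrt_pos.2 hz
  have h := ((hasFDerivAt_qLambda (q := q) hz hm).const_mul (2 * q)).fun_mul
      ((hasDerivAt_inv hm).comp_hasFDerivAt z hm')
  refine hasFDerivAt_pair (Φ := fun z : ℝ × ℝ => qLb q (Real.sqrt z.1) z.2 (qLambda q z))
    h ?_ ?_
  all_goals
    simp [pairForm]
    simp only [qLab, qLbb, qLa, qLb]
    generalize qLambda q z = L at *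
    generalize Real.sqrt z.1 = α at *
    field_simp
    ring

end PairDerivatives

/-! ### The Kropina metric: invertible Hessian, solution for D, derivatives of α⁴/β². -/

section Kropina

variable {n : ℕ} {a S : Matrix (Fin n) (Fin n) ℝ} {b y : Fin n → ℝ}

/-- The Hessian is in fact positive definite wherever β ≠ 0: splitting v into its component along y
and the a-orthogonal rest turns v·Hv into a sum of two nonnegative forms. -/
theorem kropina_det_ne_zero (ha : a.PosDef) (hB : b ⬝ᵥ y ≠ 0) :
    (hess (2 * quad a y / (b ⬝ᵥ y) ^ 2) (2 / (b ⬝ᵥ y) ^ 2) (-(4 * quad a y) / (b ⬝ᵥ y) ^ 3)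
      (6 * quad a y ^ 2 / (b ⬝ᵥ y) ^ 4) a b y).det ≠ 0 := by
  intro h0
  obtain ⟨v, hv, hv0⟩ := exists_mulVec_eq_zero_iff.2 h0
  have hy : y ≠ 0 := by rintro rfl; simp at hB
  have hA := quad_pos ha hy
  set A := quad a y with hAdef
  set B := b ⬝ᵥ y
  set c := (a *ᵥ y) ⬝ᵥ v with hc
  have h1 : v ⬝ᵥ (hess (2 * A / B ^ 2) (2 / B ^ 2) (-(4 * A) / B ^ 3)
      (6 * A ^ 2 / B ^ 4) a b y *ᵥ v) = 0 := by rw [hv0, dotProduct_zero]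
  have h2 : v ⬝ᵥ (hess (2 * A / B ^ 2) (2 / B ^ 2) (-(4 * A) / B ^ 3)
      (6 * A ^ 2 / B ^ 4) a b y *ᵥ v) = 4 * A / B ^ 2 * quad a v
        + c * (8 / B ^ 2 * c - 8 * A / B ^ 3 * (b ⬝ᵥ v))
        + (b ⬝ᵥ v) * (- 8 * A / B ^ 3 * c + 6 * A ^ 2 / B ^ 4 * (b ⬝ᵥ v)) := by
    have : hess (2 * A / B ^ 2) (2 / B ^ 2) (-(4 * A) / B ^ 3) (6 * A ^ 2 / B ^ 4) a b y *ᵥ v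
      = (4 * A / B ^ 2) • (a *ᵥ v) + (8 / B ^ 2 * c - 8 * A / B ^ 3 * (b ⬝ᵥ v)) • (a *ᵥ y)
        + (- 8 * A / B ^ 3 * c + 6 * A ^ 2 / B ^ 4 * (b ⬝ᵥ v)) • b := by
      ext l
      rw [hess_mulVec]
      simp only [Pi.add_apply, Pi.smul_apply, smul_eq_mul, ← hc]
      ring
    rw [this]
    simp only [dotProduct_add, dotProduct_smul, smul_eq_mul]
    rw [dotProduct_comm v (a *ᵥ y), dotProduct_comm v b, ← hc, ← quad]
    ring
  have h3 : quad a (v - (c / A) • y) = quad a v - c ^ 2 / A := by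
    have e1 : v ⬝ᵥ a *ᵥ y = c := dotProduct_comm _ _
    have e2 : y ⬝ᵥ a *ᵥ v = c := by rw [dotProduct_mulVec_symm (isSymm_of_posDef ha), e1]
    have e3 : y ⬝ᵥ a *ᵥ y = A := rfl
    rw [quad, mulVec_sub, mulVec_smul, sub_dotProduct, dotProduct_sub, dotProduct_sub]
    simp only [smul_dotProduct, dotProduct_smul, smul_eq_mul, e1, e2, e3]
    rw [← quad]
    field_simp
    ring
  have h4 : 0 ≤ quad a (v - (c / A) • y) := ha.posSemidef.dotProduct_mulVec_nonneg _
  -- With m = A(b·v)/B, the remaining binary form 12c² - 16cm + 6m² has negative discriminant, so c,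
  -- m and the a-norm of the orthogonal part all vanish.
  have h5 : 4 * A * quad a (v - (c / A) • y) + 12 * c ^ 2 - 16 * c * (A * (b ⬝ᵥ v) / B)
      + 6 * (A * (b ⬝ᵥ v) / B) ^ 2 = 0 := by
    rw [h2] at h1
    rw [h3]
    field_simp at h1 ⊢
    linear_combination h1
  have h6 : 0 ≤ 4 * A * quad a (v - (c / A) • y) := by positivity
  have h7 : c ^ 2 = 0 := by
    nlinarith [sq_nonneg (4 * c - 3 * (A * (b ⬝ᵥ v) / B)), sq_nonneg c]
  have h8 : c = 0 := by simpa using h7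
  have h9 : 4 * A * quad a (v - (c / A) • y) = 0 := by
    rw [h8] at h5 h6 ⊢
    nlinarith [sq_nonneg (A * (b ⬝ᵥ v) / B)]
  rw [h8, zero_div, zero_smul, sub_zero] at h9
  exact (mul_pos (mul_pos four_pos hA) (quad_pos ha hv)).ne' h9

/-- The coefficient of `y` in the spray of the Kropina metric. -/
noncomputable def kropinaRadial (A B b2 r s0 : ℝ) : ℝ := -((r + A / B * s0) * B / (A * b2))

theorem kropina_solution (ha : a.PosDef) (hS : Sᵀ = -S) (hB : b ⬝ᵥ y ≠ 0)
    (hb2 : b ⬝ᵥ a⁻¹ *ᵥ b ≠ 0) (r : ℝ) (l : Fin n) :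
    (hess (2 * quad a y / (b ⬝ᵥ y) ^ 2) (2 / (b ⬝ᵥ y) ^ 2) (-(4 * quad a y) / (b ⬝ᵥ y) ^ 3)
      (6 * quad a y ^ 2 / (b ⬝ᵥ y) ^ 4) a b y *ᵥ
        ((-(quad a y / (2 * (b ⬝ᵥ y)))) • a⁻¹ *ᵥ S *ᵥ y
          + kropinaRadial (quad a y) (b ⬝ᵥ y) (b ⬝ᵥ a⁻¹ *ᵥ b) r (b ⬝ᵥ a⁻¹ *ᵥ S *ᵥ y) • y
          + (1 / (2 * (b ⬝ᵥ a⁻¹ *ᵥ b))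
            * (r + quad a y / (b ⬝ᵥ y) * (b ⬝ᵥ a⁻¹ *ᵥ S *ᵥ y))) • a⁻¹ *ᵥ b)) l
      = -(2 * quad a y ^ 2) / (b ⬝ᵥ y) ^ 3 * (S *ᵥ y) l
        + r * (-(4 * quad a y) / (b ⬝ᵥ y) ^ 3 * (a *ᵥ y) l
          + (1 / 2) * (6 * quad a y ^ 2 / (b ⬝ᵥ y) ^ 4) * b l) := by
  have hy : y ≠ 0 := by rintro rfl; simp at hB
  have hA := (quad_pos ha hy).ne'
  apply hess_mulVec_solution ha hS
  all_goals
    try simp only [kropinaRadial]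
    generalize b ⬝ᵥ a⁻¹ *ᵥ S *ᵥ y = s0 at *
    generalize b ⬝ᵥ a⁻¹ *ᵥ b = b2 at *
    generalize quad a y = A at *
    generalize b ⬝ᵥ y = B at *
    field_simp
    try ring

theorem hasFDerivAt_kropina {z : ℝ × ℝ} (hz : z.2 ≠ 0) :
    HasFDerivAt (fun z : ℝ × ℝ => z.1 ^ 2 / z.2 ^ 2)
      (pairForm (2 * z.1 / z.2 ^ 2) (-(2 * z.1 ^ 2) / z.2 ^ 3)) z := by
  have h := hasFDerivAt_fst_mul_snd (hasDerivAt_pow 2 z.1)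
    ((hasDerivAt_pow 2 z.2).fun_inv (pow_ne_zero 2 hz))
  convert h using 2 <;> · field_simp <;> norm_num <;> (try left) <;> ring

theorem hasFDerivAt_kropina_fst {z : ℝ × ℝ} (hz : z.2 ≠ 0) :
    HasFDerivAt (fun z : ℝ × ℝ => 2 * z.1 / z.2 ^ 2)
      (pairForm (2 / z.2 ^ 2) (-(4 * z.1) / z.2 ^ 3)) z := by
  have h := hasFDerivAt_fst_mul_snd ((hasDerivAt_id z.1).const_mul 2)
    ((hasDerivAt_pow 2 z.2).fun_inv (pow_ne_zero 2 hz))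
  convert h using 2 <;> · simp; field_simp <;> norm_num <;> ring

theorem hasFDerivAt_kropina_snd {z : ℝ × ℝ} (hz : z.2 ≠ 0) :
    HasFDerivAt (fun z : ℝ × ℝ => -(2 * z.1 ^ 2) / z.2 ^ 3)
      (pairForm (-(4 * z.1) / z.2 ^ 3) (6 * z.1 ^ 2 / z.2 ^ 4)) z := by
  have h := hasFDerivAt_fst_mul_snd ((hasDerivAt_pow 2 z.1).const_mul (-2))
    ((hasDerivAt_pow 3 z.2).fun_inv (pow_ne_zero 3 hz))
  convert h using 2 <;> · field_simp <;> norm_num <;> (try left) <;> ring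

end Kropina

/-! ### The sprays of α, of the (q, α, β)-metric and of the Kropina metric in coordinates. -/

section LocalSprays

variable {n : ℕ} {a : EuclideanSpace ℝ (Fin n) → Matrix (Fin n) (Fin n) ℝ}
  {b : EuclideanSpace ℝ (Fin n) → Fin n → ℝ} {p y : EuclideanSpace ℝ (Fin n)}
  {F : EuclideanSpace ℝ (Fin n) → EuclideanSpace ℝ (Fin n) → ℝ} {Λ : ℝ × ℝ → ℝ}

theorem eventually_sq_eq
    (ha : ∀ i j, DifferentiableAt ℝ (fun x => a x i j) p)
    (hb : ∀ i, DifferentiableAt ℝ (fun x => b x i) p) {O : Set (ℝ × ℝ)} (hO : IsOpen O)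
    (hy : (quad (a p) y.ofLp, b p ⬝ᵥ y.ofLp) ∈ O)
    (hF : ∀ᶠ x in 𝓝 p, ∀ v, (quad (a x) v.ofLp, b x ⬝ᵥ v.ofLp) ∈ O →
      F x v ^ 2 = Λ (quad (a x) v.ofLp, b x ⬝ᵥ v.ofLp)) :
    ∀ᶠ x in 𝓝 p, ∀ᶠ v in 𝓝 y, F x v ^ 2 = Λ (quad (a x) v.ofLp, b x ⬝ᵥ v.ofLp) := by
  filter_upwards [hF, eventually_pair_left ha hb y.ofLp (hO.mem_nhds hy)] with x h1 h2
  filter_upwards [eventually_pair_right _ _ (hO.mem_nhds h2)] with v h3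
  exact h1 v h3

theorem sprayCoeff_norm (hsymm : ∀ x, (a x).IsSymm)
    (ha : ∀ i j, DifferentiableAt ℝ (fun x => a x i j) p) (hp : (a p).PosDef)
    (hF : ∀ᶠ x in 𝓝 p, ∀ v, F x v ^ 2 = quad (a x) v.ofLp) (i : Fin n) :
    sprayCoeff F p y i = conn a p y i := by
  have h := sprayCoeff_eq_conn_add (b := 0) (F := F) (y := y) (Λ := fun z => z.1)
    (la := fun _ => 1) (lb := fun _ => 0) (laa := 0) (lab := 0) (lbb := 0) hsymm
    (isUnit_det_of_posDef hp) ha (fun i => by simp)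
    (by filter_upwards [hF] with x hx using Filter.Eventually.of_forall hx)
    (Filter.Eventually.of_forall fun z => by
      simpa [pairForm] using (hasFDerivAt_fst (𝕜 := ℝ) (p := z)))
    (by simpa [pairForm] using (hasFDerivAt_const (𝕜 := ℝ) (1 : ℝ) _))
    (by simpa [pairForm] using (hasFDerivAt_const (𝕜 := ℝ) (0 : ℝ) _))
    (by
      have : hess 1 0 0 0 (a p) ((0 : EuclideanSpace ℝ (Fin n) → Fin n → ℝ) p) y.ofLp
        = (2 : ℝ) • a p := by
        ext i j
        simp [hess]
      rw [this, det_smul]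
      exact mul_ne_zero (by positivity) hp.det_pos.ne')
    (D := 0) (fun l => by simp) i
  simpa using h

/-- The two denominators are shown to be nonzero here because the positive definite tensor gives an
invertible Hessian; later limits and continuation arguments rely on this for every y ≠ 0. -/
theorem sprayCoeff_qMetric {q : ℝ} (hn : 3 ≤ n) (hq0 : q ≠ 0) (hq1 : q ≠ 1)
    (hsymm : ∀ x, (a x).IsSymm)
    (ha : ∀ i j, DifferentiableAt ℝ (fun x => a x i j) p)
    (hb : ∀ i, DifferentiableAt ℝ (fun x => b x i) p) (hp : (a p).PosDef) (hy : y ≠ 0)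
    (hm : 0 < Real.sqrt (quad (a p) y.ofLp) + b p ⬝ᵥ y.ofLp)
    (hF : ∀ᶠ x in 𝓝 p, ∀ v, F x v = (Real.sqrt (quad (a x) v.ofLp) + b x ⬝ᵥ v.ofLp) ^ q
      / Real.sqrt (quad (a x) v.ofLp) ^ (q - 1))
    (hg : (fundamentalTensor F p y).PosDef) :
    Real.sqrt (quad (a p) y.ofLp) + (1 - q) * (b p ⬝ᵥ y.ofLp) ≠ 0 ∧
    denom q (Real.sqrt (quad (a p) y.ofLp)) (b p ⬝ᵥ y.ofLp) (b p ⬝ᵥ (a p)⁻¹ *ᵥ b p) ≠ 0 ∧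
    ∀ i, sprayCoeff F p y i = conn a p y i +
      ((q * Real.sqrt (quad (a p) y.ofLp) ^ 2
          / (Real.sqrt (quad (a p) y.ofLp) + (1 - q) * (b p ⬝ᵥ y.ofLp)))
            • (a p)⁻¹ *ᵥ sMat a b p *ᵥ y.ofLp
        + qRadial q (Real.sqrt (quad (a p) y.ofLp)) (b p ⬝ᵥ y.ofLp) (b p ⬝ᵥ (a p)⁻¹ *ᵥ b p)
          (r00 a b p y) (b p ⬝ᵥ (a p)⁻¹ *ᵥ sMat a b p *ᵥ y.ofLp) • y.ofLp
        + ((1 / 2) * (q * (q - 1) * Real.sqrt (quad (a p) y.ofLp) ^ 2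
            / denom q (Real.sqrt (quad (a p) y.ofLp)) (b p ⬝ᵥ y.ofLp) (b p ⬝ᵥ (a p)⁻¹ *ᵥ b p))
          * (r00 a b p y - 2 * (q * Real.sqrt (quad (a p) y.ofLp) ^ 2
            / (Real.sqrt (quad (a p) y.ofLp) + (1 - q) * (b p ⬝ᵥ y.ofLp)))
              * (b p ⬝ᵥ (a p)⁻¹ *ᵥ sMat a b p *ᵥ y.ofLp))) • (a p)⁻¹ *ᵥ b p) i := by
  have hO : IsOpen {z : ℝ × ℝ | 0 < z.1 ∧ 0 < Real.sqrt z.1 + z.2} :=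
    (isOpen_lt continuous_const continuous_fst).inter
      (isOpen_lt continuous_const ((Real.continuous_sqrt.comp continuous_fst).add continuous_snd))
  have hA : 0 < quad (a p) y.ofLp := quad_pos hp fun h => hy (by ext i; exact congrFun h i)
  have hmem : (quad (a p) y.ofLp, b p ⬝ᵥ y.ofLp) ∈
    {z : ℝ × ℝ | 0 < z.1 ∧ 0 < Real.sqrt z.1 + z.2} := ⟨hA, hm⟩
  have hα := Real.sqrt_pos.2 hA
  have hF2 := eventually_sq_eq (F := F) (Λ := qLambda q) ha hb hO hmem (by
    filter_upwards [hF] with x hx v hv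
    have h1 := Real.sqrt_pos.2 hv.1
    rw [hx, qLambda, Real.rpow_def_of_pos hv.2, Real.rpow_def_of_pos h1, ← Real.exp_sub,
      ← Real.exp_nat_mul]
    congr 1
    -- `qLambda` is written with log α², the metric with log α.
    have h2 : Real.log (quad (a x) v.ofLp) = 2 * Real.log (Real.sqrt (quad (a x) v.ofLp)) := by
      rw [Real.log_sqrt hv.1.le]; ring
    simp only [h2]
    push_cast
    ring)
  have hΛ : ∀ᶠ z in 𝓝 (quad (a p) y.ofLp, b p ⬝ᵥ y.ofLp), HasFDerivAt (qLambda q)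
      (pairForm (qLa q (Real.sqrt z.1) z.2 (qLambda q z))
        (qLb q (Real.sqrt z.1) z.2 (qLambda q z))) z := by
    filter_upwards [hO.mem_nhds hmem] with z hz using hasFDerivAt_qLambda hz.1 hz.2.ne'
  have hla := hasFDerivAt_qLa (q := q) hmem.1 hmem.2.ne'
  have hlb := hasFDerivAt_qLb (q := q) hmem.1 hmem.2.ne'
  have hdet := hg.det_pos.ne'
  rw [fundamentalTensor_eq (la := fun z => qLa q (Real.sqrt z.1) z.2 (qLambda q z))
    (lb := fun z => qLb q (Real.sqrt z.1) z.2 (qLambda q z)) hsymm hF2.self_of_nhds hΛ hla hlb,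
    det_smul] at hdet
  replace hdet := right_ne_zero_of_mul hdet
  have hla0 := la_ne_zero hn hdet
  have hn' : Real.sqrt (quad (a p) y.ofLp) + (1 - q) * (b p ⬝ᵥ y.ofLp) ≠ 0 := by
    intro h0
    apply hla0
    simp only [qLa, h0, mul_zero, zero_div]
  have hA2 : quad (a p) y.ofLp = Real.sqrt (quad (a p) y.ofLp) ^ 2 := (Real.sq_sqrt hA.le).symm
  have hΔ := denom_ne_zero hp hα hA2 hm.ne' hn' hdet
  refine ⟨hn', hΔ, fun i => ?_⟩
  exact sprayCoeff_eq_conn_add (la := fun z => qLa q (Real.sqrt z.1) z.2 (qLambda q z))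
    (lb := fun z => qLb q (Real.sqrt z.1) z.2 (qLambda q z)) hsymm (isUnit_det_of_posDef hp) ha hb
    hF2 hΛ hla hlb hdet
    (q_solution hq0 hq1 hp (sMat_transpose hsymm) hα hA2 hm.ne' hn' hΔ _) i

theorem sprayCoeff_kropina (hsymm : ∀ x, (a x).IsSymm)
    (ha : ∀ i j, DifferentiableAt ℝ (fun x => a x i j) p)
    (hb : ∀ i, DifferentiableAt ℝ (fun x => b x i) p) (hp : (a p).PosDef)
    (hB : b p ⬝ᵥ y.ofLp ≠ 0) (hb2 : b p ⬝ᵥ (a p)⁻¹ *ᵥ b p ≠ 0)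
    (hF : ∀ᶠ x in 𝓝 p, ∀ v, F x v = quad (a x) v.ofLp / (b x ⬝ᵥ v.ofLp)) (i : Fin n) :
    sprayCoeff F p y i = conn a p y i +
      ((-(quad (a p) y.ofLp / (2 * (b p ⬝ᵥ y.ofLp)))) • (a p)⁻¹ *ᵥ sMat a b p *ᵥ y.ofLp
        + kropinaRadial (quad (a p) y.ofLp) (b p ⬝ᵥ y.ofLp) (b p ⬝ᵥ (a p)⁻¹ *ᵥ b p)
          (r00 a b p y) (b p ⬝ᵥ (a p)⁻¹ *ᵥ sMat a b p *ᵥ y.ofLp) • y.ofLp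
        + (1 / (2 * (b p ⬝ᵥ (a p)⁻¹ *ᵥ b p)) * (r00 a b p y + quad (a p) y.ofLp / (b p ⬝ᵥ y.ofLp)
          * (b p ⬝ᵥ (a p)⁻¹ *ᵥ sMat a b p *ᵥ y.ofLp))) • (a p)⁻¹ *ᵥ b p) i := by
  have hO : IsOpen {z : ℝ × ℝ | z.2 ≠ 0} := isOpen_ne_fun continuous_snd continuous_const
  have hF2 := eventually_sq_eq (F := F) (Λ := fun z => z.1 ^ 2 / z.2 ^ 2) ha hb hO hB (by
    filter_upwards [hF] with x hx v _
    rw [hx, div_pow])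
  exact sprayCoeff_eq_conn_add hsymm (isUnit_det_of_posDef hp) ha hb hF2
    (by filter_upwards [hO.mem_nhds hB] with z hz using hasFDerivAt_kropina hz)
    (hasFDerivAt_kropina_fst hB) (hasFDerivAt_kropina_snd hB) (kropina_det_ne_zero hp hB)
    (kropina_solution hp (sMat_transpose hsymm) hB hb2 _) i

end LocalSprays

/-! ### Algebra of quadratic maps, limits along rays, and parallel vectors. -/

section QuadraticMaps

variable {n : ℕ}

theorem quad_add_smul (m : Matrix (Fin n) (Fin n) ℝ) (y d : Fin n → ℝ) (t : ℝ) :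
    quad m (y + t • d) = quad m y + t * (y ⬝ᵥ m *ᵥ d + d ⬝ᵥ m *ᵥ y) + t ^ 2 * quad m d := by
  simp only [quad, mulVec_add, mulVec_smul, dotProduct_add, add_dotProduct, dotProduct_smul,
    smul_dotProduct, smul_eq_mul]
  ring

theorem quad_neg (m : Matrix (Fin n) (Fin n) ℝ) (y : Fin n → ℝ) : quad m (-y) = quad m y := by
  simp [quad, mulVec_neg]

theorem continuous_quad (m : Matrix (Fin n) (Fin n) ℝ) : Continuous (quad m) := by
  unfold quad
  fun_prop

theorem quad_sub_mat (m m' : Matrix (Fin n) (Fin n) ℝ) (y : Fin n → ℝ) :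
    quad (m - m') y = quad m y - quad m' y := by
  simp [quad, sub_mulVec]

theorem quad_add_mat (m m' : Matrix (Fin n) (Fin n) ℝ) (y : Fin n → ℝ) :
    quad (m + m') y = quad m y + quad m' y := by
  simp [quad, add_mulVec]

theorem quad_smul_mat (c : ℝ) (m : Matrix (Fin n) (Fin n) ℝ) (y : Fin n → ℝ) :
    quad (c • m) y = c * quad m y := by
  simp [quad, smul_mulVec]

/-- A quadratic form that vanishes on a hyperplane is a product of two linear forms. -/
theorem exists_quad_eq_mul (m : Matrix (Fin n) (Fin n) ℝ) {f e : Fin n → ℝ} (hfe : f ⬝ᵥ e = 1)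
    (h : ∀ y, f ⬝ᵥ y = 0 → quad m y = 0) :
    ∃ w : Fin n → ℝ, ∀ y, quad m y = (w ⬝ᵥ y) * (f ⬝ᵥ y) := by
  -- Since y - (f·y)e lies in the hyperplane, expanding m there expresses m(y) as f·y times this
  -- linear form.
  refine ⟨m *ᵥ e + e ᵥ* m - quad m e • f, fun y => ?_⟩
  have h1 := h (y + (-(f ⬝ᵥ y)) • e) (by
    rw [dotProduct_add, dotProduct_smul, hfe, smul_eq_mul]; ring)
  rw [quad_add_smul] at h1
  rw [sub_dotProduct, add_dotProduct, smul_dotProduct, ← dotProduct_mulVec, smul_eq_mul,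
    dotProduct_comm (m *ᵥ e)]
  linear_combination h1

/-- A vector-valued quadratic form that is everywhere parallel to a linear map of rank at least
two is the product of this linear map and a linear form. -/
theorem exists_quad_eq_linear_mul {ι : Type*} (m : ι → Matrix (Fin n) (Fin n) ℝ)
    (f e : ι → Fin n → ℝ) (hfe : ∀ i, f i ⬝ᵥ e i = 1) (hfe' : ∀ i j, i ≠ j → f i ⬝ᵥ e j = 0)
    (hι : ∀ i : ι, ∃ j, j ≠ i) (i₀ : ι)
    (h : ∀ y i j, quad (m i) y * (f j ⬝ᵥ y) = quad (m j) y * (f i ⬝ᵥ y)) :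
    ∃ w : Fin n → ℝ, ∀ i y, quad (m i) y = (w ⬝ᵥ y) * (f i ⬝ᵥ y) := by
  have h1 : ∀ i y, f i ⬝ᵥ y = 0 → quad (m i) y = 0 := by
    intro i y hy
    obtain ⟨j, hj⟩ := hι i
    -- Moving y along e_j keeps f_i·y = 0 and gives f_j·y the prescribed value t ≠ 0, which can be
    -- cancelled. The quadratic polynomial in t then has too many roots, so it also vanishes at the
    -- original y.
    have h2 : ∀ t : ℝ, t ≠ 0 → quad (m i) (y + (t - f j ⬝ᵥ y) • e j) = 0 := by
      intro t ht
      have h3 := h (y + (t - f j ⬝ᵥ y) • e j) i j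
      rw [dotProduct_add, dotProduct_smul, hfe, dotProduct_add, dotProduct_smul,
        hfe' i j (Ne.symm hj), hy, smul_eq_mul, smul_eq_mul] at h3
      have : quad (m i) (y + (t - f j ⬝ᵥ y) • e j) * t = 0 := by linear_combination h3
      exact (mul_eq_zero.1 this).resolve_right ht
    have e1 := h2 1 one_ne_zero
    have e2 := h2 (-1) (by norm_num)
    have e3 := h2 2 two_ne_zero
    rw [quad_add_smul] at e1 e2 e3
    have hE : quad (m i) (e j) = 0 := by
      linear_combination -(1 / 2) * e1 + (1 / 6) * e2 + (1 / 3) * e3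
    rw [hE] at e1 e2
    have hL : y ⬝ᵥ m i *ᵥ e j + e j ⬝ᵥ m i *ᵥ y = 0 := by
      linear_combination (1 / 2) * e1 - (1 / 2) * e2
    rw [hL] at e1
    linear_combination e1
  choose w hw using fun i => exists_quad_eq_mul (m i) (hfe i) (h1 i)
  refine ⟨w i₀, fun i y => ?_⟩
  rcases eq_or_ne i i₀ with rfl | hi
  · exact hw i y
  have h2 : ∀ y, (w i ⬝ᵥ y - w i₀ ⬝ᵥ y) * ((f i ⬝ᵥ y) * (f i₀ ⬝ᵥ y)) = 0 := fun y => by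
    have := h y i i₀
    rw [hw, hw] at this
    linear_combination this
  have hd1 : f i ⬝ᵥ (e i + e i₀) = 1 := by rw [dotProduct_add, hfe, hfe' _ _ hi, add_zero]
  have hd2 : f i₀ ⬝ᵥ (e i + e i₀) = 1 := by
    rw [dotProduct_add, hfe, hfe' _ _ (Ne.symm hi), zero_add]
  have h3 := h2 (e i + e i₀)
  rw [hd1, hd2, one_mul, mul_one] at h3
  -- The shift is long enough to make both f_i and f_{i₀} positive, so they can be cancelled; the
  -- difference w_i - w_{i₀} already vanishes on the shift direction by `h3`.
  have h4 := h2 (y + (|f i ⬝ᵥ y| + |f i₀ ⬝ᵥ y| + 1) • (e i + e i₀))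
  have h5 : ∀ u : Fin n → ℝ, u ⬝ᵥ (y + (|f i ⬝ᵥ y| + |f i₀ ⬝ᵥ y| + 1) • (e i + e i₀))
      = u ⬝ᵥ y + (|f i ⬝ᵥ y| + |f i₀ ⬝ᵥ y| + 1) * (u ⬝ᵥ (e i + e i₀)) := fun u => by
    rw [dotProduct_add, dotProduct_smul, smul_eq_mul]
  rw [h5, h5, h5, h5, hd1, hd2] at h4
  have h6 : 0 < f i ⬝ᵥ y + (|f i ⬝ᵥ y| + |f i₀ ⬝ᵥ y| + 1) * 1 := by
    linarith [neg_abs_le (f i ⬝ᵥ y), abs_nonneg (f i₀ ⬝ᵥ y)]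
  have h7 : 0 < f i₀ ⬝ᵥ y + (|f i ⬝ᵥ y| + |f i₀ ⬝ᵥ y| + 1) * 1 := by
    linarith [neg_abs_le (f i₀ ⬝ᵥ y), abs_nonneg (f i ⬝ᵥ y)]
  have h8 := (mul_eq_zero.1 h4).resolve_right (mul_pos h6 h7).ne'
  have h9 : w i ⬝ᵥ y = w i₀ ⬝ᵥ y := by
    linear_combination h8 - (|f i ⬝ᵥ y| + |f i₀ ⬝ᵥ y| + 1) * h3
  rw [hw, h9]

/-- Used with d pointing into an open half space, to carry an identity to its boundary. -/
theorem eq_zero_of_eq_zero_on_ray {g : (Fin n → ℝ) → ℝ} {y d : Fin n → ℝ}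
    (hg : ContinuousAt g y) (h : ∀ t : ℝ, 0 < t → g (y + t • d) = 0) : g y = 0 := by
  have h1 : Filter.Tendsto (fun t : ℝ => y + t • d) (𝓝[>] 0) (𝓝 y) := by
    have : Continuous (fun t : ℝ => y + t • d) := by fun_prop
    have h2 := this.tendsto 0
    rw [zero_smul, add_zero] at h2
    exact h2.mono_left nhdsWithin_le_nhds
  have h2 : Filter.Tendsto (fun t : ℝ => g (y + t • d)) (𝓝[>] 0) (𝓝 (g y)) := hg.tendsto.comp h1
  refine tendsto_nhds_unique h2 (tendsto_const_nhds.congr' ?_)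
  filter_upwards [self_mem_nhdsWithin] with t ht using (h t ht).symm

/-- T is a multiple of y; contracting the parallelism relation with ay shows that the multiple is
(y·aT)/α² = 0. -/
theorem eq_zero_of_parallel {a : Matrix (Fin n) (Fin n) ℝ} (ha : a.PosDef) {T y : Fin n → ℝ}
    (hy : y ≠ 0) (h : ∀ i j, T i * y j = T j * y i) (h0 : y ⬝ᵥ a *ᵥ T = 0) : T = 0 := by
  ext i
  have h1 : T i * quad a y = y i * (T ⬝ᵥ a *ᵥ y) := by
    simp only [quad, dotProduct, Finset.mul_sum]
    refine Finset.sum_congr rfl fun j _ => ?_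
    linear_combination (a *ᵥ y) j * h i j
  rw [dotProduct_mulVec_symm (isSymm_of_posDef ha), h0, mul_zero] at h1
  exact (mul_eq_zero.1 h1).resolve_right (quad_pos ha hy).ne'

end QuadraticMaps

/-! ### Skew forms on a hyperplane. -/

section Pointwise

variable {n : ℕ} {a S : Matrix (Fin n) (Fin n) ℝ} {b : Fin n → ℝ}

theorem dotProduct_inv_mulVec_mulVec (ha : a.PosDef) (S : Matrix (Fin n) (Fin n) ℝ)
    (b y : Fin n → ℝ) : b ⬝ᵥ a⁻¹ *ᵥ S *ᵥ y = ((a⁻¹ *ᵥ b) ᵥ* S) ⬝ᵥ y := by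
  rw [dotProduct_mulVec_symm (isSymm_of_posDef ha.inv), dotProduct_comm, dotProduct_mulVec]

theorem dotProduct_inv_mulVec_pos (ha : a.PosDef) (hb : b ≠ 0) : 0 < b ⬝ᵥ a⁻¹ *ᵥ b :=
  quad_pos ha.inv hb

/-- A skew matrix is determined by its values on the hyperplane `b = 0`. -/
theorem skew_eq_of_hyperplane (ha : a.PosDef) (hS : Sᵀ = -S) (hb : b ≠ 0)
    (h : ∀ y, b ⬝ᵥ y = 0 →
      S *ᵥ y = (((a⁻¹ *ᵥ b) ᵥ* S) ⬝ᵥ y / (b ⬝ᵥ a⁻¹ *ᵥ b)) • b) (i j : Fin n) :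
    S i j = 1 / (b ⬝ᵥ a⁻¹ *ᵥ b)
      * (b i * ((a⁻¹ *ᵥ b) ᵥ* S) j - b j * ((a⁻¹ *ᵥ b) ᵥ* S) i) := by
  have hb2 := (dotProduct_inv_mulVec_pos ha hb).ne'
  set bs := a⁻¹ *ᵥ b
  set σ := bs ᵥ* S with hσ
  have h1 : S *ᵥ bs = -σ := by
    rw [hσ, ← mulVec_transpose, hS, neg_mulVec, neg_neg]
  have h2 : σ ⬝ᵥ bs = 0 := by rw [hσ, ← dotProduct_mulVec, dotProduct_self_skew hS]
  have h3 : S *ᵥ Pi.single j 1 = fun i => S i j := by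
    ext; simp
  -- The projection of e_j to the hyperplane b = 0 along b^♯. The correction contributes no σ-term,
  -- since σ·b^♯ = 0 by skewness.
  have h4 := h (Pi.single j 1 - (b j / (b ⬝ᵥ bs)) • bs) (by
    rw [dotProduct_sub, dotProduct_smul, smul_eq_mul, div_mul_cancel₀ _ hb2]; simp)
  rw [mulVec_sub, mulVec_smul, h1, dotProduct_sub, dotProduct_smul, h2, h3] at h4
  have h5 := congrFun h4 i
  simp only [Pi.sub_apply, Pi.smul_apply, Pi.neg_apply, smul_eq_mul, mul_zero, sub_zero,
    dotProduct_single, mul_one] at h5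
  field_simp
  field_simp at h5
  linear_combination h5

end Pointwise

/-! ### Necessity of conditions 2 and 3, from the boundary of the half space. -/

section Necessity

variable {n : ℕ} {a S a' S' : Matrix (Fin n) (Fin n) ℝ} {b b' : Fin n → ℝ}

/-- E collects everything that stays continuous on the boundary. After multiplication by b'·y it
drops out in the limit, and only the numerators of the terms with 1/(b'·y) survive. -/
theorem kropina_sLow_eq (ha : a'.PosDef) (hS : S'ᵀ = -S') (hb : b' ≠ 0)
    {E : (Fin n → ℝ) → Fin n → ℝ} (hE : ∀ y, y ≠ 0 → ∀ i, ContinuousAt (fun v => E v i) y)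
    (H : ∀ y, 0 < b' ⬝ᵥ y → ∃ P : ℝ, ∀ i, E y i =
      ((-(quad a' y / (2 * (b' ⬝ᵥ y)))) • a'⁻¹ *ᵥ S' *ᵥ y
        + (1 / (2 * (b' ⬝ᵥ a'⁻¹ *ᵥ b'))
          * (quad a' y / (b' ⬝ᵥ y) * (b' ⬝ᵥ a'⁻¹ *ᵥ S' *ᵥ y))) • a'⁻¹ *ᵥ b') i + P * y i)
    (i j : Fin n) :
    S' i j = 1 / (b' ⬝ᵥ a'⁻¹ *ᵥ b')
      * (b' i * ((a'⁻¹ *ᵥ b') ᵥ* S') j - b' j * ((a'⁻¹ *ᵥ b') ᵥ* S') i) := by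
  refine skew_eq_of_hyperplane ha hS hb (fun y hy => ?_) i j
  rcases eq_or_ne y 0 with rfl | hy0
  · simp
  have hb2 := dotProduct_inv_mulVec_pos ha hb
  set b2 := b' ⬝ᵥ a'⁻¹ *ᵥ b' with hb2def
  -- T is, up to the factor -α²/2, the numerator of the singular terms. On b'·y = 0 it is
  -- a-orthogonal to y as well as parallel to it, hence zero.
  let T : (Fin n → ℝ) → Fin n → ℝ := fun v =>
    a'⁻¹ *ᵥ S' *ᵥ v - ((b' ⬝ᵥ a'⁻¹ *ᵥ S' *ᵥ v) / b2) • a'⁻¹ *ᵥ b'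
  have hT : ∀ i, Continuous fun v => T v i := fun i => by
    simp only [T, Pi.sub_apply, Pi.smul_apply]
    fun_prop
  have hquad := continuous_quad a'
  have key : ∀ i j, T y i * y j = T y j * y i := by
    intro i j
    have hc : ContinuousAt (fun v : Fin n → ℝ => ((b' ⬝ᵥ v) * E v i + quad a' v / 2 * T v i) * v j
        - ((b' ⬝ᵥ v) * E v j + quad a' v / 2 * T v j) * v i) y := by
      have h1 := hE y hy0 i
      have h2 := hE y hy0 j
      have h3 := (hT i).continuousAt (x := y)
      have h4 := (hT j).continuousAt (x := y)
      have h5 := hquad.continuousAt (x := y)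
      have h6 : ContinuousAt (fun v => b' ⬝ᵥ v) y := by fun_prop
      have h7 := fun k => (continuous_apply (A := fun _ : Fin n => ℝ) k).continuousAt (x := y)
      exact (((h6.mul h1).add ((h5.div_const 2).mul h3)).mul (h7 j)).sub
        (((h6.mul h2).add ((h5.div_const 2).mul h4)).mul (h7 i))
    have h0 := eq_zero_of_eq_zero_on_ray (d := a'⁻¹ *ᵥ b') hc (fun t ht => by
      set v := y + t • a'⁻¹ *ᵥ b' with hv
      have hB : 0 < b' ⬝ᵥ v := by
        rw [hv, dotProduct_add, hy, zero_add, dotProduct_smul, smul_eq_mul]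
        exact mul_pos ht hb2
      obtain ⟨P, hP⟩ := H v hB
      have h1 : ∀ i, (b' ⬝ᵥ v) * E v i + quad a' v / 2 * T v i = (b' ⬝ᵥ v) * P * v i := fun i => by
        rw [hP i]
        simp only [T, Pi.add_apply, Pi.sub_apply, Pi.smul_apply, smul_eq_mul]
        generalize (a'⁻¹ *ᵥ S' *ᵥ v) i = x1
        generalize (a'⁻¹ *ᵥ b') i = x2
        generalize b' ⬝ᵥ a'⁻¹ *ᵥ S' *ᵥ v = x3
        field_simp
        ring
      rw [h1, h1]
      ring)
    rw [hy] at h0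
    have hA := quad_pos ha hy0
    have h1 : quad a' y / 2 * (T y i * y j - T y j * y i) = 0 := by linear_combination h0
    have h2 := (mul_eq_zero.1 h1).resolve_left (by positivity)
    linear_combination h2
  have haT : a' *ᵥ T y = S' *ᵥ y - ((b' ⬝ᵥ a'⁻¹ *ᵥ S' *ᵥ y) / b2) • b' := by
    simp only [T, mulVec_sub, mulVec_smul, mulVec_inv_mulVec ha]
  have hT0 : T y = 0 := eq_zero_of_parallel ha hy0 key (by
    rw [haT, dotProduct_sub, dotProduct_self_skew hS, dotProduct_smul, dotProduct_comm y, hy]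
    simp)
  rw [hT0, mulVec_zero] at haT
  rw [← dotProduct_inv_mulVec_mulVec ha]
  exact (sub_eq_zero.1 haT.symm)

variable {q : ℝ}

theorem continuous_denom (q b2 : ℝ) {a : Matrix (Fin n) (Fin n) ℝ} {b : Fin n → ℝ} :
    Continuous fun v : Fin n → ℝ => denom q (Real.sqrt (quad a v)) (b ⬝ᵥ v) b2 := by
  have hα := (continuous_quad a).sqrt
  unfold denom
  fun_prop

theorem continuousAt_qForce (q b2 : ℝ) {a S R : Matrix (Fin n) (Fin n) ℝ} {b y : Fin n → ℝ}
    (hn : Real.sqrt (quad a y) + (1 - q) * (b ⬝ᵥ y) ≠ 0)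
    (hΔ : denom q (Real.sqrt (quad a y)) (b ⬝ᵥ y) b2 ≠ 0) (i : Fin n) :
    ContinuousAt (fun y => ((q * Real.sqrt (quad a y) ^ 2
          / (Real.sqrt (quad a y) + (1 - q) * (b ⬝ᵥ y))) • a⁻¹ *ᵥ S *ᵥ y
        + ((1 / 2) * (q * (q - 1) * Real.sqrt (quad a y) ^ 2
            / denom q (Real.sqrt (quad a y)) (b ⬝ᵥ y) b2)
          * (quad R y - 2 * (q * Real.sqrt (quad a y) ^ 2
            / (Real.sqrt (quad a y) + (1 - q) * (b ⬝ᵥ y)))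
              * (b ⬝ᵥ a⁻¹ *ᵥ S *ᵥ y))) • a⁻¹ *ᵥ b) i) y := by
  have hα := ((continuous_quad a).sqrt).continuousAt (x := y)
  have hd := (continuous_denom q b2 (a := a) (b := b)).continuousAt (x := y)
  have hR := (continuous_quad R).continuousAt (x := y)
  have hB : ContinuousAt (fun v => b ⬝ᵥ v) y := by fun_prop
  have hκ : ContinuousAt (fun y => q * Real.sqrt (quad a y) ^ 2
      / (Real.sqrt (quad a y) + (1 - q) * (b ⬝ᵥ y))) y :=
    ContinuousAt.div₀ (by fun_prop) (by fun_prop) hn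
  have hψ : ContinuousAt (fun y => q * (q - 1) * Real.sqrt (quad a y) ^ 2
      / denom q (Real.sqrt (quad a y)) (b ⬝ᵥ y) b2) y :=
    ContinuousAt.div₀ (by fun_prop) hd hΔ
  simp only [Pi.add_apply, Pi.smul_apply, smul_eq_mul]
  have h1 : ContinuousAt (fun v => (a⁻¹ *ᵥ S *ᵥ v) i) y := by fun_prop
  have h2 : ContinuousAt (fun v => b ⬝ᵥ a⁻¹ *ᵥ S *ᵥ v) y := by fun_prop
  fun_prop

/-- Parallelism on the half space `b' > 0` extends to its boundary. -/
theorem parallel_on_boundary (ha : a'.PosDef) (hb : b' ≠ 0) {Z : (Fin n → ℝ) → Fin n → ℝ}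
    {y : Fin n → ℝ} (hy : b' ⬝ᵥ y = 0) (hZ : ∀ i, ContinuousAt (fun v => Z v i) y)
    (H : ∀ y, 0 < b' ⬝ᵥ y → ∃ P : ℝ, ∀ i, Z y i = P * y i) (i j : Fin n) :
    Z y i * y j = Z y j * y i := by
  have hb2 := dotProduct_inv_mulVec_pos ha hb
  have hc : ContinuousAt (fun v : Fin n → ℝ => Z v i * v j - Z v j * v i) y := by
    have h7 := fun k => (continuous_apply (A := fun _ : Fin n => ℝ) k).continuousAt (x := y)
    exact ((hZ i).mul (h7 j)).sub ((hZ j).mul (h7 i))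
  have h0 := eq_zero_of_eq_zero_on_ray (d := a'⁻¹ *ᵥ b') hc (fun t ht => by
    have hB : 0 < b' ⬝ᵥ (y + t • a'⁻¹ *ᵥ b') := by
      rw [dotProduct_add, hy, zero_add, dotProduct_smul, smul_eq_mul]
      exact mul_pos ht hb2
    obtain ⟨P, hP⟩ := H _ hB
    rw [hP, hP]
    ring)
  linear_combination h0

/-- On b·y = 0 the force is even in y except for qα(a⁻¹Sy - ψ s_0 b^♯), with ψ = q(q - 1)/(1 + q(q -
1)b²). Parity isolates this vector, which must vanish. Thus S kills the hyperplane, and skewness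
gives S = 0. -/
theorem q_sMat_eq_zero (hq0 : q ≠ 0) (ha : a.PosDef) (hS : Sᵀ = -S) (hb : b ≠ 0)
    {c : ℝ} (hbc : b = c • b') {R : Matrix (Fin n) (Fin n) ℝ}
    (hn : ∀ y, y ≠ 0 → Real.sqrt (quad a y) + (1 - q) * (b ⬝ᵥ y) ≠ 0)
    (hΔ : ∀ y, y ≠ 0 → denom q (Real.sqrt (quad a y)) (b ⬝ᵥ y) (b ⬝ᵥ a⁻¹ *ᵥ b) ≠ 0)
    (N : Fin n → Matrix (Fin n) (Fin n) ℝ)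
    (H : ∀ y, 0 < b' ⬝ᵥ y → ∃ P : ℝ, ∀ i, quad (N i) y +
      ((q * Real.sqrt (quad a y) ^ 2
          / (Real.sqrt (quad a y) + (1 - q) * (b ⬝ᵥ y))) • a⁻¹ *ᵥ S *ᵥ y
        + ((1 / 2) * (q * (q - 1) * Real.sqrt (quad a y) ^ 2
            / denom q (Real.sqrt (quad a y)) (b ⬝ᵥ y) (b ⬝ᵥ a⁻¹ *ᵥ b))
          * (quad R y - 2 * (q * Real.sqrt (quad a y) ^ 2
            / (Real.sqrt (quad a y) + (1 - q) * (b ⬝ᵥ y)))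
              * (b ⬝ᵥ a⁻¹ *ᵥ S *ᵥ y))) • a⁻¹ *ᵥ b) i = P * y i) : S = 0 := by
  have hb' : b' ≠ 0 := by rintro rfl; simp [hbc] at hb
  have hb2 := dotProduct_inv_mulVec_pos ha hb
  have main : ∀ y, b ⬝ᵥ y = 0 → S *ᵥ y = 0 := by
    intro y hy
    rcases eq_or_ne y 0 with rfl | hy0
    · simp
    have hc0 : c ≠ 0 := by rintro rfl; simp [hbc] at hb
    have hy' : b' ⬝ᵥ y = 0 := by
      rw [hbc, smul_dotProduct, smul_eq_mul] at hy
      exact (mul_eq_zero.1 hy).resolve_left hc0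
    -- Collinearity is essential: the boundary b'·y = 0 of the domain is also the hyperplane b·y =
    -- 0, where the denominators simplify.
    have hpar := fun (y : Fin n → ℝ) (hy0 : y ≠ 0) (hy' : b' ⬝ᵥ y = 0) =>
      parallel_on_boundary (Z := fun v i => quad (N i) v +
      ((q * Real.sqrt (quad a v) ^ 2
          / (Real.sqrt (quad a v) + (1 - q) * (b ⬝ᵥ v))) • a⁻¹ *ᵥ S *ᵥ v
        + ((1 / 2) * (q * (q - 1) * Real.sqrt (quad a v) ^ 2
            / denom q (Real.sqrt (quad a v)) (b ⬝ᵥ v) (b ⬝ᵥ a⁻¹ *ᵥ b))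
          * (quad R v - 2 * (q * Real.sqrt (quad a v) ^ 2
            / (Real.sqrt (quad a v) + (1 - q) * (b ⬝ᵥ v)))
              * (b ⬝ᵥ a⁻¹ *ᵥ S *ᵥ v))) • a⁻¹ *ᵥ b) i) ha hb' hy' (fun i =>
        ((continuous_quad (N i)).continuousAt).add (continuousAt_qForce q _ (hn y hy0) (hΔ y hy0) i))
        H
    -- Both y and -y lie on the boundary, so the parallelism is available for both.
    have e1 := hpar y hy0 hy'
    have e2 := hpar (-y) (neg_ne_zero.2 hy0) (by rw [dotProduct_neg, hy', neg_zero])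
    have hα := Real.sqrt_pos.2 (quad_pos ha hy0)
    have hΔy := hΔ y hy0
    simp only [quad_neg, mulVec_neg, dotProduct_neg, hy, neg_zero, mul_zero, add_zero, Pi.add_apply,
      Pi.smul_apply, Pi.neg_apply, smul_eq_mul] at e1 e2
    rw [hy] at hΔy
    set s0 := b ⬝ᵥ a⁻¹ *ᵥ S *ᵥ y with hs0
    set α := Real.sqrt (quad a y)
    set b2 := b ⬝ᵥ a⁻¹ *ᵥ b with hb2def
    have hden : denom q α 0 b2 = (1 + q * (q - 1) * b2) * α ^ 2 := by rw [denom]; ring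
    have hb2n : 1 + q * (q - 1) * b2 ≠ 0 := by
      intro h0; rw [hden, h0, zero_mul] at hΔy; exact hΔy rfl
    let ψ := q * (q - 1) / (1 + q * (q - 1) * b2)
    let T : Fin n → ℝ := a⁻¹ *ᵥ S *ᵥ y - (ψ * s0) • a⁻¹ *ᵥ b
    have hT : ∀ i j, T i * y j = T j * y i := by
      intro i j
      have h1 := e1 i j
      have h2 := e2 i j
      rw [hden] at h1 h2
      simp only [T, Pi.sub_apply, Pi.smul_apply, smul_eq_mul, ψ]
      generalize (a⁻¹ *ᵥ S *ᵥ y) i = x1 at *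
      generalize (a⁻¹ *ᵥ S *ᵥ y) j = x2 at *
      generalize (a⁻¹ *ᵥ b) i = x3 at *
      generalize (a⁻¹ *ᵥ b) j = x4 at *
      have h3 : 2 * (q * α) * ((x1 - q * (q - 1) / (1 + q * (q - 1) * b2) * s0 * x3) * y j
          - (x2 - q * (q - 1) / (1 + q * (q - 1) * b2) * s0 * x4) * y i) = 0 := by
        field_simp at h1 h2 ⊢
        linear_combination (1 / 2) * h1 + (1 / 2) * h2
      have h4 := (mul_eq_zero.1 h3).resolve_left (by positivity)
      linear_combination h4
    have haT : a *ᵥ T = S *ᵥ y - (ψ * s0) • b := by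
      simp only [T, mulVec_sub, mulVec_smul, mulVec_inv_mulVec ha]
    have hT0 : T = 0 := eq_zero_of_parallel ha hy0 hT (by
      rw [haT, dotProduct_sub, dotProduct_self_skew hS, dotProduct_smul, dotProduct_comm y, hy]
      simp)
    -- Pairing T = 0 with b gives s_0(1 - ψb²) = 0, and 1 - ψb² = 1/(1 + q(q - 1)b²) is nonzero.
    have hs : s0 = 0 := by
      have h1 : b ⬝ᵥ T = 0 := by rw [hT0, dotProduct_zero]
      simp only [T, dotProduct_sub, dotProduct_smul, smul_eq_mul, ← hs0, ← hb2def, ψ] at h1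
      field_simp at h1
      linear_combination h1
    rw [hT0, hs, mulVec_zero, mul_zero, zero_smul, sub_zero] at haT
    exact haT.symm
  have hσ : ∀ y, b ⬝ᵥ y = 0 → ((a⁻¹ *ᵥ b) ᵥ* S) ⬝ᵥ y = 0 := fun y hy => by
    rw [← dotProduct_mulVec, main y hy, dotProduct_zero]
  have hσ0 : (a⁻¹ *ᵥ b) ᵥ* S = 0 := by
    ext j
    have h1 := hσ (Pi.single j 1 - (b j / (b ⬝ᵥ a⁻¹ *ᵥ b)) • a⁻¹ *ᵥ b) (by
      rw [dotProduct_sub, dotProduct_smul, smul_eq_mul, div_mul_cancel₀ _ hb2.ne']; simp)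
    rw [dotProduct_sub, dotProduct_smul, ← dotProduct_mulVec (a⁻¹ *ᵥ b) S (a⁻¹ *ᵥ b),
      dotProduct_self_skew hS] at h1
    simpa using h1
  ext i j
  rw [skew_eq_of_hyperplane ha hS hb (fun y hy => by rw [main y hy, hσ0]; simp) i j, hσ0]
  simp

end Necessity

/-! ### From parallelism on a half space to a linear factor on the whole space. -/

section HalfSpace

variable {n : ℕ} {a : Matrix (Fin n) (Fin n) ℝ} {b b' : Fin n → ℝ} {q : ℝ}

theorem exists_ne_ne (hn : 3 ≤ n) (i k : Fin n) : ∃ j, j ≠ i ∧ j ≠ k := by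
  have h := Finset.card_le_two (a := i) (b := k)
  obtain ⟨j, -, hj⟩ := Finset.exists_mem_notMem_of_card_lt_card
    (s := {i, k}) (t := (Finset.univ : Finset (Fin n)))
    (by rw [Finset.card_univ, Fintype.card_fin]; omega)
  simp only [Finset.mem_insert, Finset.mem_singleton, not_or] at hj
  exact ⟨j, hj⟩

theorem analyticAt_quad_line (m : Matrix (Fin n) (Fin n) ℝ) (y d : Fin n → ℝ) (t : ℝ) :
    AnalyticAt ℝ (fun t : ℝ => quad m (y + t • d)) t := by
  simp only [quad_add_smul]
  fun_prop

theorem analyticAt_dotProduct_line (w y d : Fin n → ℝ) (t : ℝ) :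
    AnalyticAt ℝ (fun t : ℝ => w ⬝ᵥ (y + t • d)) t := by
  simp only [dotProduct_add, dotProduct_smul, smul_eq_mul]
  fun_prop

theorem analyticAt_sqrt_quad_line (m : Matrix (Fin n) (Fin n) ℝ) {y d : Fin n → ℝ} {t : ℝ}
    (h : 0 < quad m (y + t • d)) :
    AnalyticAt ℝ (fun t : ℝ => Real.sqrt (quad m (y + t • d))) t := by
  exact AnalyticAt.fun_comp (f := fun t : ℝ => quad m (y + t • d))
    (Real.contDiffAt_sqrt (n := ω) h.ne').analyticAt (analyticAt_quad_line m y d t)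

/-- If a quadratic map plus the force of the `(q, α, β)`-metric is parallel to `y` on a half
space, then it is the product of `y` and a linear form, on the whole space. -/
theorem exists_linear_of_half_space (hn : 3 ≤ n) (ha : a.PosDef) (hb : b ≠ 0) {c : ℝ}
    (hbc : b = c • b') {R : Matrix (Fin n) (Fin n) ℝ}
    (hΔ : ∀ y, y ≠ 0 → denom q (Real.sqrt (quad a y)) (b ⬝ᵥ y) (b ⬝ᵥ a⁻¹ *ᵥ b) ≠ 0)
    (N : Fin n → Matrix (Fin n) (Fin n) ℝ)
    (H : ∀ y, 0 < b' ⬝ᵥ y → ∃ P : ℝ, ∀ i, quad (N i) y +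
      (1 / 2) * (q * (q - 1) * Real.sqrt (quad a y) ^ 2 * quad R y
          / denom q (Real.sqrt (quad a y)) (b ⬝ᵥ y) (b ⬝ᵥ a⁻¹ *ᵥ b)) * (a⁻¹ *ᵥ b) i = P * y i) :
    ∃ w : Fin n → ℝ, ∀ y, y ≠ 0 → ∀ i, quad (N i) y +
      (1 / 2) * (q * (q - 1) * Real.sqrt (quad a y) ^ 2 * quad R y
          / denom q (Real.sqrt (quad a y)) (b ⬝ᵥ y) (b ⬝ᵥ a⁻¹ *ᵥ b)) * (a⁻¹ *ᵥ b) i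
        = (w ⬝ᵥ y) * y i := by
  have hb' : b' ≠ 0 := by rintro rfl; simp [hbc] at hb
  have hc0 : c ≠ 0 := by rintro rfl; simp [hbc] at hb
  have hb2 := dotProduct_inv_mulVec_pos ha hb
  have hb2' := dotProduct_inv_mulVec_pos ha hb'
  set bs := a⁻¹ *ᵥ b with hbs
  set b2 := b ⬝ᵥ bs with hb2def
  obtain ⟨k, hk⟩ : ∃ k, bs k ≠ 0 := by
    by_contra! h
    have : bs = 0 := funext h
    rw [hb2def, this, dotProduct_zero] at hb2
    exact lt_irrefl _ hb2
  -- These n - 1 forms annihilate b^♯, so taking the same combinations of components removes the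
  -- non-quadratic term.
  let f : {i // i ≠ k} → Fin n → ℝ := fun i =>
    Pi.single i.1 1 - (bs i.1 / bs k) • Pi.single k 1
  have hf : ∀ i y, f i ⬝ᵥ y = y i.1 - bs i.1 / bs k * y k := fun i y => by
    simp [f, sub_dotProduct]
  let m : {i // i ≠ k} → Matrix (Fin n) (Fin n) ℝ := fun i =>
    N i.1 - (bs i.1 / bs k) • N k
  have hm : ∀ i y, quad (m i) y = quad (N i.1) y - bs i.1 / bs k * quad (N k) y := fun i y => by
    simp only [m, quad_sub_mat, quad_smul_mat]
  have hpar : ∀ y, 0 < b' ⬝ᵥ y → ∃ P : ℝ, (∀ i, quad (m i) y = P * (f i ⬝ᵥ y)) ∧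
      ∀ i, quad (N i) y +
      (1 / 2) * (q * (q - 1) * Real.sqrt (quad a y) ^ 2 * quad R y
          / denom q (Real.sqrt (quad a y)) (b ⬝ᵥ y) b2) * bs i = P * y i := by
    intro y hy
    obtain ⟨P, hP⟩ := H y hy
    refine ⟨P, fun i => ?_, hP⟩
    rw [hm, hf]
    have h1 : bs i.1 / bs k * bs k = bs i.1 := div_mul_cancel₀ _ hk
    linear_combination hP i.1 - bs i.1 / bs k * hP k
      + (1 / 2) * (q * (q - 1) * Real.sqrt (quad a y) ^ 2 * quad R y
          / denom q (Real.sqrt (quad a y)) (b ⬝ᵥ y) b2) * h1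
  have hpos : ∀ y, 0 < b' ⬝ᵥ y → ∀ i j,
      quad (m i) y * (f j ⬝ᵥ y) = quad (m j) y * (f i ⬝ᵥ y) := by
    intro y hy i j
    obtain ⟨P, hP, -⟩ := hpar y hy
    rw [hP, hP]
    ring
  -- Both sides are odd in y, which covers the opposite half space; continuity covers the
  -- hyperplane.
  have hall : ∀ y i j, quad (m i) y * (f j ⬝ᵥ y) = quad (m j) y * (f i ⬝ᵥ y) := by
    intro y i j
    rcases lt_trichotomy (b' ⬝ᵥ y) 0 with hy | hy | hy
    · have h := hpos (-y) (by rw [dotProduct_neg]; linarith) i j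
      rw [quad_neg, quad_neg, dotProduct_neg, dotProduct_neg] at h
      linear_combination -h
    · have hc : Continuous fun y => quad (m i) y * (f j ⬝ᵥ y) - quad (m j) y * (f i ⬝ᵥ y) := by
        have h1 := continuous_quad (m i)
        have h2 := continuous_quad (m j)
        fun_prop
      have h := eq_zero_of_eq_zero_on_ray (d := a⁻¹ *ᵥ b') (hc.continuousAt (x := y))
        (fun t ht => sub_eq_zero.2 (hpos _ (by
          rw [dotProduct_add, hy, zero_add, dotProduct_smul, smul_eq_mul]
          exact mul_pos ht hb2') i j))
      exact sub_eq_zero.1 h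
    · exact hpos y hy i j
  obtain ⟨i₀, hi₀, -⟩ := exists_ne_ne hn k k
  obtain ⟨w, hw⟩ := exists_quad_eq_linear_mul m f (fun i => Pi.single i.1 1)
    (fun i => by rw [hf]; simp [i.2.symm])
    (fun i j hij => by
      rw [hf]
      have : i.1 ≠ j.1 := fun h => hij (Subtype.ext h)
      simp [j.2.symm, this])
    (fun i => by
      obtain ⟨j, h1, h2⟩ := exists_ne_ne hn i.1 k
      exact ⟨⟨j, h2⟩, fun h => h1 (congrArg Subtype.val h)⟩) ⟨i₀, hi₀⟩ hall
  refine ⟨w, ?_⟩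
  -- The k-th component fixes the coefficient along b^♯. The claim becomes that the scalar force
  -- coefficient equals ρ, or G = 0 after clearing Δ. Reflection does not extend this from the half
  -- space, because Δ contains the term αβ.
  let ρ : (Fin n → ℝ) → ℝ := fun y => -((quad (N k) y - (w ⬝ᵥ y) * y k) / bs k)
  have hN : ∀ y i, quad (N i) y = (w ⬝ᵥ y) * y i - ρ y * bs i := by
    intro y i
    rcases eq_or_ne i k with rfl | hi
    · simp only [ρ]
      field_simp
      ring
    · have h := hw ⟨i, hi⟩ y
      rw [hm, hf] at h
      simp only [ρ]
      field_simp at h ⊢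
      linear_combination h
  let G : (Fin n → ℝ) → ℝ := fun y => (1 / 2) * (q * (q - 1)) * quad a y * quad R y
    - ρ y * denom q (Real.sqrt (quad a y)) (b ⬝ᵥ y) b2
  have hGcont : Continuous G := by
    have h1 := continuous_quad a
    have h2 := continuous_quad R
    have h3 := continuous_quad (N k)
    have h4 := continuous_denom q b2 (a := a) (b := b)
    have h5 : Continuous fun y : Fin n → ℝ => w ⬝ᵥ y := by fun_prop
    have h6 := continuous_apply (A := fun _ : Fin n => ℝ) k
    have h7 : Continuous ρ := ((h3.sub (h5.mul h6)).div_const _).neg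
    exact ((continuous_const.mul h1).mul h2).sub (h7.mul h4)
  have hG1 : ∀ y, 0 < b' ⬝ᵥ y → ∀ i, f i ⬝ᵥ y ≠ 0 → G y = 0 := by
    intro y hy i hi
    obtain ⟨P, hP1, hP2⟩ := hpar y hy
    have hy0 : y ≠ 0 := by rintro rfl; simp at hy
    have h1 : P = w ⬝ᵥ y := by
      have h2 := hP1 i
      rw [hw] at h2
      exact (mul_right_cancel₀ hi h2).symm
    have h3 := hP2 k
    rw [hN, h1] at h3
    have h4 : ((1 / 2) * (q * (q - 1) * Real.sqrt (quad a y) ^ 2 * quad R y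
          / denom q (Real.sqrt (quad a y)) (b ⬝ᵥ y) b2) - ρ y) * bs k = 0 := by
      linear_combination h3
    have h5 := (mul_eq_zero.1 h4).resolve_right hk
    rw [Real.sq_sqrt (quad_pos ha hy0).le] at h5
    have h6 := hΔ y hy0
    simp only [G]
    field_simp at h5
    linear_combination (1 / 2) * h5
  have hG2 : ∀ y i, f i ⬝ᵥ y ≠ 0 → G y = 0 := by
    intro y i hi
    -- The factor c makes b'·d = b² > 0 whatever the sign of c, so the line enters the half space.
    -- Each f_i is constant along it; if f_i·y ≠ 0 the line therefore avoids the origin and α is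
    -- analytic on it.
    set d := c • bs with hd
    have hfd : ∀ t : ℝ, f i ⬝ᵥ (y + t • d) = f i ⬝ᵥ y := fun t => by
      have : f i ⬝ᵥ bs = 0 := by
        rw [hf]; field_simp; ring
      rw [dotProduct_add, dotProduct_smul, hd, dotProduct_smul, this]
      simp
    have hbd : b' ⬝ᵥ d = b2 := by
      rw [hb2def, hd, dotProduct_smul, hbc, smul_dotProduct]
    have hne : ∀ t : ℝ, y + t • d ≠ 0 := fun t h0 => hi (by
      rw [← hfd t, h0, dotProduct_zero])
    have han : AnalyticOnNhd ℝ (fun t : ℝ => G (y + t • d)) Set.univ := by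
      intro t _
      have h1 := analyticAt_quad_line a y d t
      have h2 := analyticAt_quad_line R y d t
      have h3 := analyticAt_quad_line (N k) y d t
      have h4 := analyticAt_dotProduct_line w y d t
      have h5 := analyticAt_dotProduct_line b y d t
      have h6 := analyticAt_sqrt_quad_line a (quad_pos ha (hne t))
      have h7 : AnalyticAt ℝ (fun t : ℝ => (y + t • d) k) t := by
        simp only [Pi.add_apply, Pi.smul_apply, smul_eq_mul]
        fun_prop
      simp only [G, ρ, denom]
      fun_prop
    -- At this parameter b'·(y + td) = b'·y + |b'·y| + 1 ≥ 1.
    have hev : (fun t : ℝ => G (y + t • d)) =ᶠ[𝓝 ((|b' ⬝ᵥ y| + 1) / b2)] 0 := by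
      have hopen : IsOpen {t : ℝ | 0 < b' ⬝ᵥ (y + t • d)} :=
        isOpen_lt continuous_const (by fun_prop)
      have hmem : (|b' ⬝ᵥ y| + 1) / b2 ∈ {t : ℝ | 0 < b' ⬝ᵥ (y + t • d)} := by
        simp only [Set.mem_ofPred_eq, dotProduct_add, dotProduct_smul, hbd, smul_eq_mul]
        rw [div_mul_cancel₀ _ hb2.ne']
        linarith [neg_abs_le (b' ⬝ᵥ y)]
      filter_upwards [hopen.mem_nhds hmem] with t ht
      exact hG1 _ ht i (by rw [hfd]; exact hi)
    have h := han.eqOn_zero_of_preconnected_of_eventuallyEq_zero isPreconnected_univ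
      (Set.mem_univ _) hev (Set.mem_univ 0)
    simpa using h
  have hG : ∀ y, G y = 0 := by
    intro y
    by_cases h : f ⟨i₀, hi₀⟩ ⬝ᵥ y = 0
    -- Moving along e_{i₀} makes the chosen form nonzero for every t > 0; continuity of G gives the
    -- value at t = 0.
    · refine eq_zero_of_eq_zero_on_ray (d := Pi.single i₀ 1) hGcont.continuousAt
        fun t ht => hG2 _ ⟨i₀, hi₀⟩ ?_
      rw [dotProduct_add, h, zero_add, dotProduct_smul, hf]
      simp [hi₀.symm, ht.ne']
    · exact hG2 y _ h
  intro y hy i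
  have h1 := hG y
  have h2 := hΔ y hy
  have h3 : (1 / 2) * (q * (q - 1) * Real.sqrt (quad a y) ^ 2 * quad R y
      / denom q (Real.sqrt (quad a y)) (b ⬝ᵥ y) b2) = ρ y := by
    rw [Real.sq_sqrt (quad_pos ha hy).le]
    simp only [G] at h1
    field_simp
    linear_combination 2 * h1
  rw [h3, hN]
  ring

end HalfSpace

/-! ### Transformation laws under a change of coordinates. -/

section CoordinateChange

variable {n : ℕ}

theorem sum_smul_single (v : EuclideanSpace ℝ (Fin n)) :
    v = ∑ k, v.ofLp k • EuclideanSpace.single k (1 : ℝ) := by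
  ext i
  simp [Finset.sum_apply, Pi.single_apply]

theorem map_eq_sum (L : EuclideanSpace ℝ (Fin n) →L[ℝ] ℝ) (v : EuclideanSpace ℝ (Fin n)) :
    L v = ∑ k, v.ofLp k * L (EuclideanSpace.single k 1) := by
  conv_lhs => rw [sum_smul_single v]
  simp [map_sum]

variable {a a' : EuclideanSpace ℝ (Fin n) → Matrix (Fin n) (Fin n) ℝ}
  {b b' : EuclideanSpace ℝ (Fin n) → Fin n → ℝ} {p : EuclideanSpace ℝ (Fin n)}
  {τ : EuclideanSpace ℝ (Fin n) → EuclideanSpace ℝ (Fin n)}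

theorem fderiv_dotProduct (hb : ∀ i, DifferentiableAt ℝ (fun x => b x i) p)
    (u : Fin n → ℝ) (v : EuclideanSpace ℝ (Fin n)) :
    fderiv ℝ (fun x => b x ⬝ᵥ u) p v = ∑ k, v.ofLp k * (dVec b p k ⬝ᵥ u) := by
  rw [map_eq_sum]
  refine Finset.sum_congr rfl fun k _ => ?_
  rw [← partialDeriv_dotProduct_left hb]
  rfl

theorem fderiv_bilin (ha : ∀ i j, DifferentiableAt ℝ (fun x => a x i j) p)
    (u w : Fin n → ℝ) (v : EuclideanSpace ℝ (Fin n)) :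
    fderiv ℝ (fun x => u ⬝ᵥ a x *ᵥ w) p v = ∑ k, v.ofLp k * (u ⬝ᵥ dMat a p k *ᵥ w) := by
  rw [map_eq_sum]
  refine Finset.sum_congr rfl fun k _ => ?_
  have h : partialDeriv (fun x => u ⬝ᵥ a x *ᵥ w) k p = u ⬝ᵥ dMat a p k *ᵥ w := by
    simp only [dotProduct]
    rw [partialDeriv_sum fun j _ => (differentiableAt_mulVec_left ha w j).const_mul _]
    refine Finset.sum_congr rfl fun j _ => ?_
    rw [partialDeriv_const_mul (differentiableAt_mulVec_left ha w j),
      partialDeriv_mulVec_left ha]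
  rw [← h]
  rfl

/-- The directional derivative of `x ↦ b'_i(τ x) U^i(x)`. -/
theorem fderiv_dotProduct_comp (hτ : DifferentiableAt ℝ τ p)
    (hb : ∀ i, DifferentiableAt ℝ (fun x => b' x i) (τ p))
    {U : EuclideanSpace ℝ (Fin n) → EuclideanSpace ℝ (Fin n)} (hU : DifferentiableAt ℝ U p)
    (v : EuclideanSpace ℝ (Fin n)) :
    fderiv ℝ (fun x => b' (τ x) ⬝ᵥ (U x).ofLp) p v
      = fderiv ℝ (fun x => b' x ⬝ᵥ (U p).ofLp) (τ p) (fderiv ℝ τ p v)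
        + b' (τ p) ⬝ᵥ (fderiv ℝ U p v).ofLp := by
  have hUi : ∀ i, HasFDerivAt (fun x => (U x).ofLp i)
      ((EuclideanSpace.proj i : EuclideanSpace ℝ (Fin n) →L[ℝ] ℝ).comp (fderiv ℝ U p)) p :=
    fun i => (EuclideanSpace.proj i : EuclideanSpace ℝ (Fin n) →L[ℝ] ℝ).hasFDerivAt.comp p
      hU.hasFDerivAt
  have hbi : ∀ i, HasFDerivAt (fun x => b' (τ x) i)
      ((fderiv ℝ (fun x => b' x i) (τ p)).comp (fderiv ℝ τ p)) p := fun i =>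
    (hb i).hasFDerivAt.comp p hτ.hasFDerivAt
  have h1 : HasFDerivAt (fun x => b' (τ x) ⬝ᵥ (U x).ofLp) _ p :=
    HasFDerivAt.fun_sum (u := Finset.univ) fun i _ => (hbi i).fun_mul (hUi i)
  have h2 : HasFDerivAt (fun x => b' x ⬝ᵥ (U p).ofLp) _ (τ p) :=
    HasFDerivAt.fun_sum (u := Finset.univ) fun i _ => (hb i).hasFDerivAt.mul_const ((U p).ofLp i)
  rw [h1.fderiv, h2.fderiv]
  simp [dotProduct, Finset.sum_add_distrib]
  rw [add_comm]

theorem differentiableAt_dotProduct_comp (hτ : DifferentiableAt ℝ τ p)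
    (hb : ∀ i, DifferentiableAt ℝ (fun x => b' x i) (τ p))
    {U : EuclideanSpace ℝ (Fin n) → EuclideanSpace ℝ (Fin n)} (hU : DifferentiableAt ℝ U p) :
    DifferentiableAt ℝ (fun x => b' (τ x) ⬝ᵥ (U x).ofLp) p := by
  simp only [dotProduct]
  exact DifferentiableAt.fun_sum fun i _ =>
    (DifferentiableAt.comp (f := τ) (g := fun x => b' x i) p (hb i) hτ).fun_mul
      (DifferentiableAt.comp (f := U) (g := fun x => x.ofLp i) p
        (EuclideanSpace.proj i : EuclideanSpace ℝ (Fin n) →L[ℝ] ℝ).differentiableAt hU)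

/-- The directional derivative of `x ↦ a'_ij(τ x) V^i(x) U^j(x)`. -/
theorem fderiv_bilin_comp (hτ : DifferentiableAt ℝ τ p)
    (ha : ∀ i j, DifferentiableAt ℝ (fun x => a' x i j) (τ p))
    {U V : EuclideanSpace ℝ (Fin n) → EuclideanSpace ℝ (Fin n)} (hU : DifferentiableAt ℝ U p)
    (hV : DifferentiableAt ℝ V p) (v : EuclideanSpace ℝ (Fin n)) :
    fderiv ℝ (fun x => (V x).ofLp ⬝ᵥ a' (τ x) *ᵥ (U x).ofLp) p v
      = fderiv ℝ (fun x => (V p).ofLp ⬝ᵥ a' x *ᵥ (U p).ofLp) (τ p) (fderiv ℝ τ p v)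
        + (fderiv ℝ V p v).ofLp ⬝ᵥ a' (τ p) *ᵥ (U p).ofLp
        + (V p).ofLp ⬝ᵥ a' (τ p) *ᵥ (fderiv ℝ U p v).ofLp := by
  have hVi : ∀ i, HasFDerivAt (fun x => (V x).ofLp i)
      ((EuclideanSpace.proj i : EuclideanSpace ℝ (Fin n) →L[ℝ] ℝ).comp (fderiv ℝ V p)) p :=
    fun i => (EuclideanSpace.proj i : EuclideanSpace ℝ (Fin n) →L[ℝ] ℝ).hasFDerivAt.comp p
      hV.hasFDerivAt
  have hi : ∀ i, HasFDerivAt (fun x => a' (τ x) i ⬝ᵥ (U x).ofLp) _ p := fun i =>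
    (differentiableAt_dotProduct_comp (b' := fun x => a' x i) hτ (ha i) hU).hasFDerivAt
  have h1 : HasFDerivAt (fun x => (V x).ofLp ⬝ᵥ a' (τ x) *ᵥ (U x).ofLp) _ p :=
    HasFDerivAt.fun_sum (u := Finset.univ) fun i _ => (hVi i).fun_mul (hi i)
  have h2 : HasFDerivAt (fun x => (V p).ofLp ⬝ᵥ a' x *ᵥ (U p).ofLp) _ (τ p) :=
    HasFDerivAt.fun_sum (u := Finset.univ) fun i _ =>
      (differentiableAt_dotProduct_left (b := fun x => a' x i) (ha i) (U p).ofLp).hasFDerivAt.const_mul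
        ((V p).ofLp i)
  rw [h1.fderiv, h2.fderiv]
  simp only [FunLike.coe_sum, FunLike.coe_smul, FunLike.coe_add, Finset.sum_apply, Pi.smul_apply,
    Pi.add_apply, smul_eq_mul, ContinuousLinearMap.comp_apply,
    fun i => fderiv_dotProduct_comp (b' := fun x => a' x i) hτ (ha i) hU v, Finset.sum_add_distrib,
    mul_add]
  have e1 : ∑ i, (V p).ofLp i * (a' (τ p) i ⬝ᵥ (fderiv ℝ U p v).ofLp)
    = (V p).ofLp ⬝ᵥ a' (τ p) *ᵥ (fderiv ℝ U p v).ofLp := rfl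
  have e2 : ∑ i, (a' (τ p) *ᵥ (U p).ofLp) i
      * (EuclideanSpace.proj i : EuclideanSpace ℝ (Fin n) →L[ℝ] ℝ) (fderiv ℝ V p v)
    = (fderiv ℝ V p v).ofLp ⬝ᵥ a' (τ p) *ᵥ (U p).ofLp :=
    Finset.sum_congr rfl fun i _ => mul_comm _ _
  rw [e1, e2]
  ring

/-- An index-free description by directional derivatives, so that the transformation law follows
from the chain rule without Christoffel symbols. -/
theorem dotProduct_mulVec_conn_eq_fderiv (hsymm : ∀ x, (a x).IsSymm) (hu : IsUnit (a p).det)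
    (ha : ∀ i j, DifferentiableAt ℝ (fun x => a x i j) p) (l y : EuclideanSpace ℝ (Fin n)) :
    l.ofLp ⬝ᵥ a p *ᵥ conn a p y = (1 / 2) * (fderiv ℝ (fun x => l.ofLp ⬝ᵥ a x *ᵥ y.ofLp) p y
      - (1 / 2) * fderiv ℝ (fun x => y.ofLp ⬝ᵥ a x *ᵥ y.ofLp) p l) := by
  rw [fderiv_bilin ha, fderiv_bilin ha]
  have h1 : ∑ k, y.ofLp k * (l.ofLp ⬝ᵥ dMat a p k *ᵥ y.ofLp)
      = ∑ i, l.ofLp i * ∑ k, y.ofLp k * (dMat a p k *ᵥ y.ofLp) i := by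
    simp only [dotProduct, Finset.mul_sum]
    rw [Finset.sum_comm]
    refine Finset.sum_congr rfl fun i _ => Finset.sum_congr rfl fun k _ => ?_
    ring
  rw [h1]
  have h2 : l.ofLp ⬝ᵥ a p *ᵥ conn a p y = ∑ i, l.ofLp i
      * (1 / 4 * (2 * (∑ k, y.ofLp k * (dMat a p k *ᵥ y.ofLp) i)
        - quad (dMat a p i) y.ofLp)) :=
    Finset.sum_congr rfl fun i _ => by rw [mulVec_conn hsymm hu]
  rw [h2, Finset.mul_sum (s := Finset.univ) (a := (1 / 2 : ℝ)), ← Finset.sum_sub_distrib,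
    Finset.mul_sum]
  refine Finset.sum_congr rfl fun i _ => ?_
  rw [quad]
  ring

theorem r00_eq_fderiv (hb : ∀ i, DifferentiableAt ℝ (fun x => b x i) p)
    (y : EuclideanSpace ℝ (Fin n)) :
    r00 a b p y = fderiv ℝ (fun x => b x ⬝ᵥ y.ofLp) p y - 2 * (b p ⬝ᵥ conn a p y) := by
  rw [r00_eq, fderiv_dotProduct hb]

theorem dotProduct_sMat_mulVec (hsymm : ∀ x, (a x).IsSymm)
    (hb : ∀ i, DifferentiableAt ℝ (fun x => b x i) p) (u v : EuclideanSpace ℝ (Fin n)) :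
    u.ofLp ⬝ᵥ sMat a b p *ᵥ v.ofLp = (1 / 2) * (fderiv ℝ (fun x => b x ⬝ᵥ u.ofLp) p v
      - fderiv ℝ (fun x => b x ⬝ᵥ v.ofLp) p u) := by
  rw [fderiv_dotProduct hb, fderiv_dotProduct hb]
  have h1 : ∑ k, v.ofLp k * (dVec b p k ⬝ᵥ u.ofLp)
      = ∑ i, u.ofLp i * ∑ k, v.ofLp k * dVec b p k i := by
    simp only [dotProduct, Finset.mul_sum]
    rw [Finset.sum_comm]
    refine Finset.sum_congr rfl fun i _ => Finset.sum_congr rfl fun k _ => ?_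
    ring
  rw [h1, dotProduct]
  simp only [sMat_mulVec hsymm]
  rw [← Finset.sum_sub_distrib, Finset.mul_sum]
  refine Finset.sum_congr rfl fun i _ => ?_
  ring

/-- Compatibility of the components `a, b` and `a', b'` of a metric and a 1-form with the change
of coordinates `τ`. -/
structure Compatible (a a' : EuclideanSpace ℝ (Fin n) → Matrix (Fin n) (Fin n) ℝ)
    (b b' : EuclideanSpace ℝ (Fin n) → Fin n → ℝ)
    (τ : EuclideanSpace ℝ (Fin n) → EuclideanSpace ℝ (Fin n)) (p : EuclideanSpace ℝ (Fin n)) :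
    Prop where
  contDiffAt : ContDiffAt ℝ ∞ τ p
  surjective : Function.Surjective (fderiv ℝ τ p)
  metric : ∀ᶠ x in 𝓝 p, ∀ u v : EuclideanSpace ℝ (Fin n), u.ofLp ⬝ᵥ a x *ᵥ v.ofLp
    = (fderiv ℝ τ x u).ofLp ⬝ᵥ a' (τ x) *ᵥ (fderiv ℝ τ x v).ofLp
  form : ∀ᶠ x in 𝓝 p, ∀ u : EuclideanSpace ℝ (Fin n),
    b x ⬝ᵥ u.ofLp = b' (τ x) ⬝ᵥ (fderiv ℝ τ x u).ofLp
  symm : ∀ x, (a x).IsSymm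
  symm' : ∀ x, (a' x).IsSymm
  posDef : (a p).PosDef
  posDef' : (a' (τ p)).PosDef
  diff : ∀ i j, DifferentiableAt ℝ (fun x => a x i j) p
  diff' : ∀ i j, DifferentiableAt ℝ (fun x => a' x i j) (τ p)
  diffForm : ∀ i, DifferentiableAt ℝ (fun x => b x i) p
  diffForm' : ∀ i, DifferentiableAt ℝ (fun x => b' x i) (τ p)

namespace Compatible

variable (h : Compatible a a' b b' τ p)
include h

theorem differentiableAt : DifferentiableAt ℝ τ p := h.contDiffAt.differentiableAt (by simp)

theorem differentiableAt_fderiv_apply (u : EuclideanSpace ℝ (Fin n)) :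
    DifferentiableAt ℝ (fun x => fderiv ℝ τ x u) p :=
  ((h.contDiffAt.fderiv_right (m := 1) (by norm_cast)).differentiableAt (by simp)).clm_apply
    (differentiableAt_const u)

theorem fderiv_fderiv_comm (u v : EuclideanSpace ℝ (Fin n)) :
    fderiv ℝ (fun x => fderiv ℝ τ x u) p v = fderiv ℝ (fun x => fderiv ℝ τ x v) p u := by
  have hd := (h.contDiffAt.fderiv_right (m := 1) (by norm_cast)).differentiableAt (by simp)
  have h1 : ∀ u v, fderiv ℝ (fun x => fderiv ℝ τ x u) p v = fderiv ℝ (fderiv ℝ τ) p v u := by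
    intro u v
    rw [fderiv_clm_apply hd (differentiableAt_const u)]
    simp
  rw [h1, h1, h.contDiffAt.isSymmSndFDerivAt (by simp; exact WithTop.coe_le_coe.2 (le_top (a := (2 : ℕ∞))))]

theorem fderiv_form (u v : EuclideanSpace ℝ (Fin n)) :
    fderiv ℝ (fun x => b x ⬝ᵥ u.ofLp) p v
      = fderiv ℝ (fun x => b' x ⬝ᵥ (fderiv ℝ τ p u).ofLp) (τ p) (fderiv ℝ τ p v)
        + b' (τ p) ⬝ᵥ (fderiv ℝ (fun x => fderiv ℝ τ x u) p v).ofLp := by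
  rw [← fderiv_dotProduct_comp h.differentiableAt h.diffForm' (h.differentiableAt_fderiv_apply u)]
  have : (fun x => b x ⬝ᵥ u.ofLp) =ᶠ[𝓝 p] fun x => b' (τ x) ⬝ᵥ (fderiv ℝ τ x u).ofLp := by
    filter_upwards [h.form] with x hx using hx u
  rw [this.fderiv_eq]

theorem fderiv_metric (u w v : EuclideanSpace ℝ (Fin n)) :
    fderiv ℝ (fun x => u.ofLp ⬝ᵥ a x *ᵥ w.ofLp) p v
      = fderiv ℝ (fun x => (fderiv ℝ τ p u).ofLp ⬝ᵥ a' x *ᵥ (fderiv ℝ τ p w).ofLp) (τ p)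
          (fderiv ℝ τ p v)
        + (fderiv ℝ (fun x => fderiv ℝ τ x u) p v).ofLp ⬝ᵥ a' (τ p) *ᵥ (fderiv ℝ τ p w).ofLp
        + (fderiv ℝ τ p u).ofLp ⬝ᵥ
          a' (τ p) *ᵥ (fderiv ℝ (fun x => fderiv ℝ τ x w) p v).ofLp := by
  rw [← fderiv_bilin_comp h.differentiableAt h.diff' (h.differentiableAt_fderiv_apply w)
    (h.differentiableAt_fderiv_apply u)]
  have : (fun x => u.ofLp ⬝ᵥ a x *ᵥ w.ofLp) =ᶠ[𝓝 p]
      fun x => (fderiv ℝ τ x u).ofLp ⬝ᵥ a' (τ x) *ᵥ (fderiv ℝ τ x w).ofLp := by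
    filter_upwards [h.metric] with x hx using hx u w
  rw [this.fderiv_eq]

/-- Derivatives of τ reach every vector and a' is nondegenerate, so vectors may be compared after
lowering their index. -/
theorem eq_of_forall {z z' : Fin n → ℝ}
    (hz : ∀ l, (fderiv ℝ τ p l).ofLp ⬝ᵥ a' (τ p) *ᵥ z
      = (fderiv ℝ τ p l).ofLp ⬝ᵥ a' (τ p) *ᵥ z') : z = z' := by
  obtain ⟨l, hl⟩ := h.surjective (WithLp.toLp 2 (z - z'))
  have h1 := hz l
  rw [← sub_eq_zero, ← dotProduct_sub, ← mulVec_sub, hl] at h1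
  by_contra hne
  exact (quad_pos h.posDef' (sub_ne_zero.2 hne)).ne' h1

theorem raise_form : (fderiv ℝ τ p (WithLp.toLp 2 ((a p)⁻¹ *ᵥ b p))).ofLp
    = (a' (τ p))⁻¹ *ᵥ b' (τ p) := by
  refine h.eq_of_forall fun l => ?_
  rw [← h.metric.self_of_nhds, mulVec_inv_mulVec h.posDef', mulVec_inv_mulVec h.posDef,
    dotProduct_comm, h.form.self_of_nhds, dotProduct_comm]

theorem normSq_eq : b p ⬝ᵥ (a p)⁻¹ *ᵥ b p = b' (τ p) ⬝ᵥ (a' (τ p))⁻¹ *ᵥ b' (τ p) := by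
  rw [← h.raise_form, ← h.form.self_of_nhds]

/-- The transformation law of the spray of a Riemannian metric. -/
theorem fderiv_conn (y : EuclideanSpace ℝ (Fin n)) :
    (fderiv ℝ τ p (WithLp.toLp 2 (conn a p y))).ofLp = conn a' (τ p) (fderiv ℝ τ p y)
      + (1 / 2 : ℝ) • (fderiv ℝ (fun x => fderiv ℝ τ x y) p y).ofLp := by
  refine h.eq_of_forall fun l => ?_
  rw [← h.metric.self_of_nhds, dotProduct_mulVec_conn_eq_fderiv h.symm (isUnit_det_of_posDef h.posDef) h.diff,
    h.fderiv_metric, h.fderiv_metric, mulVec_add, dotProduct_add,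
    dotProduct_mulVec_conn_eq_fderiv h.symm' (isUnit_det_of_posDef h.posDef') h.diff', mulVec_smul,
    dotProduct_smul, smul_eq_mul, h.fderiv_fderiv_comm l y,
    dotProduct_mulVec_symm (h.symm' _) (fderiv ℝ τ p y).ofLp]
  ring

/-- The second-derivative term of τ in the derivative of b·y is cancelled by the one in the law for
`conn`. -/
theorem r00_transition (y : EuclideanSpace ℝ (Fin n)) :
    r00 a b p y = r00 a' b' (τ p) (fderiv ℝ τ p y) := by
  have h1 := h.form.self_of_nhds (WithLp.toLp 2 (conn a p y))
  rw [h.fderiv_conn, dotProduct_add, dotProduct_smul, smul_eq_mul] at h1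
  rw [r00_eq_fderiv h.diffForm, r00_eq_fderiv h.diffForm', h.fderiv_form]
  linarith

/-- The second-derivative terms are symmetric in u and v and cancel in the antisymmetrization. -/
theorem sMat_transition (u v : EuclideanSpace ℝ (Fin n)) :
    u.ofLp ⬝ᵥ sMat a b p *ᵥ v.ofLp
      = (fderiv ℝ τ p u).ofLp ⬝ᵥ sMat a' b' (τ p) *ᵥ (fderiv ℝ τ p v).ofLp := by
  rw [dotProduct_sMat_mulVec h.symm h.diffForm, dotProduct_sMat_mulVec h.symm' h.diffForm',
    h.fderiv_form, h.fderiv_form, h.fderiv_fderiv_comm u v]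
  ring

theorem sZero_transition (y : EuclideanSpace ℝ (Fin n)) :
    b p ⬝ᵥ (a p)⁻¹ *ᵥ sMat a b p *ᵥ y.ofLp
      = b' (τ p) ⬝ᵥ (a' (τ p))⁻¹ *ᵥ sMat a' b' (τ p) *ᵥ (fderiv ℝ τ p y).ofLp := by
  rw [dotProduct_inv_mulVec_mulVec h.posDef, dotProduct_inv_mulVec_mulVec h.posDef',
    ← dotProduct_mulVec, ← dotProduct_mulVec, ← h.raise_form]
  exact h.sMat_transition (WithLp.toLp 2 ((a p)⁻¹ *ᵥ b p)) y

end Compatible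

end CoordinateChange

/-! ### The reduced sprays at a point, and the equivalence there. -/

section Pointwise

variable {n : ℕ} {a a' : EuclideanSpace ℝ (Fin n) → Matrix (Fin n) (Fin n) ℝ}
  {b b' : EuclideanSpace ℝ (Fin n) → Fin n → ℝ} {p : EuclideanSpace ℝ (Fin n)} {q : ℝ}

theorem normSq_eq_dotProduct (a : EuclideanSpace ℝ (Fin n) → Matrix (Fin n) (Fin n) ℝ)
    (b : EuclideanSpace ℝ (Fin n) → Fin n → ℝ) (p : EuclideanSpace ℝ (Fin n)) :
    normSq a b p = b p ⬝ᵥ (a p)⁻¹ *ᵥ b p :=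
  dotProduct_comm _ _

theorem sVec_eq_vecMul (a : EuclideanSpace ℝ (Fin n) → Matrix (Fin n) (Fin n) ℝ)
    (b : EuclideanSpace ℝ (Fin n) → Fin n → ℝ) (p : EuclideanSpace ℝ (Fin n)) :
    sVec a b p = ((a p)⁻¹ *ᵥ b p) ᵥ* sMat a b p := rfl

theorem raise_eq_mulVec (a : EuclideanSpace ℝ (Fin n) → Matrix (Fin n) (Fin n) ℝ)
    (p : EuclideanSpace ℝ (Fin n)) (w : Fin n → ℝ) (i : Fin n) :
    raise a p w i = ((a p)⁻¹ *ᵥ w) i := rfl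

/-- The matrix `(r_ij)`. -/
noncomputable def rMat (a : EuclideanSpace ℝ (Fin n) → Matrix (Fin n) (Fin n) ℝ)
    (b : EuclideanSpace ℝ (Fin n) → Fin n → ℝ) (p : EuclideanSpace ℝ (Fin n)) :
    Matrix (Fin n) (Fin n) ℝ :=
  fun i j => rLow a b p i j

theorem r00_eq_quad (a : EuclideanSpace ℝ (Fin n) → Matrix (Fin n) (Fin n) ℝ)
    (b : EuclideanSpace ℝ (Fin n) → Fin n → ℝ) (p y : EuclideanSpace ℝ (Fin n)) :
    r00 a b p y = quad (rMat a b p) y.ofLp := by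
  rw [quad_eq_sum, r00]
  rfl

/-- The force of the Kropina metric when `s_ij = (b_i s_j - b_j s_i) / b²`. -/
theorem kropina_force_eq (ha : (a p).PosDef) (hb : b p ≠ 0)
    (hS : ∀ i j, sMat a b p i j
      = 1 / normSq a b p * (b p i * sVec a b p j - b p j * sVec a b p i))
    {y : EuclideanSpace ℝ (Fin n)} (hB : b p ⬝ᵥ y.ofLp ≠ 0) (i : Fin n) :
    -(quad (a p) y.ofLp / (2 * (b p ⬝ᵥ y.ofLp))) * ((a p)⁻¹ *ᵥ sMat a b p *ᵥ y.ofLp) i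
      + 1 / (2 * normSq a b p) * (r00 a b p y + quad (a p) y.ofLp / (b p ⬝ᵥ y.ofLp)
          * (b p ⬝ᵥ (a p)⁻¹ *ᵥ sMat a b p *ᵥ y.ofLp)) * ((a p)⁻¹ *ᵥ b p) i
    = 1 / (2 * normSq a b p) * (quad (a p) y.ofLp * ((a p)⁻¹ *ᵥ sVec a b p) i
        + r00 a b p y * ((a p)⁻¹ *ᵥ b p) i) := by
  have hb2 : normSq a b p ≠ 0 := by
    rw [normSq_eq_dotProduct]
    exact (dotProduct_inv_mulVec_pos ha hb).ne'
  have h1 : sMat a b p *ᵥ y.ofLp = (1 / normSq a b p) • ((sVec a b p ⬝ᵥ y.ofLp) • b p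
      - (b p ⬝ᵥ y.ofLp) • sVec a b p) := by
    ext i
    simp only [mulVec, dotProduct, hS, Pi.smul_apply, Pi.sub_apply, smul_eq_mul, Finset.sum_mul,
      Finset.mul_sum, ← Finset.sum_sub_distrib]
    refine Finset.sum_congr rfl fun j _ => ?_
    ring
  rw [dotProduct_inv_mulVec_mulVec ha, ← sVec_eq_vecMul, h1, mulVec_smul, mulVec_sub, mulVec_smul,
    mulVec_smul]
  simp only [Pi.smul_apply, Pi.sub_apply, smul_eq_mul]
  field_simp
  ring

/-- The vector `½ q(q-1)α² r_00 / Δ · b^i`. -/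
noncomputable def qForce (q : ℝ) (a : EuclideanSpace ℝ (Fin n) → Matrix (Fin n) (Fin n) ℝ)
    (b : EuclideanSpace ℝ (Fin n) → Fin n → ℝ) (p y : EuclideanSpace ℝ (Fin n)) (i : Fin n) : ℝ :=
  (1 / 2) * (q * (q - 1) * Real.sqrt (quad (a p) y.ofLp) ^ 2 * r00 a b p y
    / denom q (Real.sqrt (quad (a p) y.ofLp)) (b p ⬝ᵥ y.ofLp) (normSq a b p))
    * raise a p (b p) i

/-- The vector `(α² s^i + r_00 b^i) / (2b²)`. -/
noncomputable def kropinaForce (a : EuclideanSpace ℝ (Fin n) → Matrix (Fin n) (Fin n) ℝ)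
    (b : EuclideanSpace ℝ (Fin n) → Fin n → ℝ) (p y : EuclideanSpace ℝ (Fin n)) (i : Fin n) : ℝ :=
  1 / (2 * normSq a b p) * (quad (a p) y.ofLp * raise a p (sVec a b p) i
    + r00 a b p y * raise a p (b p) i)

/-- The projective factor relating the sprays of the `q`-metric of `(a, b)` and of the Kropina
metric of `(a', b')` when `b` is closed and the reduced sprays coincide. -/
noncomputable def radialDiff (q : ℝ) (a a' : EuclideanSpace ℝ (Fin n) → Matrix (Fin n) (Fin n) ℝ)
    (b b' : EuclideanSpace ℝ (Fin n) → Fin n → ℝ) (p y : EuclideanSpace ℝ (Fin n)) : ℝ :=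
  qRadial q (Real.sqrt (quad (a p) y.ofLp)) (b p ⬝ᵥ y.ofLp) (b p ⬝ᵥ (a p)⁻¹ *ᵥ b p)
      (r00 a b p y) 0
    - kropinaRadial (quad (a' p) y.ofLp) (b' p ⬝ᵥ y.ofLp) (b' p ⬝ᵥ (a' p)⁻¹ *ᵥ b' p)
      (r00 a' b' p y) (b' p ⬝ᵥ (a' p)⁻¹ *ᵥ sMat a' b' p *ᵥ y.ofLp)

/-- The formula for the spray of the `q`-metric at `p`, together with the regularity of its
denominators. -/
def HasQSpray (q : ℝ) (a : EuclideanSpace ℝ (Fin n) → Matrix (Fin n) (Fin n) ℝ)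
    (b : EuclideanSpace ℝ (Fin n) → Fin n → ℝ) (p : EuclideanSpace ℝ (Fin n))
    (G : EuclideanSpace ℝ (Fin n) → Fin n → ℝ) : Prop :=
  ∀ y : EuclideanSpace ℝ (Fin n), y ≠ 0 →
    Real.sqrt (quad (a p) y.ofLp) + (1 - q) * (b p ⬝ᵥ y.ofLp) ≠ 0 ∧
    denom q (Real.sqrt (quad (a p) y.ofLp)) (b p ⬝ᵥ y.ofLp) (b p ⬝ᵥ (a p)⁻¹ *ᵥ b p) ≠ 0 ∧
    ∀ i, G y i = conn a p y i +
      ((q * Real.sqrt (quad (a p) y.ofLp) ^ 2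
          / (Real.sqrt (quad (a p) y.ofLp) + (1 - q) * (b p ⬝ᵥ y.ofLp)))
          • (a p)⁻¹ *ᵥ sMat a b p *ᵥ y.ofLp
        + qRadial q (Real.sqrt (quad (a p) y.ofLp)) (b p ⬝ᵥ y.ofLp) (b p ⬝ᵥ (a p)⁻¹ *ᵥ b p)
          (r00 a b p y) (b p ⬝ᵥ (a p)⁻¹ *ᵥ sMat a b p *ᵥ y.ofLp) • y.ofLp
        + ((1 / 2) * (q * (q - 1) * Real.sqrt (quad (a p) y.ofLp) ^ 2
            / denom q (Real.sqrt (quad (a p) y.ofLp)) (b p ⬝ᵥ y.ofLp) (b p ⬝ᵥ (a p)⁻¹ *ᵥ b p))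
          * (r00 a b p y - 2 * (q * Real.sqrt (quad (a p) y.ofLp) ^ 2
            / (Real.sqrt (quad (a p) y.ofLp) + (1 - q) * (b p ⬝ᵥ y.ofLp)))
              * (b p ⬝ᵥ (a p)⁻¹ *ᵥ sMat a b p *ᵥ y.ofLp))) • (a p)⁻¹ *ᵥ b p) i

/-- The formula for the spray of the Kropina metric at `p`. -/
def HasKropinaSpray (a : EuclideanSpace ℝ (Fin n) → Matrix (Fin n) (Fin n) ℝ)
    (b : EuclideanSpace ℝ (Fin n) → Fin n → ℝ) (p : EuclideanSpace ℝ (Fin n))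
    (G : EuclideanSpace ℝ (Fin n) → Fin n → ℝ) : Prop :=
  ∀ y : EuclideanSpace ℝ (Fin n), 0 < b p ⬝ᵥ y.ofLp → ∀ i, G y i = conn a p y i +
      ((-(quad (a p) y.ofLp / (2 * (b p ⬝ᵥ y.ofLp)))) • (a p)⁻¹ *ᵥ sMat a b p *ᵥ y.ofLp
        + kropinaRadial (quad (a p) y.ofLp) (b p ⬝ᵥ y.ofLp) (b p ⬝ᵥ (a p)⁻¹ *ᵥ b p)
          (r00 a b p y) (b p ⬝ᵥ (a p)⁻¹ *ᵥ sMat a b p *ᵥ y.ofLp) • y.ofLp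
        + (1 / (2 * (b p ⬝ᵥ (a p)⁻¹ *ᵥ b p)) * (r00 a b p y + quad (a p) y.ofLp / (b p ⬝ᵥ y.ofLp)
          * (b p ⬝ᵥ (a p)⁻¹ *ᵥ sMat a b p *ᵥ y.ofLp))) • (a p)⁻¹ *ᵥ b p) i

variable {G G' : EuclideanSpace ℝ (Fin n) → Fin n → ℝ}

theorem ne_zero_of_dotProduct_pos {w : Fin n → ℝ} {y : EuclideanSpace ℝ (Fin n)}
    (h : 0 < w ⬝ᵥ y.ofLp) : y ≠ 0 := by
  rintro rfl
  simp at h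

theorem HasQSpray.eq_of_closed (h : HasQSpray q a b p G) (hS : sMat a b p = 0)
    {y : EuclideanSpace ℝ (Fin n)} (hy : y ≠ 0) (i : Fin n) :
    G y i = conn a p y i + qForce q a b p y i
      + qRadial q (Real.sqrt (quad (a p) y.ofLp)) (b p ⬝ᵥ y.ofLp) (b p ⬝ᵥ (a p)⁻¹ *ᵥ b p)
          (r00 a b p y) 0 * y i := by
  rw [(h y hy).2.2 i, hS]
  simp only [zero_mulVec, mulVec_zero, smul_zero, dotProduct_zero, mul_zero, sub_zero, zero_add,
    Pi.add_apply, Pi.smul_apply, smul_eq_mul, qForce, normSq_eq_dotProduct]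
  change _ = _ + _ * ((a p)⁻¹ *ᵥ b p) i + _
  ring

theorem HasKropinaSpray.eq_of_sMat_eq (h : HasKropinaSpray a b p G) (ha : (a p).PosDef)
    (hb : b p ≠ 0)
    (hS : ∀ i j, sMat a b p i j
      = 1 / normSq a b p * (b p i * sVec a b p j - b p j * sVec a b p i))
    {y : EuclideanSpace ℝ (Fin n)} (hB : 0 < b p ⬝ᵥ y.ofLp) (i : Fin n) :
    G y i = conn a p y i + kropinaForce a b p y i
      + kropinaRadial (quad (a p) y.ofLp) (b p ⬝ᵥ y.ofLp) (b p ⬝ᵥ (a p)⁻¹ *ᵥ b p)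
          (r00 a b p y) (b p ⬝ᵥ (a p)⁻¹ *ᵥ sMat a b p *ᵥ y.ofLp) * y i := by
  have h1 := kropina_force_eq ha hb hS hB.ne' i
  rw [h y hB i, kropinaForce]
  change _ = _ + 1 / (2 * normSq a b p) * (quad (a p) y.ofLp * ((a p)⁻¹ *ᵥ sVec a b p) i
        + r00 a b p y * ((a p)⁻¹ *ᵥ b p) i) + _
  rw [← h1, normSq_eq_dotProduct]
  simp only [Pi.add_apply, Pi.smul_apply, smul_eq_mul]
  ring

theorem sprays_related_iff (h : HasQSpray q a b p G) (h' : HasKropinaSpray a' b' p G')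
    (ha' : (a' p).PosDef) (hb' : b' p ≠ 0) (hS : sMat a b p = 0)
    (hS' : ∀ i j, sMat a' b' p i j
      = 1 / normSq a' b' p * (b' p i * sVec a' b' p j - b' p j * sVec a' b' p i))
    {y : EuclideanSpace ℝ (Fin n)} (hB : 0 < b' p ⬝ᵥ y.ofLp) (t : ℝ) (i : Fin n) :
    G y i = G' y i + (t + radialDiff q a a' b b' p y) * y i ↔
      conn a p y i + qForce q a b p y i = conn a' p y i + kropinaForce a' b' p y i + t * y i := by
  rw [h.eq_of_closed hS (ne_zero_of_dotProduct_pos hB), h'.eq_of_sMat_eq ha' hb' hS' hB, radialDiff]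
  constructor <;> intro h <;> linarith

theorem conditions_of_related (hn : 3 ≤ n) (hq0 : q ≠ 0) (hsymm : ∀ x, (a x).IsSymm)
    (hsymm' : ∀ x, (a' x).IsSymm) (ha : (a p).PosDef) (ha' : (a' p).PosDef) (hb : b p ≠ 0) {c : ℝ}
    (hbc : b p = c • b' p) (h : HasQSpray q a b p G) (h' : HasKropinaSpray a' b' p G')
    (H : ∀ y : EuclideanSpace ℝ (Fin n), 0 < b' p ⬝ᵥ y.ofLp →
      ∃ P : ℝ, ∀ i, G y i = G' y i + P * y i) :
    sMat a b p = 0 ∧ (∀ i j, sMat a' b' p i j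
      = 1 / normSq a' b' p * (b' p i * sVec a' b' p j - b' p j * sVec a' b' p i)) ∧
    ∃ w : Fin n → ℝ, ∀ y : EuclideanSpace ℝ (Fin n), y ≠ 0 → ∀ i,
      conn a p y i + qForce q a b p y i
        = conn a' p y i + kropinaForce a' b' p y i + (w ⬝ᵥ y.ofLp) * y i := by
  have hb' : b' p ≠ 0 := by
    intro h0
    simp [hbc, h0] at hb
  have hne : ∀ y : Fin n → ℝ, y ≠ 0 → WithLp.toLp 2 y ≠ 0 := fun y hy h0 =>
    hy (congrArg WithLp.ofLp h0)
  have hS' : ∀ i j, sMat a' b' p i j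
      = 1 / normSq a' b' p * (b' p i * sVec a' b' p j - b' p j * sVec a' b' p i) := by
    rw [normSq_eq_dotProduct]
    refine kropina_sLow_eq (S' := sMat a' b' p) ha' (sMat_transpose hsymm') hb'
      -- All force terms of both metrics except the singular Kropina ones; radial terms are moved
      -- into the factor P.
      (E := fun y i => quad (connMat a p i) y - quad (connMat a' p i) y
        + ((q * Real.sqrt (quad (a p) y) ^ 2
            / (Real.sqrt (quad (a p) y) + (1 - q) * (b p ⬝ᵥ y)))
            • (a p)⁻¹ *ᵥ sMat a b p *ᵥ y
          + ((1 / 2) * (q * (q - 1) * Real.sqrt (quad (a p) y) ^ 2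
              / denom q (Real.sqrt (quad (a p) y)) (b p ⬝ᵥ y) (b p ⬝ᵥ (a p)⁻¹ *ᵥ b p))
            * (quad (rMat a b p) y - 2 * (q * Real.sqrt (quad (a p) y) ^ 2
              / (Real.sqrt (quad (a p) y) + (1 - q) * (b p ⬝ᵥ y)))
                * (b p ⬝ᵥ (a p)⁻¹ *ᵥ sMat a b p *ᵥ y))) • (a p)⁻¹ *ᵥ b p) i
        - 1 / (2 * (b' p ⬝ᵥ (a' p)⁻¹ *ᵥ b' p)) * quad (rMat a' b' p) y
          * ((a' p)⁻¹ *ᵥ b' p) i) (fun y hy i => ?_) (fun y hB => ?_)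
    · have h0 := h (WithLp.toLp 2 y) (hne y hy)
      exact (((continuous_quad _).continuousAt.sub (continuous_quad _).continuousAt).add
        (continuousAt_qForce q _ h0.1 h0.2.1 i)).sub
        ((continuousAt_const.mul (continuous_quad _).continuousAt).mul continuousAt_const)
    · obtain ⟨P, hP⟩ := H (WithLp.toLp 2 y) hB
      have hy0 := ne_zero_of_dotProduct_pos (y := WithLp.toLp 2 y) hB
      refine ⟨P + kropinaRadial (quad (a' p) y) (b' p ⬝ᵥ y) (b' p ⬝ᵥ (a' p)⁻¹ *ᵥ b' p)
          (r00 a' b' p (WithLp.toLp 2 y)) (b' p ⬝ᵥ (a' p)⁻¹ *ᵥ sMat a' b' p *ᵥ y)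
        - qRadial q (Real.sqrt (quad (a p) y)) (b p ⬝ᵥ y) (b p ⬝ᵥ (a p)⁻¹ *ᵥ b p)
          (r00 a b p (WithLp.toLp 2 y)) (b p ⬝ᵥ (a p)⁻¹ *ᵥ sMat a b p *ᵥ y), fun i => ?_⟩
      have hi := hP i
      rw [(h _ hy0).2.2 i, h' _ hB i] at hi
      simp only [Pi.add_apply, Pi.smul_apply, smul_eq_mul, conn] at hi ⊢
      rw [r00_eq_quad, r00_eq_quad] at *
      linear_combination hi
  -- With condition 3 known, the Kropina force is quadratic in y and combines with the two
  -- Riemannian sprays into one family of matrices.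
  have hquad : ∀ (y : EuclideanSpace ℝ (Fin n)) (i : Fin n),
      quad (connMat a p i - connMat a' p i - (1 / (2 * normSq a' b' p))
        • ((raise a' p (sVec a' b' p) i) • a' p + (raise a' p (b' p) i) • rMat a' b' p)) y.ofLp
      = conn a p y i - conn a' p y i - kropinaForce a' b' p y i := by
    intro y i
    rw [quad_sub_mat, quad_sub_mat, quad_smul_mat, quad_add_mat, quad_smul_mat, quad_smul_mat,
      kropinaForce, r00_eq_quad, conn, conn]
    ring
  have hS : sMat a b p = 0 := by
    refine q_sMat_eq_zero (R := rMat a b p) hq0 ha (sMat_transpose hsymm) hb hbc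
      (fun y hy => (h _ (hne y hy)).1) (fun y hy => (h _ (hne y hy)).2.1)
      (fun i => connMat a p i - connMat a' p i - (1 / (2 * normSq a' b' p))
        • ((raise a' p (sVec a' b' p) i) • a' p + (raise a' p (b' p) i) • rMat a' b' p))
      (fun y hB => ?_)
    obtain ⟨P, hP⟩ := H (WithLp.toLp 2 y) hB
    have hy0 := ne_zero_of_dotProduct_pos (y := WithLp.toLp 2 y) hB
    refine ⟨P + kropinaRadial (quad (a' p) y) (b' p ⬝ᵥ y) (b' p ⬝ᵥ (a' p)⁻¹ *ᵥ b' p)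
          (r00 a' b' p (WithLp.toLp 2 y)) (b' p ⬝ᵥ (a' p)⁻¹ *ᵥ sMat a' b' p *ᵥ y)
        - qRadial q (Real.sqrt (quad (a p) y)) (b p ⬝ᵥ y) (b p ⬝ᵥ (a p)⁻¹ *ᵥ b p)
          (r00 a b p (WithLp.toLp 2 y)) (b p ⬝ᵥ (a p)⁻¹ *ᵥ sMat a b p *ᵥ y), fun i => ?_⟩
    have hi := hP i
    rw [(h _ hy0).2.2 i, h'.eq_of_sMat_eq ha' hb' hS' hB] at hi
    rw [hquad (WithLp.toLp 2 y) i]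
    simp only [Pi.add_apply, Pi.smul_apply, smul_eq_mul] at hi ⊢
    rw [← r00_eq_quad a b p (WithLp.toLp 2 y)]
    linear_combination hi
  refine ⟨hS, hS', ?_⟩
  obtain ⟨w, hw⟩ := exists_linear_of_half_space (R := rMat a b p) (q := q) hn ha hb hbc
    (fun y hy => (h _ (hne y hy)).2.1)
    (fun i => connMat a p i - connMat a' p i - (1 / (2 * normSq a' b' p))
        • ((raise a' p (sVec a' b' p) i) • a' p + (raise a' p (b' p) i) • rMat a' b' p))
    (fun y hB => by
      obtain ⟨P, hP⟩ := H (WithLp.toLp 2 y) hB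
      refine ⟨P - radialDiff q a a' b b' p (WithLp.toLp 2 y), fun i => ?_⟩
      have hi := (sprays_related_iff h h' ha' hb' hS hS' (y := WithLp.toLp 2 y) hB
        (P - radialDiff q a a' b b' p (WithLp.toLp 2 y)) i).1 (by rw [sub_add_cancel]; exact hP i)
      rw [hquad (WithLp.toLp 2 y) i]
      rw [qForce, raise_eq_mulVec, normSq_eq_dotProduct, r00_eq_quad] at hi
      linear_combination hi)
  refine ⟨w, fun y hy i => ?_⟩
  have hi := hw y.ofLp (fun h0 => hy (by rw [← WithLp.toLp_ofLp 2 y, h0]; rfl)) i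
  rw [hquad y i] at hi
  rw [qForce, raise_eq_mulVec, normSq_eq_dotProduct, r00_eq_quad]
  linear_combination hi

end Pointwise

/-! ### Passing from the manifold to chart components. -/

section ChartExpressions

variable {n : ℕ} {M : Type*} [TopologicalSpace M]
  [ChartedSpace (EuclideanSpace ℝ (Fin n)) M] [IsManifold (𝓡 n) ∞ M]
  {e e' : OpenPartialHomeomorph M (EuclideanSpace ℝ (Fin n))}
  {p : EuclideanSpace ℝ (Fin n)} {q : ℝ}

theorem OneForm.apply_coordVec (β : OneForm n M)
    (e : OpenPartialHomeomorph M (EuclideanSpace ℝ (Fin n))) (p y : EuclideanSpace ℝ (Fin n)) :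
    β.toFun (e.symm p) (coordVec e p y) = β.comp e p ⬝ᵥ y.ofLp := by
  rw [dotProduct_comm]
  exact map_eq_sum ((β.toFun (e.symm p)).comp (mfderiv (𝓡 n) (𝓡 n) e.symm p)) y

theorem Metric.inner_coordVec (a : Metric n M)
    (e : OpenPartialHomeomorph M (EuclideanSpace ℝ (Fin n))) (p u v : EuclideanSpace ℝ (Fin n)) :
    a.inner (e.symm p) (coordVec e p u) (coordVec e p v) = u.ofLp ⬝ᵥ a.comp e p *ᵥ v.ofLp := by
  have h1 : ∀ u v : EuclideanSpace ℝ (Fin n),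
      a.inner (e.symm p) (coordVec e p u) (coordVec e p v) = ∑ k, v.ofLp k
        * a.inner (e.symm p) (coordVec e p u) (coordVec e p (EuclideanSpace.single k 1)) :=
    fun u v => map_eq_sum ((a.inner (e.symm p) (coordVec e p u)).comp
      (mfderiv (𝓡 n) (𝓡 n) e.symm p)) v
  rw [a.symm, h1]
  refine Finset.sum_congr rfl fun i _ => ?_
  rw [a.symm, h1]
  congr 1
  refine Finset.sum_congr rfl fun j _ => ?_
  rw [mul_comm]
  rfl

theorem Metric.isSymm_comp (a : Metric n M)
    (e : OpenPartialHomeomorph M (EuclideanSpace ℝ (Fin n))) (p : EuclideanSpace ℝ (Fin n)) :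
    (a.comp e p).IsSymm := by
  ext i j
  exact a.symm _ _ _

theorem Metric.posDef_comp (a : Metric n M) (he : e ∈ IsManifold.maximalAtlas (𝓡 n) ∞ M)
    (hp : p ∈ e.target) : (a.comp e p).PosDef := by
  refine Matrix.PosDef.of_dotProduct_mulVec_pos ?_ fun x hx => ?_
  · rw [Matrix.IsHermitian, Matrix.conjTranspose_eq_transpose_of_trivial]
    exact a.isSymm_comp e p
  · have hx' : WithLp.toLp 2 x ≠ 0 := fun h0 => hx (congrArg WithLp.ofLp h0)
    have := a.pos _ _ (coordVec_ne_zero he hp hx')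
    rw [a.inner_coordVec] at this
    simpa using this

theorem Metric.inner_self_nonneg (a : Metric n M) (x : M) (v : TangentSpace (𝓡 n) x) :
    0 ≤ a.inner x v v := by
  by_cases hv : v = 0
  · simp [hv]
  · exact (a.pos x v hv).le

theorem Metric.quad_comp_nonneg (a : Metric n M)
    (e : OpenPartialHomeomorph M (EuclideanSpace ℝ (Fin n))) (p y : EuclideanSpace ℝ (Fin n)) :
    0 ≤ quad (a.comp e p) y.ofLp := by
  rw [quad, ← a.inner_coordVec]
  exact a.inner_self_nonneg _ _

theorem Metric.localExpr_norm (a : Metric n M)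
    (e : OpenPartialHomeomorph M (EuclideanSpace ℝ (Fin n))) (p y : EuclideanSpace ℝ (Fin n)) :
    localExpr a.norm e p y = Real.sqrt (quad (a.comp e p) y.ofLp) := by
  rw [localExpr, Metric.norm, a.inner_coordVec]
  rfl

theorem Metric.localExpr_norm_sq (a : Metric n M)
    (e : OpenPartialHomeomorph M (EuclideanSpace ℝ (Fin n))) (p y : EuclideanSpace ℝ (Fin n)) :
    localExpr a.norm e p y ^ 2 = quad (a.comp e p) y.ofLp := by
  rw [a.localExpr_norm, Real.sq_sqrt (a.quad_comp_nonneg e p y)]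

theorem OneForm.comp_ne_zero {β : OneForm n M} (hβ : ∀ x, β.toFun x ≠ 0)
    (he : e ∈ IsManifold.maximalAtlas (𝓡 n) ∞ M) (hp : p ∈ e.target) : β.comp e p ≠ 0 := by
  intro h0
  refine hβ (e.symm p) (ContinuousLinearMap.ext fun v => ?_)
  have h1 := (mdifferentiable_of_mem_maximalAtlas he).symm.mfderiv_surjective hp
  obtain ⟨y, hy⟩ := h1 v
  rw [← hy]
  have := β.apply_coordVec e p y
  rw [h0, zero_dotProduct] at this
  exact this

theorem Metric.differentiableAt_comp (a : Metric n M)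
    (he : e ∈ IsManifold.maximalAtlas (𝓡 n) ∞ M) (hp : p ∈ e.target) (i j : Fin n) :
    DifferentiableAt ℝ (fun x => a.comp e x i j) p :=
  ((a.contDiffOn_comp he i j).contDiffAt (e.open_target.mem_nhds hp)).differentiableAt (by simp)

theorem OneForm.differentiableAt_comp (β : OneForm n M)
    (he : e ∈ IsManifold.maximalAtlas (𝓡 n) ∞ M) (hp : p ∈ e.target) (i : Fin n) :
    DifferentiableAt ℝ (fun x => β.comp e x i) p :=
  ((β.contDiffOn_comp he i).contDiffAt (e.open_target.mem_nhds hp)).differentiableAt (by simp)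

theorem sprayCoeff_localExpr_norm (a : Metric n M) (he : e ∈ IsManifold.maximalAtlas (𝓡 n) ∞ M)
    (hp : p ∈ e.target) (y : EuclideanSpace ℝ (Fin n)) (i : Fin n) :
    sprayCoeff (localExpr a.norm e) p y i = conn (a.comp e) p y i :=
  sprayCoeff_norm (a.isSymm_comp e) (a.differentiableAt_comp he hp) (a.posDef_comp he hp)
    (Filter.Eventually.of_forall fun x v => a.localExpr_norm_sq e x v) i

theorem hasQSpray_comp (hn : 3 ≤ n) (hq0 : q ≠ 0) (hq1 : q ≠ 1) {a : Metric n M} {β : OneForm n M}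
    (hF : IsQAlphaBetaMetric q a β) (he : e ∈ IsManifold.maximalAtlas (𝓡 n) ∞ M)
    (hp : p ∈ e.target) :
    HasQSpray q (a.comp e) (β.comp e) p (sprayCoeff (localExpr (qMetric q a β) e) p) := by
  intro y hy
  refine sprayCoeff_qMetric hn hq0 hq1 (a.isSymm_comp e) (a.differentiableAt_comp he hp)
    (β.differentiableAt_comp he hp) (a.posDef_comp he hp) hy ?_
    (Filter.Eventually.of_forall fun x v => ?_) (hF.isFinsler.posDef e he p hp y hy)
  · have h1 := hF.norm_lt_one _ _ (coordVec_ne_zero he hp hy)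
    rw [β.apply_coordVec] at h1
    rw [← a.localExpr_norm, localExpr]
    linarith [neg_abs_le (β.comp e p ⬝ᵥ y.ofLp)]
  · rw [← a.localExpr_norm, ← β.apply_coordVec]
    rfl

theorem hasKropinaSpray_comp {a : Metric n M} {β : OneForm n M} (hβ : ∀ x, β.toFun x ≠ 0)
    (he : e ∈ IsManifold.maximalAtlas (𝓡 n) ∞ M) (hp : p ∈ e.target) :
    HasKropinaSpray (a.comp e) (β.comp e) p (sprayCoeff (localExpr (kropina a β) e) p) := by
  intro y hB i
  refine sprayCoeff_kropina (a.isSymm_comp e) (a.differentiableAt_comp he hp)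
    (β.differentiableAt_comp he hp) (a.posDef_comp he hp) hB.ne'
    (dotProduct_inv_mulVec_pos (a.posDef_comp he hp) (OneForm.comp_ne_zero hβ he hp)).ne'
    (Filter.Eventually.of_forall fun x v => ?_) i
  rw [← a.localExpr_norm_sq, ← β.apply_coordVec]
  rfl

theorem Metric.inner_transition (a : Metric n M) (he : e ∈ IsManifold.maximalAtlas (𝓡 n) ∞ M)
    (he' : e' ∈ IsManifold.maximalAtlas (𝓡 n) ∞ M) (hp : p ∈ e.target) (hp' : e.symm p ∈ e'.source)
    (u v : EuclideanSpace ℝ (Fin n)) :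
    u.ofLp ⬝ᵥ a.comp e p *ᵥ v.ofLp = (fderiv ℝ (transition e e') p u).ofLp
      ⬝ᵥ a.comp e' (transition e e' p) *ᵥ (fderiv ℝ (transition e e') p v).ofLp := by
  rw [← a.inner_coordVec, ← a.inner_coordVec]
  have h : ∀ {x x' : M} (_ : x = x') {u v : TangentSpace (𝓡 n) x} {u' v' : TangentSpace (𝓡 n) x'}
      (_ : (u : EuclideanSpace ℝ (Fin n)) = u') (_ : (v : EuclideanSpace ℝ (Fin n)) = v'),
      a.inner x u v = a.inner x' u' v' := by
    intro x x' hx u v u' v' hu hv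
    subst hx
    exact congrArg₂ (fun u v => a.inner x u v) hu hv
  exact h (e'.left_inv hp').symm (coordVec_transition he he' hp hp' u).symm
    (coordVec_transition he he' hp hp' v).symm

theorem OneForm.comp_transition (β : OneForm n M) (he : e ∈ IsManifold.maximalAtlas (𝓡 n) ∞ M)
    (he' : e' ∈ IsManifold.maximalAtlas (𝓡 n) ∞ M) (hp : p ∈ e.target) (hp' : e.symm p ∈ e'.source)
    (u : EuclideanSpace ℝ (Fin n)) :
    β.comp e p ⬝ᵥ u.ofLp
      = β.comp e' (transition e e' p) ⬝ᵥ (fderiv ℝ (transition e e') p u).ofLp := by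
  rw [← β.apply_coordVec, ← β.apply_coordVec]
  exact localExpr_transition (fun x v => β.toFun x v) he he' hp hp' u

theorem fderiv_transition_surjective (he : e ∈ IsManifold.maximalAtlas (𝓡 n) ∞ M)
    (he' : e' ∈ IsManifold.maximalAtlas (𝓡 n) ∞ M) (hp : p ∈ e.target)
    (hp' : e.symm p ∈ e'.source) : Function.Surjective (fderiv ℝ (transition e e') p) := by
  have hi : Function.Injective
      (fderiv ℝ (transition e e') p : EuclideanSpace ℝ (Fin n) →ₗ[ℝ] EuclideanSpace ℝ (Fin n)) := by
    intro u v huv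
    apply coordVec_injective he hp
    have hu := coordVec_transition he he' hp hp' u
    have hv := coordVec_transition he he' hp hp' v
    have huv' : fderiv ℝ (transition e e') p u = fderiv ℝ (transition e e') p v := huv
    rw [huv'] at hu
    exact hu.symm.trans hv
  exact LinearMap.injective_iff_surjective.1 hi

theorem compatible_comp (a : Metric n M) (β : OneForm n M)
    (he : e ∈ IsManifold.maximalAtlas (𝓡 n) ∞ M) (he' : e' ∈ IsManifold.maximalAtlas (𝓡 n) ∞ M)
    (hp : p ∈ e.target) (hp' : e.symm p ∈ e'.source) :
    Compatible (a.comp e) (a.comp e') (β.comp e) (β.comp e') (transition e e') p := by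
  have hq : transition e e' p ∈ e'.target := e'.map_source hp'
  have hev : ∀ᶠ x in 𝓝 p, x ∈ e.target ∧ e.symm x ∈ e'.source :=
    (e.open_target.mem_nhds hp |> Filter.eventually_mem_set.2).and
      ((e.symm.continuousAt hp).eventually_mem (e'.open_source.mem_nhds hp'))
  exact
    { contDiffAt := contDiffAt_transition he he' hp hp'
      surjective := fderiv_transition_surjective he he' hp hp'
      metric := hev.mono fun x hx => a.inner_transition he he' hx.1 hx.2
      form := hev.mono fun x hx => β.comp_transition he he' hx.1 hx.2
      symm := a.isSymm_comp e
      symm' := a.isSymm_comp e'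
      posDef := a.posDef_comp he hp
      posDef' := a.posDef_comp he' hq
      diff := a.differentiableAt_comp he hp
      diff' := a.differentiableAt_comp he' hq
      diffForm := β.differentiableAt_comp he hp
      diffForm' := β.differentiableAt_comp he' hq }

/-- Every ingredient (α², β, b², r_00, s_0) is a scalar, so the projective factor does not depend on
the chart. -/
theorem radialDiff_transition (q : ℝ) (a a' : Metric n M) (β β' : OneForm n M)
    (he : e ∈ IsManifold.maximalAtlas (𝓡 n) ∞ M) (he' : e' ∈ IsManifold.maximalAtlas (𝓡 n) ∞ M)
    (hp : p ∈ e.target) (hp' : e.symm p ∈ e'.source) (y : EuclideanSpace ℝ (Fin n)) :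
    radialDiff q (a.comp e) (a'.comp e) (β.comp e) (β'.comp e) p y
      = radialDiff q (a.comp e') (a'.comp e') (β.comp e') (β'.comp e') (transition e e' p)
        (fderiv ℝ (transition e e') p y) := by
  have h := compatible_comp a β he he' hp hp'
  have h' := compatible_comp a' β' he he' hp hp'
  have hA : ∀ a : Metric n M, quad (a.comp e p) y.ofLp
      = quad (a.comp e' (transition e e' p)) (fderiv ℝ (transition e e') p y).ofLp :=
    fun a => a.inner_transition he he' hp hp' y y
  rw [radialDiff, radialDiff, hA a, hA a', β.comp_transition he he' hp hp',
    β'.comp_transition he he' hp hp', h.normSq_eq, h'.normSq_eq, h.r00_transition,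
    h'.r00_transition, h'.sZero_transition]

/-- An open half space spans: w itself lies in it, and adding a large multiple of w brings any
vector into it. -/
theorem eq_zero_of_half_space {w : Fin n → ℝ} (hw : w ≠ 0)
    {L : EuclideanSpace ℝ (Fin n) →L[ℝ] ℝ}
    (h : ∀ y : EuclideanSpace ℝ (Fin n), 0 < w ⬝ᵥ y.ofLp → L y = 0) : L = 0 := by
  have hw2 : 0 < w ⬝ᵥ w := by
    have := Matrix.dotProduct_star_self_pos_iff.2 hw
    simpa using this
  have h0 : L (WithLp.toLp 2 w) = 0 := h _ hw2
  ext y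
  have h1 := h (y + ((1 + |w ⬝ᵥ y.ofLp|) / (w ⬝ᵥ w)) • WithLp.toLp 2 w) (by
    simp only [WithLp.ofLp_add, WithLp.ofLp_smul, dotProduct_add, dotProduct_smul, smul_eq_mul]
    rw [div_mul_cancel₀ _ hw2.ne']
    linarith [neg_abs_le (w ⬝ᵥ y.ofLp)])
  rw [map_add, map_smul, h0, smul_zero, add_zero] at h1
  simpa using h1

end ChartExpressions

/-! ### Smooth dependence of the reduced sprays on the point. -/

section Smoothness

variable {n : ℕ} {U : Set (EuclideanSpace ℝ (Fin n))}
  {a : EuclideanSpace ℝ (Fin n) → Matrix (Fin n) (Fin n) ℝ}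
  {b : EuclideanSpace ℝ (Fin n) → Fin n → ℝ} {q : ℝ}

theorem contDiffOn_partialDeriv (hU : IsOpen U) {f : EuclideanSpace ℝ (Fin n) → ℝ}
    (hf : ContDiffOn ℝ ∞ f U) (k : Fin n) : ContDiffOn ℝ ∞ (fun x => partialDeriv f k x) U :=
  (hf.fderiv_of_isOpen hU (m := ∞) (by simp)).clm_apply contDiffOn_const

theorem contDiffOn_det (ha : ∀ i j, ContDiffOn ℝ ∞ (fun x => a x i j) U) :
    ContDiffOn ℝ ∞ (fun x => (a x).det) U := by
  simp only [Matrix.det_apply']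
  exact ContDiffOn.sum fun σ _ => contDiffOn_const.mul (contDiffOn_prod fun i _ => ha _ _)

/-- Cramer's rule writes each entry as a quotient of determinants with smooth entries. -/
theorem contDiffOn_inv (ha : ∀ i j, ContDiffOn ℝ ∞ (fun x => a x i j) U)
    (hp : ∀ x ∈ U, (a x).PosDef) (i j : Fin n) : ContDiffOn ℝ ∞ (fun x => (a x)⁻¹ i j) U := by
  have h : ∀ x, (a x)⁻¹ i j = ((a x).det)⁻¹ * ((a x).updateRow j (Pi.single i 1)).det := by
    intro x
    rw [Matrix.inv_def, Matrix.smul_apply, Matrix.adjugate_apply, Ring.inverse_eq_inv', smul_eq_mul]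
  simp only [h]
  refine ((contDiffOn_det ha).inv fun x hx => (hp x hx).det_pos.ne').mul (contDiffOn_det ?_)
  intro k l
  by_cases hk : k = j
  · subst hk
    simp only [Matrix.updateRow_self]
    exact contDiffOn_const
  · simp only [Matrix.updateRow_ne hk]
    exact ha k l

variable (hU : IsOpen U) (ha : ∀ i j, ContDiffOn ℝ ∞ (fun x => a x i j) U)
  (hp : ∀ x ∈ U, (a x).PosDef) (hb : ∀ i, ContDiffOn ℝ ∞ (fun x => b x i) U)
include hU ha hp

theorem contDiffOn_christoffel (k i j : Fin n) :
    ContDiffOn ℝ ∞ (fun x => christoffel a x k i j) U :=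
  contDiffOn_const.mul (ContDiffOn.sum fun l _ => (contDiffOn_inv ha hp k l).mul
    (((contDiffOn_partialDeriv hU (ha j l) i).add (contDiffOn_partialDeriv hU (ha i l) j)).sub
      (contDiffOn_partialDeriv hU (ha i j) l)))

theorem contDiffOn_conn (y : EuclideanSpace ℝ (Fin n)) (i : Fin n) :
    ContDiffOn ℝ ∞ (fun x => conn a x y i) U := by
  simp only [conn, quad_eq_sum, connMat]
  exact ContDiffOn.sum fun j _ => ContDiffOn.sum fun k _ =>
    ((contDiffOn_const.mul (contDiffOn_christoffel hU ha hp i j k)).mul contDiffOn_const).mul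
      contDiffOn_const

omit hU hp in
theorem contDiffOn_quad (y : Fin n → ℝ) : ContDiffOn ℝ ∞ (fun x => quad (a x) y) U := by
  simp only [quad_eq_sum]
  exact ContDiffOn.sum fun j _ => ContDiffOn.sum fun k _ =>
    ((ha j k).mul contDiffOn_const).mul contDiffOn_const

omit hU in
theorem contDiffOn_raise {w : EuclideanSpace ℝ (Fin n) → Fin n → ℝ}
    (hw : ∀ i, ContDiffOn ℝ ∞ (fun x => w x i) U) (i : Fin n) :
    ContDiffOn ℝ ∞ (fun x => raise a x (w x) i) U :=
  ContDiffOn.sum fun j _ => (contDiffOn_inv ha hp i j).mul (hw j)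

include hb

omit hU in
theorem contDiffOn_normSq : ContDiffOn ℝ ∞ (fun x => normSq a b x) U :=
  ContDiffOn.sum fun i _ => (contDiffOn_raise ha hp hb i).mul (hb i)

theorem contDiffOn_covDeriv (i j : Fin n) : ContDiffOn ℝ ∞ (fun x => covDeriv a b x i j) U :=
  (contDiffOn_partialDeriv hU (hb i) j).sub
    (ContDiffOn.sum fun k _ => (contDiffOn_christoffel hU ha hp k i j).mul (hb k))

theorem contDiffOn_r00 (y : EuclideanSpace ℝ (Fin n)) : ContDiffOn ℝ ∞ (fun x => r00 a b x y) U :=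
  ContDiffOn.sum fun i _ => ContDiffOn.sum fun j _ => ((contDiffOn_const.mul
    ((contDiffOn_covDeriv hU ha hp hb i j).add (contDiffOn_covDeriv hU ha hp hb j i))).mul
      contDiffOn_const).mul contDiffOn_const

theorem contDiffOn_sVec (j : Fin n) : ContDiffOn ℝ ∞ (fun x => sVec a b x j) U :=
  ContDiffOn.sum fun i _ => (contDiffOn_raise ha hp hb i).mul (contDiffOn_const.mul
    ((contDiffOn_covDeriv hU ha hp hb i j).sub (contDiffOn_covDeriv hU ha hp hb j i)))

theorem contDiffOn_kropinaForce (hb0 : ∀ x ∈ U, b x ≠ 0) (y : EuclideanSpace ℝ (Fin n))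
    (i : Fin n) : ContDiffOn ℝ ∞ (fun x => kropinaForce a b x y i) U := by
  refine (contDiffOn_const.div (contDiffOn_const.mul (contDiffOn_normSq ha hp hb))
    fun x hx => ?_).mul (((contDiffOn_quad ha _).mul
      (contDiffOn_raise ha hp (contDiffOn_sVec hU ha hp hb) i)).add
      ((contDiffOn_r00 hU ha hp hb y).mul (contDiffOn_raise ha hp hb i)))
  rw [normSq_eq_dotProduct]
  exact mul_ne_zero two_ne_zero (dotProduct_inv_mulVec_pos (hp x hx) (hb0 x hx)).ne'

theorem contDiffOn_qForce {y : EuclideanSpace ℝ (Fin n)} (hy : y ≠ 0)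
    (hΔ : ∀ x ∈ U, denom q (Real.sqrt (quad (a x) y.ofLp)) (b x ⬝ᵥ y.ofLp) (normSq a b x) ≠ 0)
    (i : Fin n) : ContDiffOn ℝ ∞ (fun x => qForce q a b x y i) U := by
  have hα : ContDiffOn ℝ ∞ (fun x => Real.sqrt (quad (a x) y.ofLp)) U :=
    (contDiffOn_quad ha _).sqrt fun x hx =>
      (quad_pos (hp x hx) fun h0 => hy (by rw [← WithLp.toLp_ofLp 2 y, h0]; rfl)).ne'
  have hB : ContDiffOn ℝ ∞ (fun x => b x ⬝ᵥ y.ofLp) U :=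
    ContDiffOn.sum fun i _ => (hb i).mul contDiffOn_const
  have hN := contDiffOn_normSq ha hp hb
  refine (contDiffOn_const.mul (ContDiffOn.div ((contDiffOn_const.mul (hα.pow 2)).mul
    (contDiffOn_r00 hU ha hp hb y)) ?_ hΔ)).mul (contDiffOn_raise ha hp hb i)
  unfold denom
  exact ((contDiffOn_const.mul (hB.pow 2)).add ((contDiffOn_const.mul hα).mul hB)).add
    ((contDiffOn_const.add (contDiffOn_const.mul hN)).mul (hα.pow 2))

end Smoothness

/-! ### Gluing the local linear forms into θ, and the converse. -/

section Characterization

variable {n : ℕ} {M : Type*} [TopologicalSpace M]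
  [ChartedSpace (EuclideanSpace ℝ (Fin n)) M] [IsManifold (𝓡 n) ∞ M] {q : ℝ}
  {a a' : Metric n M} {β β' : OneForm n M}

/-- The components of the 1-form `θ` in the chart `e`. -/
noncomputable def thetaComp (q : ℝ) (a a' : Metric n M) (β β' : OneForm n M)
    (e : OpenPartialHomeomorph M (EuclideanSpace ℝ (Fin n))) (p : EuclideanSpace ℝ (Fin n))
    (j : Fin n) : ℝ :=
  conn (a.comp e) p (EuclideanSpace.single j 1) j
    + qForce q (a.comp e) (β.comp e) p (EuclideanSpace.single j 1) j
    - (conn (a'.comp e) p (EuclideanSpace.single j 1) j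
      + kropinaForce (a'.comp e) (β'.comp e) p (EuclideanSpace.single j 1) j)

theorem reduced_sprays_iff {θ : OneForm n M}
    {e : OpenPartialHomeomorph M (EuclideanSpace ℝ (Fin n))}
    (he : e ∈ IsManifold.maximalAtlas (𝓡 n) ∞ M) {p : EuclideanSpace ℝ (Fin n)}
    (hp : p ∈ e.target) (y : EuclideanSpace ℝ (Fin n)) (i : Fin n) :
    sprayCoeff (localExpr a.norm e) p y i
              + (1 / 2) * (q * (q - 1) * localExpr a.norm e p y ^ 2
                    * r00 (a.comp e) (β.comp e) p y
                  / ((1 - q ^ 2) * localExpr (fun x v => β.toFun x v) e p y ^ 2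
                    + (2 - q) * localExpr a.norm e p y
                        * localExpr (fun x v => β.toFun x v) e p y
                    + (1 + q * (q - 1) * normSq (a.comp e) (β.comp e) p)
                        * localExpr a.norm e p y ^ 2))
                * raise (a.comp e) p (β.comp e p) i
            = sprayCoeff (localExpr a'.norm e) p y i
              + 1 / (2 * normSq (a'.comp e) (β'.comp e) p)
                * (localExpr a'.norm e p y ^ 2
                      * raise (a'.comp e) p (sVec (a'.comp e) (β'.comp e) p) i
                    + r00 (a'.comp e) (β'.comp e) p y
                      * raise (a'.comp e) p (β'.comp e p) i)
              + localExpr (fun x v => θ.toFun x v) e p y * y i ↔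
    conn (a.comp e) p y i + qForce q (a.comp e) (β.comp e) p y i
      = conn (a'.comp e) p y i + kropinaForce (a'.comp e) (β'.comp e) p y i
        + localExpr (fun x v => θ.toFun x v) e p y * y i := by
  rw [sprayCoeff_localExpr_norm a he hp, sprayCoeff_localExpr_norm a' he hp,
    a'.localExpr_norm_sq, a.localExpr_norm,
    show localExpr (fun x v => β.toFun x v) e p y = β.comp e p ⬝ᵥ y.ofLp from
      β.apply_coordVec e p y]
  rfl

theorem conditions_of_projectivelyRelatedOn (hn : 3 ≤ n) (hq0 : q ≠ 0) (hq1 : q ≠ 1)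
    (hF : IsQAlphaBetaMetric q a β) (hβ : ∀ x, β.toFun x ≠ 0) (hβ' : ∀ x, β'.toFun x ≠ 0)
    (hcol : ∀ x, ∃ c : ℝ, β.toFun x = c • β'.toFun x)
    (H : ProjectivelyRelatedOn (fun x => {v | 0 < β'.toFun x v}) (qMetric q a β) (kropina a' β')) :
    (∃ θ : OneForm n M, ∀ e ∈ IsManifold.maximalAtlas (𝓡 n) ∞ M, ∀ p ∈ e.target,
      ∀ y : EuclideanSpace ℝ (Fin n), y ≠ 0 → ∀ i : Fin n,
        conn (a.comp e) p y i + qForce q (a.comp e) (β.comp e) p y i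
          = conn (a'.comp e) p y i + kropinaForce (a'.comp e) (β'.comp e) p y i
            + localExpr (fun x v => θ.toFun x v) e p y * y i) ∧
    ∀ e ∈ IsManifold.maximalAtlas (𝓡 n) ∞ M, ∀ p ∈ e.target,
      sMat (a.comp e) (β.comp e) p = 0 ∧ ∀ i j, sMat (a'.comp e) (β'.comp e) p i j
        = 1 / normSq (a'.comp e) (β'.comp e) p
          * (β'.comp e p i * sVec (a'.comp e) (β'.comp e) p j
            - β'.comp e p j * sVec (a'.comp e) (β'.comp e) p i) := by
  obtain ⟨P, hP⟩ := H
  have hD : ∀ (e : OpenPartialHomeomorph M (EuclideanSpace ℝ (Fin n)))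
      (p y : EuclideanSpace ℝ (Fin n)), 0 < β'.comp e p ⬝ᵥ y.ofLp →
      coordVec e p y ∈ {v | 0 < β'.toFun (e.symm p) v} := by
    intro e p y hy
    rw [← β'.apply_coordVec] at hy
    exact hy
  have hlocal : ∀ e ∈ IsManifold.maximalAtlas (𝓡 n) ∞ M, ∀ p ∈ e.target,
      sMat (a.comp e) (β.comp e) p = 0 ∧ (∀ i j, sMat (a'.comp e) (β'.comp e) p i j
        = 1 / normSq (a'.comp e) (β'.comp e) p
          * (β'.comp e p i * sVec (a'.comp e) (β'.comp e) p j
            - β'.comp e p j * sVec (a'.comp e) (β'.comp e) p i)) ∧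
      ∀ y : EuclideanSpace ℝ (Fin n), y ≠ 0 → ∀ i,
        conn (a.comp e) p y i + qForce q (a.comp e) (β.comp e) p y i
          = conn (a'.comp e) p y i + kropinaForce (a'.comp e) (β'.comp e) p y i
            + (thetaComp q a a' β β' e p ⬝ᵥ y.ofLp) * y i := by
    intro e he p hp
    obtain ⟨c, hc⟩ := hcol (e.symm p)
    obtain ⟨h1, h2, w, hw⟩ := conditions_of_related hn hq0 (a.isSymm_comp e) (a'.isSymm_comp e)
      (a.posDef_comp he hp) (a'.posDef_comp he hp) (OneForm.comp_ne_zero hβ he hp) (c := c)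
      (by
        ext i
        simp only [OneForm.comp, hc]
        rfl)
      (hasQSpray_comp hn hq0 hq1 hF he hp) (hasKropinaSpray_comp hβ' he hp)
      (fun y hy => ⟨_, hP e he p hp y (hD e p y hy)⟩)
    -- Component j of the identity at y = e_j reads off w_j, which shows that the pointwise form is
    -- given by a smooth formula.
    have hwθ : w = thetaComp q a a' β β' e p := by
      ext j
      have hj := hw (EuclideanSpace.single j 1) (by simp) j
      simp only [PiLp.ofLp_single, dotProduct_single, Pi.single_eq_same, mul_one] at hj
      rw [thetaComp, hj]
      ring
    exact ⟨h1, h2, hwθ ▸ hw⟩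
  refine ⟨?_, fun e he p hp => ⟨(hlocal e he p hp).1, (hlocal e he p hp).2.1⟩⟩
  have hPθ : ∀ e ∈ IsManifold.maximalAtlas (𝓡 n) ∞ M, ∀ p ∈ e.target,
      ∀ y : EuclideanSpace ℝ (Fin n), 0 < β'.comp e p ⬝ᵥ y.ofLp →
        thetaComp q a a' β β' e p ⬝ᵥ y.ofLp = localExpr P e p y
          - radialDiff q (a.comp e) (a'.comp e) (β.comp e) (β'.comp e) p y := by
    intro e he p hp y hy
    obtain ⟨h1, h2, h3⟩ := hlocal e he p hp
    have hy0 := ne_zero_of_dotProduct_pos hy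
    obtain ⟨i, hi⟩ : ∃ i, y i ≠ 0 := by
      by_contra hcon
      push Not at hcon
      exact hy0 (by ext i; simpa using hcon i)
    have h4 := (sprays_related_iff (hasQSpray_comp hn hq0 hq1 hF he hp)
      (hasKropinaSpray_comp hβ' he hp) (a'.posDef_comp he hp) (OneForm.comp_ne_zero hβ' he hp)
      h1 h2 hy _ i).2 (h3 y hy0 i)
    have h5 := hP e he p hp y (hD e p y hy) i
    have h6 := mul_right_cancel₀ hi (add_left_cancel (h4.symm.trans h5))
    linarith
  obtain ⟨θ, hθ⟩ := exists_oneForm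
    (fun e p => ∑ j, thetaComp q a a' β β' e p j
      • (EuclideanSpace.proj j : EuclideanSpace ℝ (Fin n) →L[ℝ] ℝ))
    (by
      intro e he e' he' p hp hp' y
      have hq' : transition e e' p ∈ e'.target := e'.map_source hp'
      -- The scalar P is controlled only where the barred form is positive, so the two coordinate
      -- expressions are compared there first; linearity does the rest.
      have hz := eq_zero_of_half_space (OneForm.comp_ne_zero hβ' he hp)
        (L := (∑ j, thetaComp q a a' β β' e p j
            • (EuclideanSpace.proj j : EuclideanSpace ℝ (Fin n) →L[ℝ] ℝ))
          - (∑ j, thetaComp q a a' β β' e' (transition e e' p) j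
            • (EuclideanSpace.proj j : EuclideanSpace ℝ (Fin n) →L[ℝ] ℝ)).comp
              (fderiv ℝ (transition e e') p))
        (by
          intro y hy
          have h1 := hPθ e he p hp y hy
          rw [β'.comp_transition he he' hp hp'] at hy
          have h2 := hPθ e' he' _ hq' _ hy
          rw [← localExpr_transition P he he' hp hp',
            ← radialDiff_transition q a a' β β' he he' hp hp', ← h1] at h2
          simp only [dotProduct] at h2
          simpa [sub_eq_zero] using h2.symm)
      exact sub_eq_zero.1 (DFunLike.congr_fun hz y))
    (by
      intro e he
      refine ContDiffOn.sum fun j _ => ?_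
      suffices h : ContDiffOn ℝ ∞ (fun p => thetaComp q a a' β β' e p j) e.target from
        h.smul contDiffOn_const
      have hj : (EuclideanSpace.single j (1 : ℝ) : EuclideanSpace ℝ (Fin n)) ≠ 0 := by simp
      refine ((contDiffOn_conn e.open_target (a.contDiffOn_comp he)
        (fun x hx => a.posDef_comp he hx) _ j).add
        (contDiffOn_qForce e.open_target (a.contDiffOn_comp he)
        (fun x hx => a.posDef_comp he hx) (β.contDiffOn_comp he) hj (fun x hx => ?_) j)).sub
        ((contDiffOn_conn e.open_target (a'.contDiffOn_comp he)
        (fun x hx => a'.posDef_comp he hx) _ j).add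
        (contDiffOn_kropinaForce e.open_target (a'.contDiffOn_comp he)
        (fun x hx => a'.posDef_comp he hx) (β'.contDiffOn_comp he)
        (fun x hx => OneForm.comp_ne_zero hβ' he hx) _ j))
      rw [normSq_eq_dotProduct]
      exact (hasQSpray_comp hn hq0 hq1 hF he hx _ hj).2.1)
  refine ⟨θ, fun e he p hp y hy i => ?_⟩
  rw [hθ e he p hp, (hlocal e he p hp).2.2 y hy i]
  simp [dotProduct]

theorem projectivelyRelatedOn_of_conditions (hn : 3 ≤ n) (hq0 : q ≠ 0) (hq1 : q ≠ 1)
    (hF : IsQAlphaBetaMetric q a β) (hβ' : ∀ x, β'.toFun x ≠ 0) (θ : OneForm n M)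
    (hθ : ∀ e ∈ IsManifold.maximalAtlas (𝓡 n) ∞ M, ∀ p ∈ e.target,
      ∀ y : EuclideanSpace ℝ (Fin n), y ≠ 0 → ∀ i : Fin n,
        conn (a.comp e) p y i + qForce q (a.comp e) (β.comp e) p y i
          = conn (a'.comp e) p y i + kropinaForce (a'.comp e) (β'.comp e) p y i
            + localExpr (fun x v => θ.toFun x v) e p y * y i)
    (hS : ∀ e ∈ IsManifold.maximalAtlas (𝓡 n) ∞ M, ∀ p ∈ e.target,
      sMat (a.comp e) (β.comp e) p = 0)
    (hS' : ∀ e ∈ IsManifold.maximalAtlas (𝓡 n) ∞ M, ∀ p ∈ e.target, ∀ i j,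
      sMat (a'.comp e) (β'.comp e) p i j = 1 / normSq (a'.comp e) (β'.comp e) p
          * (β'.comp e p i * sVec (a'.comp e) (β'.comp e) p j
            - β'.comp e p j * sVec (a'.comp e) (β'.comp e) p i)) :
    ProjectivelyRelatedOn (fun x => {v | 0 < β'.toFun x v}) (qMetric q a β) (kropina a' β') := by
  -- P has to be a function on the manifold, so the radial term is evaluated in the preferred chart
  -- at x; its invariance makes the formula valid in every chart.
  refine ⟨fun x v => θ.toFun x v
    + radialDiff q (a.comp (chartAt _ x)) (a'.comp (chartAt _ x)) (β.comp (chartAt _ x))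
      (β'.comp (chartAt _ x)) (chartAt (EuclideanSpace ℝ (Fin n)) x x)
      (mfderiv (𝓡 n) (𝓡 n) (chartAt (EuclideanSpace ℝ (Fin n)) x) x v),
    fun e he p hp y hy i => ?_⟩
  have hB : 0 < β'.comp e p ⬝ᵥ y.ofLp := by
    rw [← β'.apply_coordVec]
    exact hy
  have hs := mem_chart_source (EuclideanSpace ℝ (Fin n)) (e.symm p)
  have he' := IsManifold.chart_mem_maximalAtlas (I := 𝓡 n) (n := ∞) (e.symm p)
  have h1 := radialDiff_transition q a a' β β' he he' hp hs y
  rw [fderiv_transition_apply he he' hp hs] at h1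
  rw [(sprays_related_iff (hasQSpray_comp hn hq0 hq1 hF he hp)
      (hasKropinaSpray_comp hβ' he hp) (a'.posDef_comp he hp) (OneForm.comp_ne_zero hβ' he hp)
      (hS e he p hp) (hS' e he p hp) hB _ i).2 (hθ e he p hp y (ne_zero_of_dotProduct_pos hB) i), h1]
  rfl

end Characterization

end Finsler

open Finsler in
theorem mainTheorem3 {n : ℕ} (hn : 3 ≤ n) {M : Type*} [TopologicalSpace M]
    [ChartedSpace (EuclideanSpace ℝ (Fin n)) M] [IsManifold (𝓡 n) ∞ M]
    (q : ℝ) (hq0 : q ≠ 0) (hq1 : q ≠ 1)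
    (a a' : Metric n M) (β β' : OneForm n M)
    (hF : IsQAlphaBetaMetric q a β)
    (hβ : ∀ x, β.toFun x ≠ 0) (hβ' : ∀ x, β'.toFun x ≠ 0)
    (hcol : ∀ x, ∃ c : ℝ, β.toFun x = c • β'.toFun x) :
    ProjectivelyRelatedOn (fun x => {v | 0 < β'.toFun x v}) (qMetric q a β) (kropina a' β') ↔
      (∃ θ : OneForm n M,
        ∀ e ∈ IsManifold.maximalAtlas (𝓡 n) ∞ M, ∀ p ∈ e.target,
          ∀ y : EuclideanSpace ℝ (Fin n), y ≠ 0 → ∀ i : Fin n,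
            sprayCoeff (localExpr a.norm e) p y i
              + (1 / 2) * (q * (q - 1) * localExpr a.norm e p y ^ 2
                    * r00 (a.comp e) (β.comp e) p y
                  / ((1 - q ^ 2) * localExpr (fun x v => β.toFun x v) e p y ^ 2
                    + (2 - q) * localExpr a.norm e p y
                        * localExpr (fun x v => β.toFun x v) e p y
                    + (1 + q * (q - 1) * normSq (a.comp e) (β.comp e) p)
                        * localExpr a.norm e p y ^ 2))
                * raise (a.comp e) p (β.comp e p) i
            = sprayCoeff (localExpr a'.norm e) p y i
              + 1 / (2 * normSq (a'.comp e) (β'.comp e) p)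
                * (localExpr a'.norm e p y ^ 2
                      * raise (a'.comp e) p (sVec (a'.comp e) (β'.comp e) p) i
                    + r00 (a'.comp e) (β'.comp e) p y
                      * raise (a'.comp e) p (β'.comp e p) i)
              + localExpr (fun x v => θ.toFun x v) e p y * y i) ∧
      (∀ e ∈ IsManifold.maximalAtlas (𝓡 n) ∞ M, ∀ p ∈ e.target, ∀ i j : Fin n,
        sLow (a.comp e) (β.comp e) p i j = 0) ∧
      (∀ e ∈ IsManifold.maximalAtlas (𝓡 n) ∞ M, ∀ p ∈ e.target, ∀ i j : Fin n,
        sLow (a'.comp e) (β'.comp e) p i j =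
          1 / normSq (a'.comp e) (β'.comp e) p
            * (β'.comp e p i * sVec (a'.comp e) (β'.comp e) p j
              - β'.comp e p j * sVec (a'.comp e) (β'.comp e) p i)) := by
  constructor
  · intro H
    obtain ⟨⟨θ, hθ⟩, h⟩ := conditions_of_projectivelyRelatedOn hn hq0 hq1 hF hβ hβ' hcol H
    refine ⟨⟨θ, fun e he p hp y hy i => (reduced_sprays_iff he hp y i).2 (hθ e he p hp y hy i)⟩,
      fun e he p hp i j => ?_, fun e he p hp => (h e he p hp).2⟩
    exact congrFun (congrFun (h e he p hp).1 i) j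
  · rintro ⟨⟨θ, hθ⟩, hS, hS'⟩
    exact projectivelyRelatedOn_of_conditions hn hq0 hq1 hF hβ' θ
      (fun e he p hp y hy i => (reduced_sprays_iff he hp y i).1 (hθ e he p hp y hy i))
      (fun e he p hp => by ext i j; exact hS e he p hp i j) hS'
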